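/- Let $k$ be a field, let $S$ be a $k$-scheme and let $g\colon Y\to S$ be a flat morphism of schemes. For a $k$-scheme $T$, a $T$-scheme $X$ and an Artinian local $k$-algebra $A$ with residue field $k$, a \emph{$T$-deformation} of $X$ over $A$ is a scheme $\mathcal X$ with a closed immersion $X\hookrightarrow\mathcal X$ and a flat morphism $\mathcal X\to T\times_k\operatorname{Spec}A$ such that the square $$\begin{array}{ccc} X&\to&\mathcal X\\ \downarrow&&\downarrow\\ T&\to&T\times_k\operatorname{Spec}A\end{array}$$ is cartesian, where the lower morphism is induced by the residue map $A\to k$. An isomorphism of $T$-deformations is an isomorphism over $T\times_k\operatorname{Spec}A$ that is compatible with the closed immersions of $X$; let $D^T_X(A)$ be the set of isomorphism classes, which is functorial in $A$ by base change. On $D^T_X(k[\epsilon])$ the sum of the classes of $\mathcal X_1$ and $\mathcal X_2$ is the base change of the fibred sum $\mathcal X_1\cup_X\mathcal X_2$, a $T$-deformation of $X$ over $k[\epsilon]\times_k k[\epsilon]$, along the addition $k[\epsilon]\times_kk[\epsilon]\to k[\epsilon]$, $(a+b\epsilon,a+c\epsilon)\mapsto a+(b+c)\epsilon$, and multiplication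 by $c\in k$ is base change along $\epsilon\mapsto c\epsilon$. Then the functor $F\colon \mathrm{Sch}/S\to\mathrm{Sch}/Y$, $F(X)=X\times_SY$, is smooth in the following sense. (1) For every $S$-scheme $X$, every Artinian local $k$-algebra $A$ with residue field $k$ and every $S$-deformation $\mathcal X$ of $X$ over $A$, the scheme $\mathcal X\times_SY$, with the induced morphisms $X\times_SY\to\mathcal X\times_SY$ and $\mathcal X\times_SY\to Y\times_k\operatorname{Spec}A$, is a $Y$-deformation of $X\times_SY$ over $A$; and with the induced morphism $\mathcal X\times_SY\to S\times_k\operatorname{Spec}A$ it is an $S$-deformation of the $S$-scheme $X\times_SY$ over $A$. (2) For every flat $S$-scheme $X$, the operations above are well defined and make $D^S_X(k[\epsilon])$, $D^Y_{X\times_SY}(k[\epsilon])$ and $D^S_{X\times_SY}(k[\epsilon])$ into $k$-vector spaces, and $\mathcal X\mapsto\mathcal X\times_SY$ induces well-defined $k$-linear maps $$D^S_X(k[\epsilon])\to D^Y_{X\times_SY}(k[\epsilon]),\qquad D^S_X(k[\epsilon])\to D^S_{X\times_SY}(k[\epsilon]).$$ -/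

import Mathlib

open CategoryTheory Limits AlgebraicGeometry

universe u

namespace SmoothFunctor

noncomputable section

/-- `A` is an Artinian local `k`-algebra with residue field `k`. -/
class IsArtAlg (k A : Type u) [Field k] [CommRing A] [Algebra k A] : Prop
    extends IsLocalRing A, IsArtinianRing A where
  bijective_residue : Function.Bijective (algebraMap k (IsLocalRing.ResidueField A))

section Art

variable (k A B : Type u) [Field k] [CommRing A] [Algebra k A] [IsArtAlg k A]
  [CommRing B] [Algebra k B] [IsArtAlg k B]

/-- The augmentation `A → k`, i.e. the residue map of `A`. -/
def aug : A →ₐ[k] k :=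
  (AlgEquiv.ofBijective (Algebra.ofId k (IsLocalRing.ResidueField A))
      (IsArtAlg.bijective_residue (k := k) (A := A))).symm.toAlgHom.comp
    (IsScalarTower.toAlgHom k A (IsLocalRing.ResidueField A))

variable {k A B}

theorem algHom_eq_aug (ψ : A →ₐ[k] k) : ψ = aug k A := by
  have surj : ∀ χ : A →ₐ[k] k, Function.Surjective χ := fun χ c =>
    ⟨algebraMap k A c, by simp⟩
  have ker : ∀ χ : A →ₐ[k] k, RingHom.ker χ.toRingHom = IsLocalRing.maximalIdeal A := fun χ =>
    IsLocalRing.eq_maximalIdeal (RingHom.ker_isMaximal_of_surjective _ (surj χ))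
  ext a
  have h : a - algebraMap k A (aug k A a) ∈ RingHom.ker (aug k A).toRingHom := by
    rw [RingHom.mem_ker]; simp
  rw [ker, ← ker ψ, RingHom.mem_ker] at h
  simpa [sub_eq_zero] using h

theorem aug_comp (φ : A →ₐ[k] B) : (aug k B).comp φ = aug k A := algHom_eq_aug _

instance isArtAlg_trivSqZeroExt (V : Type u) [AddCommGroup V] [Module k V] [Module kᵐᵒᵖ V]
    [IsCentralScalar k V] [Module.Finite k V] : IsArtAlg k (TrivSqZeroExt k V) := by
  have hloc : IsLocalRing (TrivSqZeroExt k V) := by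
    refine IsLocalRing.of_nonunits_add fun a b ha hb => ?_
    simp only [mem_nonunits_iff, TrivSqZeroExt.isUnit_iff_isUnit_fst, isUnit_iff_ne_zero,
      not_not, TrivSqZeroExt.fst_add] at *
    simp [ha, hb]
  have hfin : Module.Finite k (TrivSqZeroExt k V) :=
    inferInstanceAs (Module.Finite k (k × V))
  have hart : IsArtinianRing (TrivSqZeroExt k V) := IsArtinianRing.of_finite k _
  refine { hloc, hart with bijective_residue := ⟨(algebraMap k _).injective, fun x => ?_⟩ }
  obtain ⟨a, rfl⟩ := IsLocalRing.residue_surjective x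
  refine ⟨a.fst, ?_⟩
  rw [IsScalarTower.algebraMap_apply k (TrivSqZeroExt k V)]
  change IsLocalRing.residue _ _ = _
  rw [← sub_eq_zero, ← map_sub, IsLocalRing.residue_eq_zero_iff, IsLocalRing.mem_maximalIdeal,
    mem_nonunits_iff, TrivSqZeroExt.isUnit_iff_isUnit_fst]
  simp [TrivSqZeroExt.algebraMap_eq_inl]

end Art

section Deformations

variable {k : Type u} [Field k] {S : Scheme.{u}} (s : S ⟶ Spec (.of k))

/-- The product `S ×ₖ Spec A`. -/
abbrev prodSpec (A : Type u) [CommRing A] [Algebra k A] : Scheme.{u} :=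
  pullback s (Spec.map (CommRingCat.ofHom (algebraMap k A)))

/-- The morphism `S ×ₖ Spec B ⟶ S ×ₖ Spec A` induced by `A → B`. -/
def prodSpecMap {A B : Type u} [CommRing A] [Algebra k A] [CommRing B] [Algebra k B]
    (φ : A →ₐ[k] B) : prodSpec s B ⟶ prodSpec s A :=
  pullback.lift (pullback.fst _ _)
    (pullback.snd _ _ ≫ Spec.map (CommRingCat.ofHom φ.toRingHom)) (by
      rw [pullback.condition, Category.assoc, ← Spec.map_comp, ← CommRingCat.ofHom_comp]
      congr 4
      exact φ.comp_algebraMap.symm)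

/-- The closed embedding `S ⟶ S ×ₖ Spec A` induced by `A → k`. -/
def closedPt (A : Type u) [CommRing A] [Algebra k A] [IsArtAlg k A] : S ⟶ prodSpec s A :=
  pullback.lift (𝟙 S) (s ≫ Spec.map (CommRingCat.ofHom (aug k A).toRingHom)) (by
    rw [Category.id_comp, Category.assoc, ← Spec.map_comp, ← CommRingCat.ofHom_comp]
    have : (aug k A).toRingHom.comp (algebraMap k A) = RingHom.id k :=
      (aug k A).comp_algebraMap
    rw [this]
    simp)

@[simp]
theorem prodSpecMap_fst {A B : Type u} [CommRing A] [Algebra k A] [CommRing B] [Algebra k B]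
    (φ : A →ₐ[k] B) : prodSpecMap s φ ≫ pullback.fst _ _ = pullback.fst _ _ :=
  pullback.lift_fst _ _ _

@[simp]
theorem closedPt_fst (A : Type u) [CommRing A] [Algebra k A] [IsArtAlg k A] :
    closedPt s A ≫ pullback.fst _ _ = 𝟙 S :=
  pullback.lift_fst _ _ _

theorem closedPt_map {A B : Type u} [CommRing A] [Algebra k A] [IsArtAlg k A]
    [CommRing B] [Algebra k B] [IsArtAlg k B] (φ : A →ₐ[k] B) :
    closedPt s B ≫ prodSpecMap s φ = closedPt s A := by
  apply pullback.hom_ext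
  · rw [Category.assoc, prodSpecMap_fst, closedPt_fst, closedPt_fst]
  · simp only [closedPt, prodSpecMap, Category.assoc, pullback.lift_snd,
      pullback.lift_snd_assoc]
    rw [← Spec.map_comp, ← CommRingCat.ofHom_comp, ← aug_comp φ]
    rfl

instance isClosedImmersion_closedPt (A : Type u) [CommRing A] [Algebra k A] [IsArtAlg k A] :
    IsClosedImmersion (closedPt s A) := by
  have : IsClosedImmersion (closedPt s A ≫ pullback.fst s
      (Spec.map (CommRingCat.ofHom (algebraMap k A)))) := by
    rw [closedPt_fst]; infer_instance
  exact IsClosedImmersion.of_comp _ (pullback.fst s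
      (Spec.map (CommRingCat.ofHom (algebraMap k A))))

/-- The morphisms `incl : X ⟶ Z` and `hom : Z ⟶ S ×ₖ Spec A` make `Z` an `S`-deformation
of the `S`-scheme `X` over `A`. -/
structure IsDeformation (X : Over S) (A : Type u) [CommRing A] [Algebra k A] [IsArtAlg k A]
    {Z : Scheme.{u}} (incl : X.left ⟶ Z) (hom : Z ⟶ prodSpec s A) : Prop where
  isClosedImmersion : IsClosedImmersion incl
  flat : Flat hom
  isPullback : IsPullback incl X.hom hom (closedPt s A)

/-- An `S`-deformation of the `S`-scheme `X` over `A`. -/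
structure Deformation (X : Over S) (A : Type u) [CommRing A] [Algebra k A] [IsArtAlg k A] where
  total : Scheme.{u}
  incl : X.left ⟶ total
  hom : total ⟶ prodSpec s A
  isDeformation : IsDeformation s X A incl hom

namespace Deformation

variable {s} {X : Over S} {A B : Type u} [CommRing A] [Algebra k A] [IsArtAlg k A]
  [CommRing B] [Algebra k B] [IsArtAlg k B]

/-- The total space of a deformation as an `S`-scheme. -/
abbrev toOver (D : Deformation s X A) : Over S := Over.mk (D.hom ≫ pullback.fst _ _)

/-- The inclusion `X ⟶ Z` as a morphism of `S`-schemes. -/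
def inclOver (D : Deformation s X A) : X ⟶ D.toOver :=
  Over.homMk D.incl (by
    change D.incl ≫ D.hom ≫ pullback.fst _ _ = X.hom
    rw [← Category.assoc, D.isDeformation.isPullback.w, Category.assoc, closedPt_fst,
      Category.comp_id])

/-- Isomorphism of deformations: over `S ×ₖ Spec A`, and inducing the identity on `X`. -/
instance setoid (s : S ⟶ Spec (.of k)) (X : Over S) (A : Type u) [CommRing A] [Algebra k A]
    [IsArtAlg k A] : Setoid (Deformation s X A) where
  r D E := ∃ e : D.total ≅ E.total, e.hom ≫ E.hom = D.hom ∧ D.incl ≫ e.hom = E.incl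
  iseqv :=
    { refl := fun D => ⟨Iso.refl _, by simp, by simp⟩
      symm := by
        rintro D E ⟨e, h₁, h₂⟩
        exact ⟨e.symm, by simp [← h₁], by simp [← h₂]⟩
      trans := by
        rintro D E F ⟨e, h₁, h₂⟩ ⟨e', h₁', h₂'⟩
        exact ⟨e ≪≫ e', by simp [h₁, h₁'], by simp [← h₂', ← h₂]⟩ }

/-- Base change of a deformation along a morphism `A → B`. -/
def baseChange (φ : A →ₐ[k] B) (D : Deformation s X A) : Deformation s X B where
  total := pullback D.hom (prodSpecMap s φ)
  incl := pullback.lift D.incl (X.hom ≫ closedPt s B) (by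
    rw [D.isDeformation.isPullback.w, Category.assoc, closedPt_map])
  hom := pullback.snd _ _
  isDeformation := by
    have hD := D.isDeformation
    have hw : D.incl ≫ D.hom = (X.hom ≫ closedPt s B) ≫ prodSpecMap s φ := by
      rw [hD.isPullback.w, Category.assoc, closedPt_map]
    have hp : IsPullback (pullback.lift D.incl (X.hom ≫ closedPt s B) hw) X.hom
        (pullback.snd D.hom (prodSpecMap s φ)) (closedPt s B) := by
      refine IsPullback.of_right ?_ (pullback.lift_snd _ _ _)
        (IsPullback.of_hasPullback D.hom (prodSpecMap s φ))
      rw [closedPt_map, pullback.lift_fst]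
      exact hD.isPullback
    have := hD.flat
    exact ⟨MorphismProperty.of_isPullback hp.flip inferInstance, inferInstance, hp⟩

end Deformation

/-- The set `D_X(A)` of isomorphism classes of `S`-deformations of `X` over `A`. -/
def DefClass (X : Over S) (A : Type u) [CommRing A] [Algebra k A] [IsArtAlg k A] : Type (u + 1) :=
  Quotient (Deformation.setoid s X A)

/-- The isomorphism class of a deformation. -/
def Deformation.cls {s : S ⟶ Spec (.of k)} {X : Over S} {A : Type u} [CommRing A] [Algebra k A]
    [IsArtAlg k A] (D : Deformation s X A) : DefClass s X A :=
  Quotient.mk _ D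

theorem exists_pullback_iso {W Z Z' P Q : Scheme.{u}} {f : Z ⟶ P} {f' : Z' ⟶ P} (m : Q ⟶ P)
    (e : Z ≅ Z') (h : e.hom ≫ f' = f) {a : W ⟶ Z} {a' : W ⟶ Z'} (ha : a ≫ e.hom = a')
    (b : W ⟶ Q) (w : a ≫ f = b ≫ m) (w' : a' ≫ f' = b ≫ m) :
    ∃ i : pullback f m ≅ pullback f' m, i.hom ≫ pullback.snd f' m = pullback.snd f m ∧
      pullback.lift a b w ≫ i.hom = pullback.lift a' b w' := by
  subst h ha
  have w₁ : (pullback.fst (e.hom ≫ f') m ≫ e.hom) ≫ f' = pullback.snd (e.hom ≫ f') m ≫ m := by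
    rw [Category.assoc, pullback.condition]
  have w₂ : (pullback.fst f' m ≫ e.inv) ≫ e.hom ≫ f' = pullback.snd f' m ≫ m := by
    rw [Category.assoc, e.inv_hom_id_assoc, pullback.condition]
  refine ⟨⟨pullback.lift _ _ w₁, pullback.lift _ _ w₂, ?_, ?_⟩, pullback.lift_snd _ _ _, ?_⟩
  all_goals
    apply pullback.hom_ext <;>
      simp [pullback.lift_fst, pullback.lift_snd, pullback.lift_fst_assoc]

/-- Functoriality of `D_X` in the Artinian algebra. -/
def DefClass.map {s : S ⟶ Spec (.of k)} {X : Over S} {A B : Type u} [CommRing A] [Algebra k A]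
    [IsArtAlg k A] [CommRing B] [Algebra k B] [IsArtAlg k B] (φ : A →ₐ[k] B) :
    DefClass s X A → DefClass s X B :=
  Quotient.map (Deformation.baseChange φ) (by
    rintro D E ⟨e, h₁, h₂⟩
    exact exists_pullback_iso (prodSpecMap s φ) e h₁ h₂ _ _ _)

end Deformations

section Tangent

open scoped DualNumber

variable (k : Type u) [Field k]

/-- The algebra `k[ε] ×ₖ k[ε] = k[ε₁, ε₂] / (ε₁, ε₂)²`, as the trivial square zero extension
of `k` by `k × k`. -/
abbrev DualSq : Type u := TrivSqZeroExt k (k × k)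

/-- The first projection `k[ε] ×ₖ k[ε] → k[ε]`. -/
def DualSq.proj₁ : DualSq k →ₐ[k] k[ε] := TrivSqZeroExt.map (LinearMap.fst k k k)

/-- The second projection `k[ε] ×ₖ k[ε] → k[ε]`. -/
def DualSq.proj₂ : DualSq k →ₐ[k] k[ε] := TrivSqZeroExt.map (LinearMap.snd k k k)

/-- The addition `k[ε] ×ₖ k[ε] → k[ε]`, `(a + b ε, a + c ε) ↦ a + (b + c) ε`. -/
def DualSq.sum : DualSq k →ₐ[k] k[ε] :=
  TrivSqZeroExt.map (LinearMap.fst k k k + LinearMap.snd k k k)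

variable {k}

/-- The endomorphism `a + b ε ↦ a + c b ε` of `k[ε]`. -/
def dualScale (c : k) : k[ε] →ₐ[k] k[ε] := TrivSqZeroExt.map (c • LinearMap.id)

variable {S : Scheme.{u}} {s : S ⟶ Spec (.of k)} {X : Over S}

/-- The deformation `Z` over `k[ε] ×ₖ k[ε]` is the fibred sum `D₁ ∪_X D₂` of two first order
deformations along `X`. -/
def IsGluing (D₁ D₂ : Deformation s X k[ε]) (Z : Deformation s X (DualSq k)) : Prop :=
  ∃ (i₁ : D₁.total ⟶ Z.total) (i₂ : D₂.total ⟶ Z.total),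
    IsPushout D₁.incl D₂.incl i₁ i₂ ∧ D₁.incl ≫ i₁ = Z.incl ∧
    i₁ ≫ Z.hom = D₁.hom ≫ prodSpecMap s (DualSq.proj₁ k) ∧
    i₂ ≫ Z.hom = D₂.hom ≫ prodSpecMap s (DualSq.proj₂ k)

/-- The class `c` is the sum of `a` and `b`: it is obtained from the fibred sum along `X` of
representatives of `a` and `b` by base change along the addition `k[ε] ×ₖ k[ε] → k[ε]`. -/
def IsSum (a b c : DefClass s X k[ε]) : Prop :=
  ∃ (D₁ D₂ : Deformation s X k[ε]) (Z : Deformation s X (DualSq k)),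
    D₁.cls = a ∧ D₂.cls = b ∧ IsGluing D₁ D₂ Z ∧ (Z.baseChange (DualSq.sum k)).cls = c

variable (s X) in
/-- A `k`-vector space structure on `D_X(k[ε])` is the tangent space structure if its addition
is the one by fibred sums and its scalar multiplication is the one induced by `ε ↦ c ε`.
There is at most one such structure. -/
structure IsTangentSpace [AddCommGroup (DefClass s X k[ε])] [Module k (DefClass s X k[ε])] :
    Prop where
  add_eq_iff : ∀ a b c : DefClass s X k[ε], a + b = c ↔ IsSum a b c
  smul_eq : ∀ (c : k) (a : DefClass s X k[ε]), c • a = a.map (dualScale c)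

end Tangent

section Smooth

open scoped DualNumber

variable {k : Type u} [Field k] {S T : Scheme.{u}}

/-- Natural `k`-morphisms `F X ⟶ X`, for a functor `F` from `S`-schemes to `T`-schemes, where
`S` and `T` are `k`-schemes. They turn a family `Z ⟶ S ×ₖ B` over a `k`-scheme `B` into a family
`F Z ⟶ T ×ₖ B` over the same `B`. -/
structure NatProj (s : S ⟶ Spec (.of k)) (t : T ⟶ Spec (.of k)) (F : Over S ⥤ Over T) where
  app : ∀ X : Over S, (F.obj X).left ⟶ X.left
  naturality : ∀ {X X' : Over S} (f : X ⟶ X'), (F.map f).left ≫ app X' = app X ≫ f.left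
  comm : ∀ X : Over S, app X ≫ X.hom ≫ s = (F.obj X).hom ≫ t

variable {s : S ⟶ Spec (.of k)} {t : T ⟶ Spec (.of k)} {F : Over S ⥤ Over T}

/-- The structure morphism `F Z ⟶ T ×ₖ Spec A`, for a deformation `Z ⟶ S ×ₖ Spec A`. -/
def imageHom (p : NatProj s t F) {A : Type u} [CommRing A] [Algebra k A] [IsArtAlg k A]
    {X : Over S} (D : Deformation s X A) : (F.obj D.toOver).left ⟶ prodSpec t A :=
  pullback.lift (F.obj D.toOver).hom (p.app D.toOver ≫ D.hom ≫ pullback.snd _ _) (by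
    rw [← p.comm, Category.assoc, Category.assoc, ← pullback.condition]
    change _ ≫ (D.hom ≫ _) ≫ s = _
    rw [Category.assoc])

/-- `F` sends deformations to deformations: if `Z` is an `S`-deformation of `X` over `A`, then
`F Z` is a `T`-deformation of `F X` over `A`. -/
def PreservesDeformations (p : NatProj s t F) : Prop :=
  ∀ (X : Over S) (A : Type u) [CommRing A] [Algebra k A] [IsArtAlg k A] (D : Deformation s X A),
    IsDeformation t (F.obj X) A (F.map D.inclOver).left (imageHom p D)

/-- The deformation `F Z` of `F X`, for a deformation `Z` of `X`. -/
def PreservesDeformations.image {p : NatProj s t F} (h : PreservesDeformations p) {A : Type u}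
    [CommRing A] [Algebra k A] [IsArtAlg k A] {X : Over S} (D : Deformation s X A) :
    Deformation t (F.obj X) A where
  total := (F.obj D.toOver).left
  incl := (F.map D.inclOver).left
  hom := imageHom p D
  isDeformation := h X A D

/-- Smoothness of `F` (first notion): `F` sends deformations to deformations, and for every flat
`S`-scheme `X` the assignment `Z ↦ F Z` induces a well defined `k`-linear map
`D_X(k[ε]) → D_{F X}(k[ε])` of tangent spaces.
(If `X` is not flat over `S`, it has no deformations and `D_X(k[ε])` is empty.) -/
def IsSmoothFunctor (p : NatProj s t F) : Prop :=
  ∃ h : PreservesDeformations p, ∀ (X : Over S), Flat X.hom →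
    ∃ (_ : AddCommGroup (DefClass s X k[ε])) (_ : Module k (DefClass s X k[ε]))
      (_ : AddCommGroup (DefClass t (F.obj X) k[ε])) (_ : Module k (DefClass t (F.obj X) k[ε])),
      IsTangentSpace s X ∧ IsTangentSpace t (F.obj X) ∧
      ∃ L : DefClass s X k[ε] →ₗ[k] DefClass t (F.obj X) k[ε],
        ∀ D : Deformation s X k[ε], L D.cls = (h.image D).cls

/-- The functor `X ↦ X ×_S Y` from `S`-schemes to `Y`-schemes, with the projections
`X ×_S Y ⟶ X`. -/
def fibreProduct (s : S ⟶ Spec (.of k)) {Y : Scheme.{u}} (g : Y ⟶ S) :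
    NatProj s (g ≫ s) (Over.pullback g) where
  app X := pullback.fst X.hom g
  naturality _ := pullback.lift_fst _ _ _
  comm _ := pullback.condition_assoc _

/-- The functor `X ↦ X ×_S Y` with values in `S`-schemes, with the projections
`X ×_S Y ⟶ X`. -/
def fibreProductOver (s : S ⟶ Spec (.of k)) {Y : Scheme.{u}} (g : Y ⟶ S) :
    NatProj s s (Over.pullback g ⋙ Over.map g) where
  app X := pullback.fst X.hom g
  naturality _ := pullback.lift_fst _ _ _
  comm _ := (pullback.condition_assoc _).trans (Category.assoc _ _ _).symm

end Smooth

end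

end SmoothFunctor

namespace SmoothFunctor

open TopologicalSpace Opposite

noncomputable section

section

/-! ### Base change of deformation classes and the trivial deformation. -/

section Functoriality

variable {k : Type u} [Field k] {S : Scheme.{u}} {s : S ⟶ Spec (.of k)} {X : Over S}
  {A B C : Type u} [CommRing A] [Algebra k A] [CommRing B] [Algebra k B] [CommRing C] [Algebra k C]

/-! The geometry of the functor is formal. The morphism `𝒳 ×_S Y ⟶ Y ×ₖ Spec A` is the base change
of `𝒳 ⟶ S ×ₖ Spec A` along `Y ×ₖ Spec A ⟶ S ×ₖ Spec A`, hence flat; composing with the latter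
morphism, flat because `g` is, gives the `S`-deformation. Cartesian squares are handled by pasting.
The substance is that the tangent spaces are vector spaces.

For a finite-dimensional `V` let `k[V]` be the trivial square zero extension of `k` by `V`. The key
fact is that `D_X(k[V × W]) → D_X(k[V]) × D_X(k[W])` is bijective (`DefClass.exists_pair`,
`DefClass.pair_ext`). Classes over `k[ε]` are then images of a single class `z` over some `k[V]`
under linear forms, and `DefClass.lin_add` says that adding classes is adding forms. The vector
space axioms become identities between linear maps, and a transformation that commutes with base
change is automatically linear (`PreservesDeformations.imageClass_add`).

Surjectivity: two deformations are surjective closed immersions of `X`, so they can be glued along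
`X` into a scheme with the same space whose rings of sections are fibre products
(`exists_milnorSquare`). It is flat by the local criterion for square zero ideals
(`flat_of_forall_relation`), and its base changes are the given deformations
(`Deformation.exists_isPushout`). Injectivity: flatness forces a deformation over `k[V × W]` to be
the pushout of its two base changes (`isPushout_of_isPullback`), and pushouts are unique. -/

theorem prodSpecMap_id : prodSpecMap s (AlgHom.id k A) = 𝟙 _ := by
  apply pullback.hom_ext
  · simp
  · rw [prodSpecMap, pullback.lift_snd, Category.id_comp]
    exact (congrArg _ (Spec.map_id _)).trans (Category.comp_id _)

theorem prodSpecMap_comp (φ : A →ₐ[k] B) (ψ : B →ₐ[k] C) :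
    prodSpecMap s (ψ.comp φ) = prodSpecMap s ψ ≫ prodSpecMap s φ := by
  apply pullback.hom_ext
  · simp
  · simp only [prodSpecMap, pullback.lift_snd, Category.assoc, pullback.lift_snd_assoc]
    rw [← Spec.map_comp]
    rfl

theorem prodSpecMap_ofId_comp_aug [IsArtAlg k A] :
    prodSpecMap s ((Algebra.ofId k B).comp (aug k A)) = pullback.fst _ _ ≫ closedPt s A := by
  apply pullback.hom_ext
  · simp
  · simp only [prodSpecMap, closedPt, pullback.lift_snd, Category.assoc]
    rw [pullback.condition_assoc, ← Spec.map_comp, ← CommRingCat.ofHom_comp]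
    rfl

variable [IsArtAlg k A] [IsArtAlg k B] [IsArtAlg k C]

/-- With its converse `Deformation.exists_isPullback_of_cls_eq`, this trades equations between
classes for cartesian squares under `X`, to which pasting applies. -/
theorem Deformation.cls_eq_of_isPullback {D : Deformation s X A} {E : Deformation s X B}
    {φ : A →ₐ[k] B} {f : E.total ⟶ D.total}
    (h : IsPullback f E.hom D.hom (prodSpecMap s φ)) (hf : E.incl ≫ f = D.incl) :
    E.cls = DefClass.map φ D.cls := by
  have hw : D.incl ≫ D.hom = (X.hom ≫ closedPt s B) ≫ prodSpecMap s φ := by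
    rw [D.isDeformation.isPullback.w, Category.assoc, closedPt_map]
  have key : E.incl ≫ h.isoPullback.hom = pullback.lift D.incl (X.hom ≫ closedPt s B) hw := by
    apply pullback.hom_ext
    · rw [Category.assoc, h.isoPullback_hom_fst, hf, pullback.lift_fst]
    · rw [Category.assoc, h.isoPullback_hom_snd, E.isDeformation.isPullback.w, pullback.lift_snd]
  exact Quotient.sound ⟨h.isoPullback, h.isoPullback_hom_snd, key⟩

theorem Deformation.exists_isPullback_baseChange (φ : A →ₐ[k] B) (D : Deformation s X A) :
    ∃ f : (D.baseChange φ).total ⟶ D.total,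
      IsPullback f (D.baseChange φ).hom D.hom (prodSpecMap s φ) ∧
        (D.baseChange φ).incl ≫ f = D.incl :=
  ⟨pullback.fst _ _, IsPullback.of_hasPullback _ _, pullback.lift_fst _ _ _⟩

theorem Deformation.exists_isPullback_of_cls_eq {D : Deformation s X A} {E : Deformation s X B}
    {φ : A →ₐ[k] B} (h : E.cls = DefClass.map φ D.cls) :
    ∃ f : E.total ⟶ D.total,
      IsPullback f E.hom D.hom (prodSpecMap s φ) ∧ E.incl ≫ f = D.incl := by
  obtain ⟨e, he, he'⟩ := Quotient.exact h
  obtain ⟨f, hf, hf'⟩ := D.exists_isPullback_baseChange φ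
  refine ⟨e.hom ≫ f, ?_, ?_⟩
  · have : IsPullback e.hom E.hom (D.baseChange φ).hom (𝟙 _) :=
      IsPullback.of_horiz_isIso ⟨by rw [he, Category.comp_id]⟩
    simpa using this.paste_horiz hf
  · rw [← Category.assoc, he', hf']

@[elab_as_elim]
theorem DefClass.ind {P : DefClass s X A → Prop} (h : ∀ D : Deformation s X A, P D.cls) (a) : P a :=
  Quotient.ind h a

theorem DefClass.map_cls (φ : A →ₐ[k] B) (D : Deformation s X A) :
    DefClass.map φ D.cls = (D.baseChange φ).cls := rfl

theorem DefClass.map_id (a : DefClass s X A) : a.map (AlgHom.id k A) = a := by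
  induction a using DefClass.ind with | h D
  symm
  refine Deformation.cls_eq_of_isPullback (f := 𝟙 _) ?_ (Category.comp_id _)
  rw [prodSpecMap_id]
  exact IsPullback.of_horiz_isIso ⟨by simp⟩

theorem DefClass.map_map (φ : A →ₐ[k] B) (ψ : B →ₐ[k] C) (a : DefClass s X A) :
    (a.map φ).map ψ = a.map (ψ.comp φ) := by
  induction a using DefClass.ind with | h D
  rw [DefClass.map_cls, DefClass.map_cls]
  obtain ⟨f, hf, hf'⟩ := D.exists_isPullback_baseChange φ
  obtain ⟨g, hg, hg'⟩ := (D.baseChange φ).exists_isPullback_baseChange ψ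
  refine Deformation.cls_eq_of_isPullback (f := g ≫ f) ?_ (by rw [← Category.assoc, hg', hf'])
  rw [prodSpecMap_comp]
  exact hg.paste_horiz hf

variable (s X A) in
/-- The trivial deformation `X ×ₖ Spec A` of a flat `S`-scheme `X`. -/
def Deformation.trivial (hX : Flat X.hom) : Deformation s X A where
  total := pullback X.hom (pullback.fst s (Spec.map (CommRingCat.ofHom (algebraMap k A))))
  incl := pullback.lift (𝟙 _) (X.hom ≫ closedPt s A) (by simp)
  hom := pullback.snd _ _
  isDeformation := by
    have hp : IsPullback (pullback.lift (𝟙 _) (X.hom ≫ closedPt s A) (by simp)) X.hom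
        (pullback.snd X.hom (pullback.fst s (Spec.map (CommRingCat.ofHom (algebraMap k A)))))
        (closedPt s A) := by
      refine IsPullback.of_right ?_ (pullback.lift_snd _ _ _) (IsPullback.of_hasPullback _ _)
      rw [pullback.lift_fst, closedPt_fst]
      exact IsPullback.of_horiz_isIso ⟨by simp⟩
    exact ⟨MorphismProperty.of_isPullback hp.flip inferInstance, inferInstance, hp⟩

/-- Over `k` every deformation becomes `X` itself, so a base change that factors through `k` forgets
the deformation. This is what makes the trivial class the zero of the tangent space. -/
theorem DefClass.map_ofId_comp_aug (hX : Flat X.hom) (a : DefClass s X A) :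
    a.map ((Algebra.ofId k B).comp (aug k A)) = (Deformation.trivial s X B hX).cls := by
  induction a using DefClass.ind with | h D
  symm
  refine Deformation.cls_eq_of_isPullback (f := pullback.fst _ _ ≫ D.incl) ?_ ?_
  · rw [prodSpecMap_ofId_comp_aug]
    exact (IsPullback.of_hasPullback _ _).paste_horiz D.isDeformation.isPullback
  · exact (pullback.lift_fst_assoc _ _ _ _).trans (Category.id_comp _)

theorem flat_of_deformation (D : Deformation s X A) : Flat X.hom :=
  have := D.isDeformation.flat
  MorphismProperty.of_isPullback D.isDeformation.isPullback inferInstance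

end Functoriality

end

section

/-! ### Squares of schemes whose sections form fibre products are pushouts. -/

section Pushout

variable {X D₁ D₂ Z : Scheme.{u}}

/-- The sections of `Z` over `W` are the pairs of sections of `D₁` and `D₂` that agree on `X`. -/
structure IsMilnorOn (j₁ : X ⟶ D₁) (j₂ : X ⟶ D₂) (i₁ : D₁ ⟶ Z) (i₂ : D₂ ⟶ Z) (W : Z.Opens) :
    Prop where
  eq_zero : ∀ a : Γ(Z, W), i₁.app W a = 0 → i₂.app W a = 0 → a = 0
  exists_app_eq : ∀ (a₁ : Γ(D₁, i₁ ⁻¹ᵁ W)) (a₂ : Γ(D₂, i₂ ⁻¹ᵁ W)),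
    (∀ (Q : X.Opens) (h₁ : Q ≤ j₁ ⁻¹ᵁ i₁ ⁻¹ᵁ W) (h₂ : Q ≤ j₂ ⁻¹ᵁ i₂ ⁻¹ᵁ W),
      j₁.appLE _ Q h₁ a₁ = j₂.appLE _ Q h₂ a₂) → ∃ a, i₁.app W a = a₁ ∧ i₂.app W a = a₂

variable {j₁ : X ⟶ D₁} {j₂ : X ⟶ D₂} {i₁ : D₁ ⟶ Z} {i₂ : D₂ ⟶ Z}

theorem IsMilnorOn.ext {W : Z.Opens} (h : IsMilnorOn j₁ j₂ i₁ i₂ W) {a b : Γ(Z, W)}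
    (h₁ : i₁.app W a = i₁.app W b) (h₂ : i₂.app W a = i₂.app W b) : a = b :=
  sub_eq_zero.mp (h.eq_zero _ (by rw [map_sub, h₁, sub_self]) (by rw [map_sub, h₂, sub_self]))

theorem app_map_apply {X Y : Scheme.{u}} (f : X ⟶ Y) {U V : Y.Opens} (h : V ≤ U) (a : Γ(Y, U)) :
    f.app V (Y.presheaf.map (homOfLE h).op a) =
      X.presheaf.map (homOfLE (f.preimage_mono h)).op (f.app U a) :=
  congr($(f.naturality (homOfLE h).op).hom a)

theorem appLE_congr_hom {X Y : Scheme.{u}} {f g : X ⟶ Y} (h : f = g) {U : Y.Opens} {V : X.Opens}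
    (e : V ≤ f ⁻¹ᵁ U) (e' : V ≤ g ⁻¹ᵁ U) : f.appLE U V e = g.appLE U V e' := by
  subst h; rfl

/-- All three structure sheaves are sheaves: local solutions are unique, so they agree on overlaps
and glue. -/
theorem IsMilnorOn.of_basis
    (hb : ∀ (O : Z.Opens), ∀ z ∈ O, ∃ W ≤ O, z ∈ W ∧ IsMilnorOn j₁ j₂ i₁ i₂ W) (U : Z.Opens) :
    IsMilnorOn j₁ j₂ i₁ i₂ U := by
  -- Uniqueness is needed on arbitrary opens, since an overlap `W z ⊓ W z'` need not belong to the
  -- basis.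
  have inj : ∀ (O : Z.Opens) (a b : Γ(Z, O)), i₁.app O a = i₁.app O b → i₂.app O a = i₂.app O b →
      a = b := by
    intro O a b h₁ h₂
    choose W hWO hzW hW using fun z : O ↦ hb O z.1 z.2
    refine Z.sheaf.eq_of_locally_eq' W O (fun z ↦ homOfLE (hWO z))
      (fun z hz ↦ TopologicalSpace.Opens.mem_iSup.mpr ⟨⟨z, hz⟩, hzW _⟩) _ _ fun z ↦ ?_
    refine (hW z).ext ?_ ?_
    · exact (app_map_apply i₁ _ _).trans ((congrArg _ h₁).trans (app_map_apply i₁ _ _).symm)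
    · exact (app_map_apply i₂ _ _).trans ((congrArg _ h₂).trans (app_map_apply i₂ _ _).symm)
  refine ⟨fun a h₁ h₂ ↦ inj U a 0 (by rw [h₁, map_zero]) (by rw [h₂, map_zero]),
    fun a₁ a₂ h ↦ ?_⟩
  choose W hWU hzW hW using fun z : U ↦ hb U z.1 z.2
  have hcov : U ≤ iSup W := fun z hz ↦ TopologicalSpace.Opens.mem_iSup.mpr ⟨⟨z, hz⟩, hzW _⟩
  have key : ∀ z : U, ∃ a : Γ(Z, W z),
      i₁.app (W z) a = D₁.presheaf.map (homOfLE (i₁.preimage_mono (hWU z))).op a₁ ∧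
      i₂.app (W z) a = D₂.presheaf.map (homOfLE (i₂.preimage_mono (hWU z))).op a₂ := by
    refine fun z ↦ (hW z).exists_app_eq _ _ fun Q h₁ h₂ ↦ ?_
    have e₁ := congr($(j₁.map_appLE h₁ (homOfLE (i₁.preimage_mono (hWU z))).op).hom a₁)
    have e₂ := congr($(j₂.map_appLE h₂ (homOfLE (i₂.preimage_mono (hWU z))).op).hom a₂)
    exact e₁.trans ((h Q _ _).trans e₂.symm)
  choose a ha₁ ha₂ using key
  obtain ⟨b, hb', -⟩ := Z.sheaf.existsUnique_gluing' W U (fun z ↦ homOfLE (hWU z)) hcov a (by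
    intro z z'
    apply inj
    · refine (app_map_apply i₁ inf_le_left _).trans (.trans ?_ (app_map_apply i₁ inf_le_right _).symm)
      rw [ha₁, ha₁, ← ConcreteCategory.comp_apply, ← ConcreteCategory.comp_apply,
        ← Functor.map_comp, ← Functor.map_comp]
      rfl
    · refine (app_map_apply i₂ inf_le_left _).trans (.trans ?_ (app_map_apply i₂ inf_le_right _).symm)
      rw [ha₂, ha₂, ← ConcreteCategory.comp_apply, ← ConcreteCategory.comp_apply,
        ← Functor.map_comp, ← Functor.map_comp]
      rfl)
  refine ⟨b, ?_, ?_⟩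
  · refine D₁.sheaf.eq_of_locally_eq' (fun z ↦ i₁ ⁻¹ᵁ W z) _
      (fun z ↦ homOfLE (i₁.preimage_mono (hWU z))) ?_ _ _ fun z ↦ ?_
    · exact fun y hy ↦ TopologicalSpace.Opens.mem_iSup.mpr ⟨⟨i₁ y, hy⟩, hzW _⟩
    · exact (app_map_apply i₁ (hWU z) b).symm.trans ((congrArg _ (hb' z)).trans (ha₁ z))
  · refine D₂.sheaf.eq_of_locally_eq' (fun z ↦ i₂ ⁻¹ᵁ W z) _
      (fun z ↦ homOfLE (i₂.preimage_mono (hWU z))) ?_ _ _ fun z ↦ ?_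
    · exact fun y hy ↦ TopologicalSpace.Opens.mem_iSup.mpr ⟨⟨i₂ y, hy⟩, hzW _⟩
    · exact (app_map_apply i₂ (hWU z) b).symm.trans ((congrArg _ (hb' z)).trans (ha₂ z))

theorem isPullback_commRingCat {R R₁ R₂ R₀ : CommRingCat.{u}} {f₁ : R ⟶ R₁} {f₂ : R ⟶ R₂}
    {g₁ : R₁ ⟶ R₀} {g₂ : R₂ ⟶ R₀} (w : f₁ ≫ g₁ = f₂ ≫ g₂)
    (inj : ∀ a : R, f₁ a = 0 → f₂ a = 0 → a = 0)
    (ex : ∀ a₁ a₂, g₁ a₁ = g₂ a₂ → ∃ a, f₁ a = a₁ ∧ f₂ a = a₂) : IsPullback f₁ f₂ g₁ g₂ := by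
  refine IsPullback.of_map (forget CommRingCat) w ((Types.isPullback_iff _ _ _ _).mpr ⟨?_, ?_, ?_⟩)
  · rw [← Functor.map_comp, w, Functor.map_comp]
  · rintro a b ⟨h₁, h₂⟩
    exact sub_eq_zero.mp (inj _ ((map_sub f₁.hom a b).trans (sub_eq_zero.mpr h₁))
      ((map_sub f₂.hom a b).trans (sub_eq_zero.mpr h₂)))
  · exact ex

theorem exists_of_isPullback_commRingCat {R R₁ R₂ R₀ : CommRingCat.{u}} {f₁ : R ⟶ R₁} {f₂ : R ⟶ R₂}
    {g₁ : R₁ ⟶ R₀} {g₂ : R₂ ⟶ R₀} (h : IsPullback f₁ f₂ g₁ g₂) {a₁ : R₁} {a₂ : R₂}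
    (ha : g₁ a₁ = g₂ a₂) : ∃ a, f₁ a = a₁ ∧ f₂ a = a₂ :=
  Types.exists_of_isPullback (h.map (forget CommRingCat)) a₁ a₂ ha

theorem eq_of_isPullback_commRingCat {R R₁ R₂ R₀ : CommRingCat.{u}} {f₁ : R ⟶ R₁} {f₂ : R ⟶ R₂}
    {g₁ : R₁ ⟶ R₀} {g₂ : R₂ ⟶ R₀} (h : IsPullback f₁ f₂ g₁ g₂) {a b : R} (h₁ : f₁ a = f₁ b)
    (h₂ : f₂ a = f₂ b) : a = b :=
  Types.ext_of_isPullback (h.map (forget CommRingCat)) h₁ h₂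

theorem preimage_preimage_eq (w : j₁ ≫ i₁ = j₂ ≫ i₂) (W : Z.Opens) :
    j₁ ⁻¹ᵁ i₁ ⁻¹ᵁ W = j₂ ⁻¹ᵁ i₂ ⁻¹ᵁ W := by
  rw [← Scheme.Hom.comp_preimage, w, Scheme.Hom.comp_preimage]

/-- Agreement on every common open `Q` amounts to agreement on the full preimage of `W` in `X`.
Quantifying over `Q` in `IsMilnorOn` avoids transport along the equality of the two preimages. -/
theorem IsMilnorOn.isPullback {W : Z.Opens} (h : IsMilnorOn j₁ j₂ i₁ i₂ W)
    (w : j₁ ≫ i₁ = j₂ ≫ i₂) :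
    IsPullback (i₁.app W) (i₂.app W) (j₁.appLE (i₁ ⁻¹ᵁ W) (j₁ ⁻¹ᵁ i₁ ⁻¹ᵁ W) le_rfl)
      (j₂.appLE (i₂ ⁻¹ᵁ W) (j₁ ⁻¹ᵁ i₁ ⁻¹ᵁ W) (preimage_preimage_eq w W).le) := by
  refine isPullback_commRingCat ?_ h.eq_zero fun a₁ a₂ ha ↦ h.exists_app_eq a₁ a₂ fun Q h₁ h₂ ↦ ?_
  · exact (Scheme.Hom.comp_appLE ..).symm.trans
      ((appLE_congr_hom w _ _).trans (Scheme.Hom.comp_appLE ..))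
  · have e₁ := congr($(j₁.appLE_map (U := i₁ ⁻¹ᵁ W) le_rfl (homOfLE h₁).op).hom a₁)
    have e₂ := congr($(j₂.appLE_map (U := i₂ ⁻¹ᵁ W) (preimage_preimage_eq w W).le
      (homOfLE h₁).op).hom a₂)
    exact e₁.symm.trans ((congrArg _ ha).trans e₂)

/-- `Z` has the space of `D₁`, which dictates the continuous map; surjectivity of `j₂` makes it
compatible with `f₂`. The map on sections comes from the universal property of the fibre product of
rings. -/
theorem exists_desc_of_isMilnorOn (w : j₁ ≫ i₁ = j₂ ≫ i₂) (h₁ : IsHomeomorph i₁)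
    (hj₂ : Function.Surjective j₂) (hb : ∀ W, IsMilnorOn j₁ j₂ i₁ i₂ W)
    {T : Scheme.{u}} (f₁ : D₁ ⟶ T) (f₂ : D₂ ⟶ T) (hf : j₁ ≫ f₁ = j₂ ≫ f₂) :
    ∃ h : Z ⟶ T, i₁ ≫ h = f₁ ∧ i₂ ≫ h = f₂ := by
  let e : D₁ ≃ₜ Z := h₁.homeomorph
  let b : (Z : TopCat) ⟶ (T : TopCat) := TopCat.ofHom ⟨f₁ ∘ e.symm, f₁.continuous.comp e.symm.continuous⟩
  have hb₁ : ∀ y : D₁, b (i₁ y) = f₁ y := fun y ↦ congrArg f₁ (e.symm_apply_apply y)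
  have hb₂ : ∀ y : D₂, b (i₂ y) = f₂ y := by
    intro y
    obtain ⟨x, rfl⟩ := hj₂ y
    have e₁ : i₂ (j₂ x) = i₁ (j₁ x) := congr($(w.symm) x)
    rw [e₁, hb₁]
    exact congr($hf x)
  have le₁ : ∀ V : T.Opens, i₁ ⁻¹ᵁ ((Opens.map b).obj V) ≤ f₁ ⁻¹ᵁ V := fun V y hy ↦ by
    have : b (i₁ y) ∈ V := hy
    rwa [hb₁] at this
  have le₂ : ∀ V : T.Opens, i₂ ⁻¹ᵁ ((Opens.map b).obj V) ≤ f₂ ⁻¹ᵁ V := fun V y hy ↦ by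
    have : b (i₂ y) ∈ V := hy
    rwa [hb₂] at this
  have hl : ∀ V : T.Opens, ∃ l : Γ(T, V) ⟶ Γ(Z, (Opens.map b).obj V),
      l ≫ i₁.app _ = f₁.appLE V _ (le₁ V) ∧ l ≫ i₂.app _ = f₂.appLE V _ (le₂ V) := by
    intro V
    have hp := (hb ((Opens.map b).obj V)).isPullback w
    refine ⟨hp.lift _ _ ?_, hp.lift_fst _ _ _, hp.lift_snd _ _ _⟩
    rw [Scheme.Hom.appLE_comp_appLE, Scheme.Hom.appLE_comp_appLE]
    exact appLE_congr_hom hf _ _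
  choose l hl₁ hl₂ using hl
  have hext : ∀ (W : Z.Opens) {R : CommRingCat.{u}} (a c : R ⟶ Γ(Z, W)),
      a ≫ i₁.app W = c ≫ i₁.app W → a ≫ i₂.app W = c ≫ i₂.app W → a = c :=
    fun W _ _ _ ↦ ((hb W).isPullback w).hom_ext
  let c : T.presheaf ⟶ (TopCat.Presheaf.pushforward _ b).obj Z.presheaf :=
    { app := fun V ↦ l V.unop
      naturality := by
        intro V V' r
        apply hext
        · have := i₁.naturality ((Opens.map b).map r.unop).op
          have e := hl₁ V'.unop
          have e' := hl₁ V.unop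
          refine (Category.assoc _ _ _).trans ((congrArg _ e).trans ?_)
          refine .trans ?_ (Category.assoc _ _ _).symm
          refine .trans ?_ (congrArg _ this).symm
          refine .trans ?_ (Category.assoc _ _ _)
          refine .trans ?_ (congrArg (· ≫ _) e').symm
          exact (f₁.map_appLE _ _).trans (f₁.appLE_map _ _).symm
        · have := i₂.naturality ((Opens.map b).map r.unop).op
          have e := hl₂ V'.unop
          have e' := hl₂ V.unop
          refine (Category.assoc _ _ _).trans ((congrArg _ e).trans ?_)
          refine .trans ?_ (Category.assoc _ _ _).symm
          refine .trans ?_ (congrArg _ this).symm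
          refine .trans ?_ (Category.assoc _ _ _)
          refine .trans ?_ (congrArg (· ≫ _) e').symm
          exact (f₂.map_appLE _ _).trans (f₂.appLE_map _ _).symm }
  let g : PresheafedSpace.Hom Z.toPresheafedSpace T.toPresheafedSpace := ⟨b, c⟩
  have hg₁ : (i₁.toLRSHom.toHom ≫ g : D₁.toPresheafedSpace ⟶ T.toPresheafedSpace) = f₁.toLRSHom.toHom := by
    refine PresheafedSpace.ext _ _ (by ext y; exact hb₁ y) ?_
    refine TopCat.Presheaf.ext fun V ↦ ?_
    rw [NatTrans.comp_app, Functor.whiskerRight_app]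
    refine .trans (congrArg (· ≫ D₁.presheaf.map _) (hl₁ V)) ?_
    exact (f₁.appLE_map _ _).trans f₁.appLE_eq_app
  have hg₂ : (i₂.toLRSHom.toHom ≫ g : D₂.toPresheafedSpace ⟶ T.toPresheafedSpace) = f₂.toLRSHom.toHom := by
    refine PresheafedSpace.ext _ _ (by ext y; exact hb₂ y) ?_
    refine TopCat.Presheaf.ext fun V ↦ ?_
    rw [NatTrans.comp_app, Functor.whiskerRight_app]
    refine .trans (congrArg (· ≫ D₂.presheaf.map _) (hl₂ V)) ?_
    exact (f₂.appLE_map _ _).trans f₂.appLE_eq_app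
  refine ⟨⟨⟨g, fun z ↦ ?_⟩⟩, ?_, ?_⟩
  -- Followed by the stalk map of `i₁`, the stalk map of `g` becomes that of `f₁`, which is local;
  -- the first factor of a local composite is local.
  · obtain ⟨y, rfl⟩ := h₁.surjective z
    have e := PresheafedSpace.stalkMap.comp i₁.toLRSHom.toHom g y
    have : IsLocalHom ((i₁.toLRSHom.toHom ≫ g : D₁.toPresheafedSpace ⟶ T.toPresheafedSpace).stalkMap y).hom := by
      rw [hg₁]
      exact f₁.toLRSHom.prop y
    rw [e] at this
    exact @isLocalHom_of_comp _ _ _ _ _ _ _ (PresheafedSpace.Hom.stalkMap i₁.toLRSHom.toHom y).hom this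
  · apply Scheme.Hom.ext'
    apply LocallyRingedSpace.Hom.ext'
    exact hg₁
  · apply Scheme.Hom.ext'
    apply LocallyRingedSpace.Hom.ext'
    exact hg₂

theorem hom_ext_of_isMilnorOn (h₁ : Function.Surjective i₁) (hb : ∀ W, IsMilnorOn j₁ j₂ i₁ i₂ W)
    {T : Scheme.{u}} {f g : Z ⟶ T} (e₁ : i₁ ≫ f = i₁ ≫ g) (e₂ : i₂ ≫ f = i₂ ≫ g) : f = g := by
  have hfg : f.base = g.base := by
    ext z
    obtain ⟨y, rfl⟩ := h₁ z
    exact congr($e₁ y)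
  have key : ∀ (V : T.Opens) (W : Z.Opens) (h : W ≤ f ⁻¹ᵁ V) (h' : W ≤ g ⁻¹ᵁ V),
      f.appLE V W h = g.appLE V W h' := by
    intro V W h h'
    ext a
    refine (hb W).ext ?_ ?_
    · have e := appLE_congr_hom e₁ (U := V) (V := i₁ ⁻¹ᵁ W) (i₁.preimage_mono h) (i₁.preimage_mono h')
      rw [← Scheme.Hom.appLE_comp_appLE (e₁ := h) (e₂ := le_rfl),
        ← Scheme.Hom.appLE_comp_appLE (e₁ := h') (e₂ := le_rfl), i₁.appLE_eq_app] at e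
      exact congr(($e).hom a)
    · have e := appLE_congr_hom e₂ (U := V) (V := i₂ ⁻¹ᵁ W) (i₂.preimage_mono h) (i₂.preimage_mono h')
      rw [← Scheme.Hom.appLE_comp_appLE (e₁ := h) (e₂ := le_rfl),
        ← Scheme.Hom.appLE_comp_appLE (e₁ := h') (e₂ := le_rfl), i₂.appLE_eq_app] at e
      exact congr(($e).hom a)
  refine Scheme.Hom.ext hfg fun V ↦ ?_
  rw [← g.appLE_eq_app, ← key V (g ⁻¹ᵁ V) (by rw [hfg]) le_rfl]
  rfl

theorem isPushout_of_isMilnorOn (w : j₁ ≫ i₁ = j₂ ≫ i₂) (h₁ : IsHomeomorph i₁)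
    (hj₂ : Function.Surjective j₂) (hb : ∀ W, IsMilnorOn j₁ j₂ i₁ i₂ W) :
    IsPushout j₁ j₂ i₁ i₂ := by
  refine ⟨⟨w⟩, ⟨PushoutCocone.IsColimit.mk w
    (fun c ↦ (exists_desc_of_isMilnorOn w h₁ hj₂ hb c.inl c.inr c.condition).choose)
    (fun c ↦ (exists_desc_of_isMilnorOn w h₁ hj₂ hb c.inl c.inr c.condition).choose_spec.1)
    (fun c ↦ (exists_desc_of_isMilnorOn w h₁ hj₂ hb c.inl c.inr c.condition).choose_spec.2)
    fun c m hm₁ hm₂ ↦ ?_⟩⟩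
  have := (exists_desc_of_isMilnorOn w h₁ hj₂ hb c.inl c.inr c.condition).choose_spec
  exact hom_ext_of_isMilnorOn h₁.surjective hb (hm₁.trans this.1.symm) (hm₂.trans this.2.symm)

end Pushout

end

section

/-! ### Flatness over square zero extensions and fibre products of rings. -/

section Algebra

open TensorProduct

/-- For `N` killed by `I` one has `N ⊗[C] M = N ⊗[C ⧸ I] ((C ⧸ I) ⊗[C] M)`, so flatness of the
reduction of `M` is enough. -/
theorem rTensor_injective_of_isTorsionBySet {C M N N' : Type*} [CommRing C] {I : Ideal C}
    [AddCommGroup M] [Module C M] [AddCommGroup N] [Module C N] [AddCommGroup N'] [Module C N']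
    (h : Module.Flat (C ⧸ I) ((C ⧸ I) ⊗[C] M)) (hN : Module.IsTorsionBySet C N I)
    (f : N' →ₗ[C] N) (hf : Function.Injective f) : Function.Injective (f.rTensor M) := by
  have hN' : Module.IsTorsionBySet C N' I := fun n c ↦ hf (by rw [map_smul, hN, map_zero])
  let := hN.module
  let := hN'.module
  let f' : N' →ₗ[C ⧸ I] N := LinearMap.extendScalarsOfSurjective Ideal.Quotient.mk_surjective f
  have hf' : Function.Injective (f'.rTensor ((C ⧸ I) ⊗[C] M)) :=
    Module.Flat.rTensor_preserves_injective_linearMap f' hf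
  let e := AlgebraTensorModule.cancelBaseChange C (C ⧸ I) (C ⧸ I) N M
  let e' := AlgebraTensorModule.cancelBaseChange C (C ⧸ I) (C ⧸ I) N' M
  have he : ∀ x, f.rTensor M x = e (f'.rTensor ((C ⧸ I) ⊗[C] M) (e'.symm x)) := by
    intro x
    induction x with
    | zero => simp
    | add x y hx hy => rw [map_add, hx, hy, map_add, map_add, map_add]
    | tmul n m =>
      simp only [e', e, LinearMap.rTensor_tmul, AlgebraTensorModule.cancelBaseChange_symm_tmul,
        AlgebraTensorModule.cancelBaseChange_tmul, one_smul]
      rfl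
  intro x y hxy
  rw [he, he] at hxy
  exact e'.symm.injective (hf' (e.injective hxy))

/-- The local criterion of flatness for a square zero ideal. -/
theorem flat_of_square_zero {C M : Type*} [CommRing C] [AddCommGroup M] [Module C M]
    {I : Ideal C} (hI : I * I = ⊥) (h : Module.Flat (C ⧸ I) ((C ⧸ I) ⊗[C] M))
    (hinj : Function.Injective (I.subtype.rTensor M)) : Module.Flat C M := by
  rw [Module.Flat.iff_rTensor_injective]
  intro J _
  let q : J →ₗ[C] C ⧸ I := I.mkQ ∘ₗ J.subtype
  let ι : (J ⊓ I : Ideal C) →ₗ[C] J := Submodule.inclusion inf_le_left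
  let ι' : (J ⊓ I : Ideal C) →ₗ[C] I := Submodule.inclusion inf_le_right
  have hex : Function.Exact ι q.rangeRestrict := by
    intro x
    constructor
    · intro hx
      have hx' : q x = 0 := congrArg Subtype.val hx
      have hx'' : (x : C) ∈ I := (Submodule.Quotient.mk_eq_zero I).mp hx'
      exact ⟨⟨x, x.2, hx''⟩, rfl⟩
    · rintro ⟨y, rfl⟩
      apply Subtype.ext
      exact (Submodule.Quotient.mk_eq_zero I).mpr y.2.2
  have hex' := rTensor_exact M hex q.surjective_rangeRestrict
  have hq : Module.IsTorsionBySet C (C ⧸ I) I := by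
    rintro x c
    obtain ⟨x, rfl⟩ := I.mkQ_surjective x
    exact (Submodule.Quotient.mk_eq_zero I).mpr (I.mul_mem_right x c.2)
  have hII : Module.IsTorsionBySet C I I := fun x c ↦ Subtype.ext
    (by
      have : (c : C) * x ∈ I * I := Ideal.mul_mem_mul c.2 x.2
      rwa [hI] at this)
  rw [injective_iff_map_eq_zero]
  intro x hx
  -- The image of `J` in `C ⧸ I` is killed by `I`, so its inclusion stays injective after tensoring.
  -- Hence `x` dies in the quotient and comes from `(J ⊓ I) ⊗ M`.
  have hx₁ : q.rangeRestrict.rTensor M x = 0 := by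
    apply rTensor_injective_of_isTorsionBySet h hq (LinearMap.range q).subtype Subtype.val_injective
    rw [map_zero, ← LinearMap.comp_apply, ← LinearMap.rTensor_comp]
    change (I.mkQ ∘ₗ J.subtype).rTensor M x = 0
    rw [LinearMap.rTensor_comp, LinearMap.comp_apply, hx, map_zero]
  obtain ⟨y, rfl⟩ := (hex' x).mp hx₁
  -- In `I ⊗ M` the element `y` vanishes by `hinj`. Since `I * I = ⊥`, the module `I` is itself
  -- killed by `I`, so `J ⊓ I → I` stays injective after tensoring and `y = 0`.
  have hy : ι'.rTensor M y = 0 := by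
    apply hinj
    rw [map_zero, ← LinearMap.comp_apply, ← LinearMap.rTensor_comp]
    rwa [← LinearMap.comp_apply, ← LinearMap.rTensor_comp] at hx
  rw [rTensor_injective_of_isTorsionBySet h hII ι' (Submodule.inclusion_injective _)
    (hy.trans (map_zero _).symm), map_zero]

theorem tmul_range_mem_sum {C M ι : Type*} [CommRing C] [AddCommGroup M] [Module C M] [Fintype ι]
    {N : Type*} [AddCommGroup N] [Module C N] {n : ι → N} (hn : Submodule.span C (Set.range n) = ⊤)
    (x : N ⊗[C] M) : ∃ m : ι → M, x = ∑ i, n i ⊗ₜ m i := by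
  induction x with
  | zero => exact ⟨0, by simp⟩
  | add x y hx hy =>
    obtain ⟨m, rfl⟩ := hx
    obtain ⟨m', rfl⟩ := hy
    exact ⟨m + m', by simp [tmul_add, Finset.sum_add_distrib]⟩
  | tmul a m =>
    obtain ⟨c, rfl⟩ := (Submodule.mem_span_range_iff_exists_fun C).mp
      (hn ▸ Submodule.mem_top : a ∈ Submodule.span C (Set.range n))
    exact ⟨fun i ↦ c i • m, by simp [sum_tmul, smul_tmul]⟩

/-- A ring homomorphism `φ : C → R` is flat if it is so modulo an ideal of `C` that is generated
by elements `ε i` with `ε i * ε j = 0`, and if every relation `∑ φ (ε i) * r i = 0` has coefficients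
in this ideal. -/
theorem flat_of_forall_relation {C R C₀ R₀ ι : Type*} [CommRing C] [CommRing R] [CommRing C₀]
    [CommRing R₀] [Fintype ι] {φ : C →+* R} {φ₀ : C₀ →+* R₀} {q : C →+* C₀} {p : R →+* R₀}
    (w : p.comp φ = φ₀.comp q) (hφ₀ : φ₀.Flat) (hq : Function.Surjective q)
    (hp : Function.Surjective p) {ε : ι → C} (hε : ∀ i j, ε i * ε j = 0)
    (hkq : RingHom.ker q = Ideal.span (Set.range ε))
    (hkp : RingHom.ker p ≤ Ideal.span (Set.range fun i ↦ φ (ε i)))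
    (hrel : ∀ r : ι → R, ∑ i, φ (ε i) * r i = 0 → ∀ i, p (r i) = 0) : φ.Flat := by
  algebraize [φ]
  set I : Ideal C := Ideal.span (Set.range ε) with hIdef
  have hεI : ∀ i, ε i ∈ I := fun i ↦ Ideal.subset_span ⟨i, rfl⟩
  have hqε : ∀ i, q (ε i) = 0 := fun i ↦ by
    rw [← RingHom.mem_ker, hkq]
    exact hεI i
  have hII : I * I = ⊥ := by
    rw [hIdef, Ideal.span_mul_span', eq_bot_iff, Ideal.span_le]
    rintro _ ⟨_, ⟨i, rfl⟩, _, ⟨j, rfl⟩, rfl⟩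
    exact hε i j
  refine flat_of_square_zero hII ?_ ?_
  · let e₁ : C ⧸ I ≃+* C₀ := (Ideal.quotEquivOfEq hkq.symm).trans
      (RingHom.quotientKerEquivOfSurjective hq)
    have he₁ : ∀ c, e₁ (Ideal.Quotient.mk I c) = q c := fun c ↦ rfl
    let : Algebra C R₀ := (p.comp φ).toAlgebra
    let a : C ⧸ I →ₐ[C] R₀ := Ideal.Quotient.liftₐ I (Algebra.ofId C R₀) (by
      intro c hc
      rw [← hkq, RingHom.mem_ker] at hc
      change p.comp φ c = 0
      rw [w, RingHom.comp_apply, hc, map_zero])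
    let b : R →ₐ[C] R₀ := { p with commutes' := fun c ↦ rfl }
    -- This map turns out to be an isomorphism, so the reduction of `φ` modulo `I` is `φ₀` and
    -- inherits its flatness.
    let e : (C ⧸ I) ⊗[C] R →ₐ[C] R₀ := Algebra.TensorProduct.lift a b (fun _ _ ↦ .all _ _)
    have he : ∀ c r, e (c ⊗ₜ r) = a c * p r := fun c r ↦ rfl
    have he0 : ∀ r, e (1 ⊗ₜ r) = p r := fun r ↦ by rw [he, map_one, one_mul]
    have hsurj : ∀ x : (C ⧸ I) ⊗[C] R, ∃ r, x = 1 ⊗ₜ r := by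
      intro x
      induction x with
      | zero => exact ⟨0, by simp⟩
      | add x y hx hy =>
        obtain ⟨r, rfl⟩ := hx
        obtain ⟨r', rfl⟩ := hy
        exact ⟨r + r', by rw [tmul_add]⟩
      | tmul c r =>
        obtain ⟨c, rfl⟩ := Ideal.Quotient.mk_surjective c
        refine ⟨c • r, ?_⟩
        rw [← smul_tmul]
        congr 1
        rw [Algebra.smul_def, mul_one]
        rfl
    have hbij : Function.Bijective e := by
      constructor
      · rw [injective_iff_map_eq_zero]
        intro x hx
        obtain ⟨r, rfl⟩ := hsurj x
        rw [he0] at hx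
        obtain ⟨c, hc⟩ := Ideal.mem_span_range_iff_exists_fun.mp (hkp hx)
        rw [← hc, tmul_sum]
        refine Finset.sum_eq_zero fun i _ ↦ ?_
        rw [mul_comm]
        change (1 : C ⧸ I) ⊗ₜ[C] (ε i • c i) = 0
        rw [← smul_tmul]
        have : ε i • (1 : C ⧸ I) = 0 := by
          rw [Algebra.smul_def, mul_one]
          exact Ideal.Quotient.eq_zero_iff_mem.mpr (hεI i)
        rw [this, zero_tmul]
      · intro r
        obtain ⟨r, rfl⟩ := hp r
        exact ⟨_, he0 r⟩
    have key : (algebraMap (C ⧸ I) ((C ⧸ I) ⊗[C] R)) =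
        ((RingEquiv.ofBijective e hbij).symm.toRingHom.comp φ₀).comp e₁.toRingHom := by
      ext c
      apply (RingEquiv.ofBijective e hbij).injective
      change e (Ideal.Quotient.mk I c ⊗ₜ 1) = (RingEquiv.ofBijective e hbij)
        ((RingEquiv.ofBijective e hbij).symm (φ₀ (e₁ (Ideal.Quotient.mk I c))))
      rw [RingEquiv.apply_symm_apply, he, he₁, map_one, mul_one]
      exact congr($w c)
    have hfl : (algebraMap (C ⧸ I) ((C ⧸ I) ⊗[C] R)).Flat := by
      rw [key]
      exact RingHom.Flat.comp (.of_bijective e₁.bijective)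
        (RingHom.Flat.comp hφ₀ (.of_bijective (RingEquiv.bijective _)))
    exact RingHom.flat_algebraMap_iff.mp hfl
  · rw [injective_iff_map_eq_zero]
    intro x hx
    -- An element of `I ⊗ R` is `∑ ε i ⊗ r i`. If it maps to zero in `R`, each `r i` is a
    -- combination of the `φ (ε j)`, and moving `ε j` across the tensor sign produces `ε j * ε i =
    -- 0`.
    obtain ⟨r, rfl⟩ := tmul_range_mem_sum (n := fun i ↦ (⟨ε i, hεI i⟩ : I)) (by
      rw [eq_top_iff]
      rintro ⟨y, hy⟩ -
      obtain ⟨c, hc⟩ := Ideal.mem_span_range_iff_exists_fun.mp hy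
      refine (Submodule.mem_span_range_iff_exists_fun C).mpr ⟨c, Subtype.ext ?_⟩
      simpa using hc) x
    have hr : ∑ i, φ (ε i) * r i = 0 := by
      simpa using! congrArg (TensorProduct.lid C R) hx
    refine Finset.sum_eq_zero fun i _ ↦ ?_
    obtain ⟨c, hc⟩ := Ideal.mem_span_range_iff_exists_fun.mp (hkp (hrel r hr i))
    rw [← hc, tmul_sum]
    refine Finset.sum_eq_zero fun j _ ↦ ?_
    rw [mul_comm]
    change (⟨ε i, hεI i⟩ : I) ⊗ₜ[C] (ε j • c j) = 0
    rw [← smul_tmul]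
    have : ε j • (⟨ε i, hεI i⟩ : I) = 0 := Subtype.ext (hε j i)
    rw [this, zero_tmul]

section Milnor

variable {R R₁ R₂ R₀ ι₁ ι₂ : Type*} [CommRing R] [CommRing R₁] [CommRing R₂] [CommRing R₀]
  [Fintype ι₁] {p₁ : R →+* R₁} {p₂ : R →+* R₂} {q₁ : R₁ →+* R₀} {q₂ : R₂ →+* R₀}
  {t₁ : ι₁ → R} {t₂ : ι₂ → R}

theorem surjective_fst_of_fibreProduct (hex : ∀ a₁ a₂, q₁ a₁ = q₂ a₂ → ∃ a, p₁ a = a₁ ∧ p₂ a = a₂)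
    (hq₂ : Function.Surjective q₂) : Function.Surjective p₁ := fun a₁ ↦ by
  obtain ⟨a₂, h⟩ := hq₂ (q₁ a₁)
  obtain ⟨a, h, -⟩ := hex a₁ a₂ h.symm
  exact ⟨a, h⟩

/-- An element of `ker p₁` is determined by its second component, which lies in `ker q₂`; lifting
the coefficients there to `R` writes the element in terms of `t₂`. -/
theorem ker_fst_le_of_fibreProduct [Fintype ι₂] (hw : q₁.comp p₁ = q₂.comp p₂)
    (hinj : ∀ a, p₁ a = 0 → p₂ a = 0 → a = 0) (hp₂ : Function.Surjective p₂)
    (ht₂ : ∀ j, p₁ (t₂ j) = 0)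
    (hk₂ : RingHom.ker q₂ ≤ Ideal.span (Set.range fun j ↦ p₂ (t₂ j))) :
    RingHom.ker p₁ ≤ Ideal.span (Set.range t₂) := by
  intro a ha
  rw [RingHom.mem_ker] at ha
  have h : p₂ a ∈ RingHom.ker q₂ := by
    rw [RingHom.mem_ker, ← RingHom.comp_apply, ← hw, RingHom.comp_apply, ha, map_zero]
  obtain ⟨c, hc⟩ := Ideal.mem_span_range_iff_exists_fun.mp (hk₂ h)
  choose d hd using fun j ↦ hp₂ (c j)
  refine Ideal.mem_span_range_iff_exists_fun.mpr ⟨d, ?_⟩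
  refine sub_eq_zero.mp (hinj _ ?_ ?_)
  · simp [ha, ht₂]
  · simp [hd, hc]

theorem ker_comp_le_of_fibreProduct
    (hk₁ : RingHom.ker q₁ ≤ Ideal.span (Set.range fun j ↦ p₁ (t₁ j)))
    (hp₁ : Function.Surjective p₁) (hk : RingHom.ker p₁ ≤ Ideal.span (Set.range t₂)) :
    RingHom.ker (q₁.comp p₁) ≤ Ideal.span (Set.range (Sum.elim t₁ t₂)) := by
  intro a ha
  obtain ⟨c, hc⟩ := Ideal.mem_span_range_iff_exists_fun.mp (hk₁ ha)
  choose d hd using fun j ↦ hp₁ (c j)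
  have h : a - ∑ i, d i * t₁ i ∈ RingHom.ker p₁ := by simp [RingHom.mem_ker, hd, hc]
  have h₁ : ∑ i, d i * t₁ i ∈ Ideal.span (Set.range (Sum.elim t₁ t₂)) :=
    Ideal.sum_mem _ fun i _ ↦ Ideal.mul_mem_left _ _ (Ideal.subset_span ⟨.inl i, rfl⟩)
  have h₂ : Ideal.span (Set.range t₂) ≤ Ideal.span (Set.range (Sum.elim t₁ t₂)) :=
    Ideal.span_mono (by rintro _ ⟨j, rfl⟩; exact ⟨.inr j, rfl⟩)
  simpa using Ideal.add_mem _ (h₂ (hk h)) h₁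

variable [Fintype ι₂]

/-- Each projection kills one of the two families, so a relation in `R` splits into one in `R₁` and
one in `R₂`. -/
theorem relation_of_fibreProduct (hw : q₁.comp p₁ = q₂.comp p₂)
    (ht₁ : ∀ i, p₂ (t₁ i) = 0) (ht₂ : ∀ j, p₁ (t₂ j) = 0)
    (hrel₁ : ∀ r : ι₁ → R₁, ∑ i, p₁ (t₁ i) * r i = 0 → ∀ i, q₁ (r i) = 0)
    (hrel₂ : ∀ r : ι₂ → R₂, ∑ i, p₂ (t₂ i) * r i = 0 → ∀ i, q₂ (r i) = 0)
    (r : ι₁ ⊕ ι₂ → R) (hr : ∑ i, Sum.elim t₁ t₂ i * r i = 0) (i : ι₁ ⊕ ι₂) :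
    q₁.comp p₁ (r i) = 0 := by
  rw [Fintype.sum_sum_type] at hr
  match i with
  | .inl i =>
    exact hrel₁ (fun i ↦ p₁ (r (.inl i))) (by simpa [ht₂] using congrArg p₁ hr) i
  | .inr j =>
    rw [hw]
    exact hrel₂ (fun i ↦ p₂ (r (.inr i))) (by simpa [ht₁] using congrArg p₂ hr) j

/-- Such an `a` equals both `∑ t₁ i * d i` and `∑ t₂ j * c j`. Their difference is a relation, so
the `d i` are combinations of the `t`'s, and all products of two `t`'s vanish. -/
theorem eq_zero_of_relation {p₀ : R →+* R₀} (ht : ∀ i j, Sum.elim t₁ t₂ i * Sum.elim t₁ t₂ j = 0)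
    (hk₁ : RingHom.ker p₁ ≤ Ideal.span (Set.range t₂))
    (hk₂ : RingHom.ker p₂ ≤ Ideal.span (Set.range t₁))
    (hk : RingHom.ker p₀ ≤ Ideal.span (Set.range (Sum.elim t₁ t₂)))
    (hrel : ∀ r : ι₁ ⊕ ι₂ → R, ∑ i, Sum.elim t₁ t₂ i * r i = 0 → ∀ i, p₀ (r i) = 0)
    {a : R} (h₁ : p₁ a = 0) (h₂ : p₂ a = 0) : a = 0 := by
  obtain ⟨c, hc⟩ := Ideal.mem_span_range_iff_exists_fun.mp (hk₁ h₁)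
  obtain ⟨d, hd⟩ := Ideal.mem_span_range_iff_exists_fun.mp (hk₂ h₂)
  have hr := hrel (Sum.elim (fun i ↦ d i) fun j ↦ - c j) (by
    have hc' : ∑ j, t₂ j * c j = a := hc ▸ Finset.sum_congr rfl fun _ _ ↦ mul_comm _ _
    have hd' : ∑ i, t₁ i * d i = a := hd ▸ Finset.sum_congr rfl fun _ _ ↦ mul_comm _ _
    rw [Fintype.sum_sum_type]
    simp [hc', hd'])
  rw [← hd]
  refine Finset.sum_eq_zero fun i _ ↦ ?_
  obtain ⟨e, he⟩ := Ideal.mem_span_range_iff_exists_fun.mp (hk (hr (.inl i)))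
  simp only [Sum.elim_inl] at he
  rw [← he, Finset.sum_mul]
  refine Finset.sum_eq_zero fun j _ ↦ ?_
  rw [mul_assoc]
  exact (congrArg (e j * ·) (ht j (.inl i))).trans (mul_zero _)

theorem exists_of_ker_le (hw : q₁.comp p₁ = q₂.comp p₂) (hp₁ : Function.Surjective p₁)
    (hp₂ : Function.Surjective p₂) (ht₁ : ∀ i, p₂ (t₁ i) = 0) (ht₂ : ∀ j, p₁ (t₂ j) = 0)
    (hk : RingHom.ker (q₁.comp p₁) ≤ Ideal.span (Set.range (Sum.elim t₁ t₂))) (a₁ : R₁) (a₂ : R₂)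
    (h : q₁ a₁ = q₂ a₂) : ∃ a, p₁ a = a₁ ∧ p₂ a = a₂ := by
  obtain ⟨a₁, rfl⟩ := hp₁ a₁
  obtain ⟨a₂, rfl⟩ := hp₂ a₂
  have h' : a₁ - a₂ ∈ RingHom.ker (q₁.comp p₁) := by
    rw [RingHom.mem_ker, map_sub, RingHom.comp_apply, h, hw, RingHom.comp_apply, sub_self]
  obtain ⟨c, hc⟩ := Ideal.mem_span_range_iff_exists_fun.mp (hk h')
  rw [Fintype.sum_sum_type] at hc
  -- Subtracting only the `t₂`-part of `a₁ - a₂` leaves the image under `p₁` unchanged and turns the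
  -- image under `p₂` into that of `a₂`.
  refine ⟨a₁ - ∑ j, c (.inr j) * t₂ j, by simp [ht₂], ?_⟩
  have := congrArg p₂ hc
  simp only [Sum.elim_inl, Sum.elim_inr, map_add, map_sum, map_mul, ht₁, mul_zero,
    Finset.sum_const_zero, zero_add, map_sub] at this
  simp [this]

end Milnor

section SquareZero

open TrivSqZeroExt

variable {k V W ι : Type*} [Field k] [AddCommGroup V] [Module k V] [Module kᵐᵒᵖ V]
  [IsCentralScalar k V] [AddCommGroup W] [Module k W] [Module kᵐᵒᵖ W] [IsCentralScalar k W]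
  [Fintype ι]

theorem ker_map_eq_span {g : V →ₗ[k] W} {v : ι → V}
    (hv : LinearMap.ker g = Submodule.span k (Set.range v)) :
    RingHom.ker (TrivSqZeroExt.map g) = Ideal.span (Set.range fun i ↦ (inr (v i) : TrivSqZeroExt k V)) := by
  apply le_antisymm
  · intro x hx
    rw [RingHom.mem_ker] at hx
    have h₁ : x.fst = 0 := by simpa using congrArg fst hx
    have h₂ : x.snd ∈ LinearMap.ker g := by simpa using congrArg snd hx
    rw [hv] at h₂
    obtain ⟨c, hc⟩ := (Submodule.mem_span_range_iff_exists_fun k).mp h₂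
    refine Ideal.mem_span_range_iff_exists_fun.mpr ⟨fun i ↦ inl (c i), ?_⟩
    rw [← inl_fst_add_inr_snd_eq x, h₁, ← hc, inl_zero, zero_add, ← inrHom_apply k, map_sum]
    exact Finset.sum_congr rfl fun i _ ↦ inl_mul_inr _ _
  · rw [Ideal.span_le]
    rintro _ ⟨i, rfl⟩
    have : v i ∈ LinearMap.ker g := hv ▸ Submodule.subset_span ⟨i, rfl⟩
    rw [LinearMap.mem_ker] at this
    simp [RingHom.mem_ker, this]

theorem ker_fst_eq_span {v : ι → V} (hv : Submodule.span k (Set.range v) = ⊤) :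
    RingHom.ker (fstHom k k V) = Ideal.span (Set.range fun i ↦ (inr (v i) : TrivSqZeroExt k V)) := by
  rw [← ker_map_eq_span (g := (0 : V →ₗ[k] V)) (by rw [hv, LinearMap.ker_zero])]
  ext x
  rw [RingHom.mem_ker, RingHom.mem_ker, TrivSqZeroExt.ext_iff]
  simp

/-- By the equational criterion the relation comes from relations among the `inr (b i)` in the base,
whose coefficients lie in the augmentation ideal. -/
theorem mem_span_of_flat_of_sum_eq_zero (b : Module.Basis ι k V) {R : Type*} [CommRing R]
    {f : TrivSqZeroExt k V →+* R} (hf : f.Flat) {r : ι → R} (hr : ∑ i, f (inr (b i)) * r i = 0)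
    (i : ι) : r i ∈ Ideal.span (Set.range fun i ↦ f (inr (b i))) := by
  algebraize [f]
  obtain ⟨κ, a, y, h₁, h₂⟩ := Module.Flat.isTrivialRelation_of_sum_smul_eq_zero
    (R := TrivSqZeroExt k V) (f := fun i ↦ inr (b i)) (x := r) hr
  rw [h₁]
  refine Ideal.sum_mem _ fun j _ ↦ ?_
  refine Ideal.mul_mem_right _ _ ?_
  -- The second component of `∑ i, a i j * inr (b i) = 0` is `∑ i, (a i j).fst • b i = 0`.
  have : (a i j).fst = 0 := by
    refine Fintype.linearIndependent_iff.mp b.linearIndependent (fun i ↦ (a i j).fst) ?_ i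
    have hj := congrArg (sndHom k V) (h₂ j)
    rw [map_sum, map_zero] at hj
    exact .trans (Finset.sum_congr rfl fun i _ ↦ by simp) hj
  have hm : a i j ∈ RingHom.ker (fstHom k k V) := this
  rw [ker_fst_eq_span b.span_eq] at hm
  have := Ideal.mem_map_of_mem f hm
  rwa [Ideal.map_span, ← Set.range_comp] at this

end SquareZero

end Algebra

end

section

/-! ### Localization and spectra of fibre products of rings. -/

section FibreProductRings

/-- The ring homomorphism `φ` is a localization at the powers of `f`. -/
structure IsAway {R S : Type*} [CommRing R] [CommRing S] (φ : R →+* S) (f : R) : Prop where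
  isUnit : IsUnit (φ f)
  surj : ∀ s, ∃ (n : ℕ) (a : R), s * φ f ^ n = φ a
  exists_pow_mul : ∀ a, φ a = 0 → ∃ n : ℕ, f ^ n * a = 0

theorem IsAway.of_isLocalization {R S : Type*} [CommRing R] [CommRing S] [Algebra R S] (f : R)
    [IsLocalization.Away f S] : IsAway (algebraMap R S) f := by
  refine ⟨IsLocalization.Away.algebraMap_isUnit f, fun s ↦ ?_, fun a ha ↦ ?_⟩
  · obtain ⟨n, a, h⟩ := IsLocalization.Away.surj f s
    exact ⟨n, a, h⟩
  · obtain ⟨⟨_, n, rfl⟩, h⟩ := (IsLocalization.map_eq_zero_iff (.powers f) S a).mp ha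
    exact ⟨n, h⟩

theorem IsAway.isOpenImmersion {R S : CommRingCat.{u}} {φ : R ⟶ S} {f : R}
    (h : IsAway φ.hom f) : IsOpenImmersion (Spec.map φ) := by
  algebraize [φ.hom]
  have : IsLocalization.Away f S := by
    refine IsLocalization.Away.mk f h.isUnit h.surj fun a b hab ↦ ?_
    obtain ⟨n, hn⟩ := h.exists_pow_mul (a - b) (by rw [map_sub, sub_eq_zero]; exact hab)
    exact ⟨n, by rwa [mul_sub, sub_eq_zero] at hn⟩
  exact IsOpenImmersion.of_isLocalization f

variable {R R₁ R₂ R₀ : CommRingCat.{u}} {f₁ : R ⟶ R₁} {f₂ : R ⟶ R₂} {g₁ : R₁ ⟶ R₀} {g₂ : R₂ ⟶ R₀}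
  {R' R₁' R₂' R₀' : CommRingCat.{u}} {f₁' : R' ⟶ R₁'} {f₂' : R' ⟶ R₂'} {g₁' : R₁' ⟶ R₀'}
  {g₂' : R₂' ⟶ R₀'} {ρ : R ⟶ R'} {ρ₁ : R₁ ⟶ R₁'} {ρ₂ : R₂ ⟶ R₂'} {ρ₀ : R₀ ⟶ R₀'}

/-- Inverting one element is exact and so commutes with fibre products; elementwise, this means
finding common denominators. -/
theorem IsAway.fibreProduct (h : IsPullback f₁ f₂ g₁ g₂) (h' : IsPullback f₁' f₂' g₁' g₂')
    (w₁ : ρ ≫ f₁' = f₁ ≫ ρ₁) (w₂ : ρ ≫ f₂' = f₂ ≫ ρ₂) (v₁ : ρ₁ ≫ g₁' = g₁ ≫ ρ₀)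
    (v₂ : ρ₂ ≫ g₂' = g₂ ≫ ρ₀) {f : R} (h₁ : IsAway ρ₁.hom (f₁ f)) (h₂ : IsAway ρ₂.hom (f₂ f))
    (h₀ : IsAway ρ₀.hom (g₁ (f₁ f))) : IsAway ρ.hom f := by
  have w₁ : ∀ a, f₁' (ρ a) = ρ₁ (f₁ a) := fun a ↦ congr($w₁ a)
  have w₂ : ∀ a, f₂' (ρ a) = ρ₂ (f₂ a) := fun a ↦ congr($w₂ a)
  have v₁ : ∀ a, g₁' (ρ₁ a) = ρ₀ (g₁ a) := fun a ↦ congr($v₁ a)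
  have v₂ : ∀ a, g₂' (ρ₂ a) = ρ₀ (g₂ a) := fun a ↦ congr($v₂ a)
  have hg : ∀ a, g₁ (f₁ a) = g₂ (f₂ a) := fun a ↦ congr($h.w a)
  have hg' : ∀ a, g₁' (f₁' a) = g₂' (f₂' a) := fun a ↦ congr($h'.w a)
  have x₁ : ∀ a, ρ₁.hom a = ρ₁ a := fun _ ↦ rfl
  have x₂ : ∀ a, ρ₂.hom a = ρ₂ a := fun _ ↦ rfl
  have x₀ : ∀ a, ρ₀.hom a = ρ₀ a := fun _ ↦ rfl
  refine ⟨?_, fun s ↦ ?_, fun a ha ↦ ?_⟩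
  · obtain ⟨u₁, hu₁⟩ := h₁.isUnit.exists_right_inv
    obtain ⟨u₂, hu₂⟩ := h₂.isUnit.exists_right_inv
    rw [x₁] at hu₁
    rw [x₂] at hu₂
    have e₁ := congrArg g₁' hu₁
    have e₂ := congrArg g₂' hu₂
    simp only [map_mul, v₁, v₂, map_one, ← hg] at e₁ e₂
    have : g₁' u₁ = g₂' u₂ := by
      calc g₁' u₁ = g₁' u₁ * (ρ₀ (g₁ (f₁ f)) * g₂' u₂) := by rw [e₂, mul_one]
        _ = (ρ₀ (g₁ (f₁ f)) * g₁' u₁) * g₂' u₂ := by ring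
        _ = g₂' u₂ := by rw [e₁, one_mul]
    obtain ⟨u, rfl, rfl⟩ := exists_of_isPullback_commRingCat h' this
    refine IsUnit.of_mul_eq_one u (eq_of_isPullback_commRingCat h' ?_ ?_)
    · rw [map_mul, map_one, ← hu₁]; exact congrArg (· * _) (w₁ f)
    · rw [map_mul, map_one, ← hu₂]; exact congrArg (· * _) (w₂ f)
  · obtain ⟨n₁, a₁, ha₁⟩ := h₁.surj (f₁' s)
    obtain ⟨n₂, a₂, ha₂⟩ := h₂.surj (f₂' s)
    rw [x₁, x₁] at ha₁
    rw [x₂, x₂] at ha₂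
    -- The rescaled numerators agree only in the localization of `R₀`; a further power `m` makes
    -- them agree in `R₀`, so that they lift to `R`.
    obtain ⟨m, hm⟩ := h₀.exists_pow_mul
        (g₁ (f₁ f) ^ n₂ * g₁ a₁ - g₁ (f₁ f) ^ n₁ * g₂ a₂) (by
      rw [x₀, map_sub, map_mul, map_mul, map_pow, map_pow, ← v₁, ← v₁, ← v₂, ← ha₁, ← ha₂, map_mul,
        map_mul, map_pow, map_pow, ← hg', v₁, v₂, hg]
      ring)
    have : g₁ (f₁ f ^ (m + n₂) * a₁) = g₂ (f₂ f ^ (m + n₁) * a₂) := by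
      rw [map_mul, map_mul, map_pow, map_pow, ← hg, ← sub_eq_zero, ← hm]
      ring
    obtain ⟨a, ha₁', ha₂'⟩ := exists_of_isPullback_commRingCat h this
    refine ⟨n₁ + n₂ + m, a, eq_of_isPullback_commRingCat h' ?_ ?_⟩
    · refine .trans ?_ (w₁ a).symm
      rw [ha₁', map_mul, map_mul, map_pow, map_pow, ← ha₁]
      refine (congrArg (fun z ↦ f₁' s * z ^ _) (w₁ f)).trans ?_
      ring
    · refine .trans ?_ (w₂ a).symm
      rw [ha₂', map_mul, map_mul, map_pow, map_pow, ← ha₂]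
      refine (congrArg (fun z ↦ f₂' s * z ^ _) (w₂ f)).trans ?_
      ring
  · have ha : ρ a = 0 := ha
    obtain ⟨n₁, hn₁⟩ := h₁.exists_pow_mul (f₁ a) (by rw [x₁, ← w₁, ha, map_zero])
    obtain ⟨n₂, hn₂⟩ := h₂.exists_pow_mul (f₂ a) (by rw [x₂, ← w₂, ha, map_zero])
    refine ⟨n₁ + n₂, eq_of_isPullback_commRingCat h ?_ ?_⟩
    · rw [map_mul, map_pow, pow_add, mul_right_comm, hn₁, zero_mul, map_zero]
    · rw [map_mul, map_pow, pow_add, mul_assoc, hn₂, mul_zero, map_zero]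

theorem ker_le_nilradical_of_surjective {R S : CommRingCat.{u}} (φ : R ⟶ S)
    (h : Function.Surjective φ) (h' : Function.Surjective (Spec.map φ)) :
    RingHom.ker φ.hom ≤ nilradical R := by
  have h₁ : Set.range (PrimeSpectrum.comap φ.hom) = Set.univ := Set.range_eq_univ.mpr h'
  rw [range_comap_of_surjective _ _ h] at h₁
  exact (PrimeSpectrum.zeroLocus_eq_univ_iff _).mp h₁

/-- Surjectivity and the nil kernel pass from `g₂` to the opposite side `f₁`. -/
theorem isHomeomorph_specMap_fst (h : IsPullback f₁ f₂ g₁ g₂) (hg : Function.Surjective g₂)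
    (hg' : RingHom.ker g₂.hom ≤ nilradical R₂) : IsHomeomorph (Spec.map f₁) := by
  refine PrimeSpectrum.isHomeomorph_comap f₁.hom (fun x ↦ ⟨1, one_pos, ?_⟩) fun a ha ↦ ?_
  · obtain ⟨y, hy⟩ := hg (g₁ x)
    obtain ⟨a, ha, -⟩ := exists_of_isPullback_commRingCat h hy.symm
    exact ⟨a, by rw [pow_one]; exact ha⟩
  · have ha : f₁ a = 0 := ha
    have : f₂ a ∈ RingHom.ker g₂.hom := by
      have : g₁ (f₁ a) = g₂ (f₂ a) := congr($h.w a)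
      rw [ha, map_zero] at this
      exact this.symm
    obtain ⟨n, hn⟩ := hg' this
    -- The exponent must be positive for the first component, where `f₁ a = 0`.
    refine ⟨n + 1, eq_of_isPullback_commRingCat h ?_ ?_⟩
    · rw [map_pow, ha, zero_pow n.succ_ne_zero, map_zero]
    · rw [map_pow, pow_succ, hn, zero_mul, map_zero]

end FibreProductRings

/-! ### Gluing along directed families of opens. -/

section DirectedOpens

/-- Near each point of an overlap both morphisms restrict to the one on a smaller `O l`, so
intersections need not belong to the family. -/
theorem exists_glue_of_directed {D T : Scheme.{u}} {J : Type u} [Preorder J] (O : J → D.Opens)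
    (mono : ∀ i j, i ≤ j → O i ≤ O j) (cov : ∀ x, ∃ i, x ∈ O i)
    (dir : ∀ i j x, x ∈ O i → x ∈ O j → ∃ l, l ≤ i ∧ l ≤ j ∧ x ∈ O l)
    (g : ∀ i, (O i).toScheme ⟶ T) (hg : ∀ i j (h : i ≤ j), D.homOfLE (mono i j h) ≫ g j = g i) :
    ∃ f : D ⟶ T, ∀ i, (O i).ι ≫ f = g i := by
  have hcomp : ∀ i j : J, pullback.fst (O i).ι (O j).ι ≫ g i =
      pullback.snd (O i).ι (O j).ι ≫ g j := by
    intro i j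
    refine Scheme.hom_ext_of_forall _ _ fun x ↦ ?_
    let a := pullback.fst (O i).ι (O j).ι
    let b := pullback.snd (O i).ι (O j).ι
    have hab : a ≫ (O i).ι = b ≫ (O j).ι := pullback.condition
    have hx : (O i).ι (a x) = (O j).ι (b x) := congr($hab x)
    obtain ⟨l, hi, hj, hl⟩ := dir i j ((O i).ι (a x)) (a x).2 (by rw [hx]; exact (b x).2)
    let Q := (a ≫ (O i).ι) ⁻¹ᵁ O l
    refine ⟨Q, hl, ?_⟩
    let r := (a ≫ (O i).ι).resLE (O l) Q le_rfl
    have ra : Q.ι ≫ a = r ≫ D.homOfLE (mono _ _ hi) := by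
      rw [← cancel_mono (O i).ι, Category.assoc, Category.assoc, D.homOfLE_ι,
        Scheme.Hom.resLE_comp_ι]
    have rb : Q.ι ≫ b = r ≫ D.homOfLE (mono _ _ hj) := by
      rw [← cancel_mono (O j).ι, Category.assoc, Category.assoc, D.homOfLE_ι,
        Scheme.Hom.resLE_comp_ι, hab]
    change Q.ι ≫ a ≫ g i = Q.ι ≫ b ≫ g j
    rw [← Category.assoc, ← Category.assoc, ra, rb, Category.assoc, Category.assoc, hg l i hi, hg l j hj]
  let 𝒰 : D.OpenCover := D.openCoverOfIsOpenCover O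
    (.mk (top_unique fun x _ ↦ Opens.mem_iSup.mpr (cov x)))
  exact ⟨𝒰.glueMorphisms g hcomp, fun i ↦ 𝒰.ι_glueMorphisms g hcomp i⟩

end DirectedOpens

section Colimit

variable {D : Scheme.{u}} {J : Type u} [Preorder J] {F : J ⥤ Scheme.{u}} {O : J → D.Opens}
  {γ : ∀ i, (O i).toScheme ⟶ F.obj i}

theorem map_apply_of_naturality (mono : ∀ i j, i ≤ j → O i ≤ O j)
    (nat : ∀ i j (h : i ⟶ j), D.homOfLE (mono i j h.le) ≫ γ j = γ i ≫ F.map h) {i l : J}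
    (f : i ⟶ l) (y : O i) : F.map f (γ i y) = γ l ⟨y.1, mono i l f.le y.2⟩ := by
  have e : γ l (D.homOfLE (mono i l f.le) y) = F.map f (γ i y) := congr($(nat i l f) y)
  rw [← e]
  congr 1
  exact Subtype.ext (Scheme.homOfLE_apply ..)

theorem isLocallyDirected_of_opens
    (hγ : ∀ i, IsHomeomorph (γ i)) (mono : ∀ i j, i ≤ j → O i ≤ O j)
    (nat : ∀ i j (h : i ⟶ j), D.homOfLE (mono i j h.le) ≫ γ j = γ i ≫ F.map h)
    (dir : ∀ i j x, x ∈ O i → x ∈ O j → ∃ l, l ≤ i ∧ l ≤ j ∧ x ∈ O l) :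
    (F ⋙ Scheme.forget).IsLocallyDirected := by
  refine ⟨fun {i j l} fi fj xi xj h ↦ ?_⟩
  obtain ⟨y, rfl⟩ := (hγ i).surjective xi
  obtain ⟨z, rfl⟩ := (hγ j).surjective xj
  have h : F.map fi (γ i y) = F.map fj (γ j z) := h
  have h' := (map_apply_of_naturality mono nat fi y).symm.trans
    (h.trans (map_apply_of_naturality mono nat fj z))
  have hyz := congrArg Subtype.val ((hγ l).injective h')
  obtain ⟨m, hi, hj, hm⟩ := dir i j y.1 y.2 (by rw [hyz]; exact z.2)
  refine ⟨m, homOfLE hi, homOfLE hj, γ m ⟨y.1, hm⟩, ?_, ?_⟩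
  · exact map_apply_of_naturality mono nat (homOfLE hi) ⟨y.1, hm⟩
  · exact (map_apply_of_naturality mono nat (homOfLE hj) ⟨y.1, hm⟩).trans
      (congrArg _ (Subtype.ext hyz))

/-- Each chart of the colimit has the space of the corresponding `O i`. Local directedness describes
when points of two charts are identified, which gives injectivity; openness is checked on the `O i`,
a basis of `D`. -/
theorem exists_hom_colimit
    (hγ : ∀ i, IsHomeomorph (γ i)) (mono : ∀ i j, i ≤ j → O i ≤ O j)
    (nat : ∀ i j (h : i ⟶ j), D.homOfLE (mono i j h.le) ≫ γ j = γ i ≫ F.map h)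
    (dir : ∀ i j x, x ∈ O i → x ∈ O j → ∃ l, l ≤ i ∧ l ≤ j ∧ x ∈ O l)
    [∀ {i j} (f : i ⟶ j), IsOpenImmersion (F.map f)]
    [(F ⋙ Scheme.forget).IsLocallyDirected]
    (basis : ∀ (N : D.Opens), ∀ x ∈ N, ∃ i, x ∈ O i ∧ O i ≤ N) :
    ∃ f : D ⟶ colimit F, (∀ i, (O i).ι ≫ f = γ i ≫ colimit.ι F i) ∧ IsHomeomorph f ∧
      ∀ i, f ⁻¹ᵁ (colimit.ι F i).opensRange = O i := by
  have cov : ∀ x, ∃ i, x ∈ O i := fun x ↦ (basis ⊤ x trivial).imp fun _ h ↦ h.1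
  obtain ⟨f, hf⟩ := exists_glue_of_directed O mono cov dir (fun i ↦ γ i ≫ colimit.ι F i)
    (fun i j h ↦ by rw [← Category.assoc, nat i j (homOfLE h), Category.assoc, colimit.w])
  have hfx : ∀ i (x : O i), f x.1 = colimit.ι F i (γ i x) := fun i x ↦ congr($(hf i) x)
  have inj : Function.Injective f := by
    intro x y hxy
    obtain ⟨i, hi⟩ := cov x
    obtain ⟨j, hj⟩ := cov y
    rw [hfx i ⟨x, hi⟩, hfx j ⟨y, hj⟩, Scheme.IsLocallyDirected.ι_eq_ι_iff] at hxy
    obtain ⟨l, fi, fj, w, hwi, hwj⟩ := hxy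
    obtain ⟨v, rfl⟩ := (hγ l).surjective w
    have hi' := (map_apply_of_naturality mono nat fi v).symm.trans hwi
    have hj' := (map_apply_of_naturality mono nat fj v).symm.trans hwj
    exact (congrArg Subtype.val ((hγ i).injective hi')).symm.trans
      (congrArg Subtype.val ((hγ j).injective hj'))
  have himg : ∀ i, f '' (O i) = Set.range (colimit.ι F i) := by
    intro i
    ext z
    constructor
    · rintro ⟨x, hx, rfl⟩
      exact ⟨_, (hfx i ⟨x, hx⟩).symm⟩
    · rintro ⟨w, rfl⟩
      obtain ⟨x, rfl⟩ := (hγ i).surjective w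
      exact ⟨x.1, x.2, hfx i x⟩
  refine ⟨f, hf, ⟨f.continuous, ?_, inj, ?_⟩, fun i ↦ ?_⟩
  · intro N hN
    rw [isOpen_iff_forall_mem_open]
    rintro _ ⟨x, hx, rfl⟩
    obtain ⟨i, hi, hiN⟩ := basis ⟨N, hN⟩ x hx
    refine ⟨f '' (O i), Set.image_mono hiN, ?_, x, hi, rfl⟩
    rw [himg]
    exact (colimit.ι F i).opensRange.isOpen
  · intro z
    obtain ⟨i, w, rfl⟩ := Scheme.IsLocallyDirected.ι_jointly_surjective F z
    obtain ⟨x, rfl⟩ := (hγ i).surjective w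
    exact ⟨x.1, hfx i x⟩
  · ext x
    change f x ∈ Set.range (colimit.ι F i) ↔ x ∈ O i
    rw [← himg, inj.mem_set_image]
    rfl

end Colimit

end

/-! ### Affine pairs: the charts of the pushout of two closed immersions. -/

section

theorem isIso_toSpecΓ {X : Scheme.{u}} {U : X.Opens} (hU : IsAffineOpen U) : IsIso U.toSpecΓ := by
  rw [← hU.isoSpec_hom]
  infer_instance

theorem surjective_resLE {X Y : Scheme.{u}} (f : X ⟶ Y) [Surjective f] {U : Y.Opens} {V : X.Opens}
    (h : V = f ⁻¹ᵁ U) : Function.Surjective (f.resLE U V h.le) := by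
  rintro ⟨y, hy⟩
  obtain ⟨x, rfl⟩ := f.surjective y
  refine ⟨⟨x, by rw [h]; exact hy⟩, ?_⟩
  apply U.ι.injective
  have : (f.resLE U V h.le ≫ U.ι) ⟨x, by rw [h]; exact hy⟩ = (V.ι ≫ f) ⟨x, by rw [h]; exact hy⟩ := by
    rw [Scheme.Hom.resLE_comp_ι]
  exact this

theorem surjective_specMap_of_resLE {X Y : Scheme.{u}} (f : X ⟶ Y) {U : Y.Opens} {V : X.Opens}
    (hU : IsAffineOpen U) (h : V ≤ f ⁻¹ᵁ U) (hs : Function.Surjective (f.resLE U V h)) :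
    Function.Surjective (Spec.map (f.appLE U V h)) := by
  have e := Scheme.Opens.toSpecΓ_SpecMap_appLE f U V h
  have : IsIso U.toSpecΓ := isIso_toSpecΓ hU
  have h₁ : Function.Surjective (f.resLE U V h ≫ U.toSpecΓ) := by
    rw [Scheme.Hom.comp_base, TopCat.coe_comp]
    exact U.toSpecΓ.surjective.comp hs
  rw [← e, Scheme.Hom.comp_base, TopCat.coe_comp] at h₁
  exact h₁.of_comp

variable {X D₁ D₂ : Scheme.{u}}

/-- A pair of affine opens of `D₁` and `D₂` with the same preimage in `X`. -/
structure AffinePair (j₁ : X ⟶ D₁) (j₂ : X ⟶ D₂) where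
  U₁ : D₁.Opens
  U₂ : D₂.Opens
  preimage_eq : j₁ ⁻¹ᵁ U₁ = j₂ ⁻¹ᵁ U₂
  isAffineOpen₁ : IsAffineOpen U₁
  isAffineOpen₂ : IsAffineOpen U₂

namespace AffinePair

variable {j₁ : X ⟶ D₁} {j₂ : X ⟶ D₂} (U V : AffinePair j₁ j₂)

/-- The restriction of sections from `U₁` to the preimage in `X`. -/
abbrev q₁ : Γ(D₁, U.U₁) ⟶ Γ(X, j₁ ⁻¹ᵁ U.U₁) := j₁.appLE U.U₁ (j₁ ⁻¹ᵁ U.U₁) le_rfl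

/-- The restriction of sections from `U₂` to the preimage in `X`. -/
abbrev q₂ : Γ(D₂, U.U₂) ⟶ Γ(X, j₁ ⁻¹ᵁ U.U₁) := j₂.appLE U.U₂ (j₁ ⁻¹ᵁ U.U₁) U.preimage_eq.le

/-- The ring of pairs of sections on `U₁` and `U₂` that agree on `X`. -/
def ring : CommRingCat.{u} := pullback U.q₁ U.q₂

/-- The first projection. -/
def p₁ : U.ring ⟶ Γ(D₁, U.U₁) := pullback.fst _ _

/-- The second projection. -/
def p₂ : U.ring ⟶ Γ(D₂, U.U₂) := pullback.snd _ _

theorem isPullback : IsPullback U.p₁ U.p₂ U.q₁ U.q₂ := IsPullback.of_hasPullback _ _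

variable {U V}

/-- The restriction map between the rings of pairs. -/
def res (h₁ : U.U₁ ≤ V.U₁) (h₂ : U.U₂ ≤ V.U₂) : V.ring ⟶ U.ring :=
  U.isPullback.lift (V.p₁ ≫ D₁.presheaf.map (homOfLE h₁).op)
    (V.p₂ ≫ D₂.presheaf.map (homOfLE h₂).op) (by
      have := V.isPullback.w =≫ X.presheaf.map (homOfLE (j₁.preimage_mono h₁)).op
      simpa [q₁, q₂] using this)

theorem res_p₁ (h₁ : U.U₁ ≤ V.U₁) (h₂ : U.U₂ ≤ V.U₂) :
    res h₁ h₂ ≫ U.p₁ = V.p₁ ≫ D₁.presheaf.map (homOfLE h₁).op := IsPullback.lift_fst ..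

theorem res_p₂ (h₁ : U.U₁ ≤ V.U₁) (h₂ : U.U₂ ≤ V.U₂) :
    res h₁ h₂ ≫ U.p₂ = V.p₂ ≫ D₂.presheaf.map (homOfLE h₂).op := IsPullback.lift_snd ..

theorem res_self (h₁ : U.U₁ ≤ U.U₁) (h₂ : U.U₂ ≤ U.U₂) : res h₁ h₂ = 𝟙 U.ring := by
  apply U.isPullback.hom_ext
  · rw [res_p₁, Category.id_comp]
    exact (congrArg _ (D₁.presheaf.map_id _)).trans (Category.comp_id _)
  · rw [res_p₂, Category.id_comp]
    exact (congrArg _ (D₂.presheaf.map_id _)).trans (Category.comp_id _)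

theorem res_res {W : AffinePair j₁ j₂} (h₁ : U.U₁ ≤ V.U₁) (h₂ : U.U₂ ≤ V.U₂)
    (h₁' : V.U₁ ≤ W.U₁) (h₂' : V.U₂ ≤ W.U₂) :
    res h₁' h₂' ≫ res h₁ h₂ = res (h₁.trans h₁') (h₂.trans h₂') := by
  apply U.isPullback.hom_ext
  · rw [Category.assoc, res_p₁, ← Category.assoc, res_p₁, res_p₁, Category.assoc,
      ← Functor.map_comp]
    rfl
  · rw [Category.assoc, res_p₂, ← Category.assoc, res_p₂, res_p₂, Category.assoc,
      ← Functor.map_comp]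
    rfl

/-- The open immersion is built into the order, so `specFunctor` is a diagram of open immersions by
construction. It only has to be verified for basic opens (`basicOpen_le`), which suffice for
directedness. -/
instance : Preorder (AffinePair j₁ j₂) where
  le U V := ∃ (h₁ : U.U₁ ≤ V.U₁) (h₂ : U.U₂ ≤ V.U₂), IsOpenImmersion (Spec.map (res h₁ h₂))
  le_refl U := ⟨le_rfl, le_rfl, by rw [res_self]; infer_instance⟩
  le_trans U V W := by
    rintro ⟨h₁, h₂, h⟩ ⟨h₁', h₂', h'⟩
    refine ⟨h₁.trans h₁', h₂.trans h₂', ?_⟩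
    rw [← res_res h₁ h₂ h₁' h₂', Spec.map_comp]
    infer_instance

theorem le_fst (h : U ≤ V) : U.U₁ ≤ V.U₁ := h.choose

theorem le_snd (h : U ≤ V) : U.U₂ ≤ V.U₂ := h.choose_spec.choose

variable (j₁ j₂) in
/-- The spectra of the rings of pairs. -/
def specFunctor : AffinePair j₁ j₂ ⥤ Scheme.{u} where
  obj U := Spec U.ring
  map f := Spec.map (res (le_fst f.le) (le_snd f.le))
  map_id U := by rw [res_self]; exact Spec.map_id _
  map_comp f g := by rw [← Spec.map_comp, res_res]

instance {U V : AffinePair j₁ j₂} (f : U ⟶ V) : IsOpenImmersion ((specFunctor j₁ j₂).map f) :=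
  f.le.choose_spec.choose_spec

/-- The morphism `U₁ ⟶ Spec` of the ring of pairs. -/
def γ₁ (U : AffinePair j₁ j₂) : U.U₁.toScheme ⟶ Spec U.ring := U.U₁.toSpecΓ ≫ Spec.map U.p₁

/-- The morphism `U₂ ⟶ Spec` of the ring of pairs. -/
def γ₂ (U : AffinePair j₁ j₂) : U.U₂.toScheme ⟶ Spec U.ring := U.U₂.toSpecΓ ≫ Spec.map U.p₂

theorem γ₁_naturality (f : U ⟶ V) :
    D₁.homOfLE (le_fst f.le) ≫ V.γ₁ = U.γ₁ ≫ (specFunctor j₁ j₂).map f := by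
  rw [γ₁, γ₁, ← Scheme.Opens.toSpecΓ_SpecMap_presheaf_map_assoc, ← Spec.map_comp,
    ← res_p₁ _ (le_snd f.le), Spec.map_comp]
  exact (Category.assoc _ _ _).symm

theorem γ₂_naturality (f : U ⟶ V) :
    D₂.homOfLE (le_snd f.le) ≫ V.γ₂ = U.γ₂ ≫ (specFunctor j₁ j₂).map f := by
  rw [γ₂, γ₂, ← Scheme.Opens.toSpecΓ_SpecMap_presheaf_map_assoc, ← Spec.map_comp,
    ← res_p₂ (le_fst f.le), Spec.map_comp]
  exact (Category.assoc _ _ _).symm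

theorem res_eq_γ (U : AffinePair j₁ j₂) :
    j₁.resLE U.U₁ (j₁ ⁻¹ᵁ U.U₁) le_rfl ≫ U.γ₁ =
      j₂.resLE U.U₂ (j₁ ⁻¹ᵁ U.U₁) U.preimage_eq.le ≫ U.γ₂ := by
  rw [γ₁, γ₂, ← Scheme.Opens.toSpecΓ_SpecMap_appLE_assoc,
    ← Scheme.Opens.toSpecΓ_SpecMap_appLE_assoc, ← Spec.map_comp, ← Spec.map_comp, U.isPullback.w]

section ClosedImmersion

theorem q₁_surjective [IsClosedImmersion j₁] (U : AffinePair j₁ j₂) : Function.Surjective U.q₁ := by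
  rw [q₁, j₁.appLE_eq_app]
  exact j₁.app_surjective U.U₁ U.isAffineOpen₁

theorem q₂_surjective [IsClosedImmersion j₂] (U : AffinePair j₁ j₂) : Function.Surjective U.q₂ := by
  have h := U.preimage_eq
  rw [q₂]
  generalize_proofs hp
  generalize j₁ ⁻¹ᵁ U.U₁ = Q at h hp
  subst h
  rw [j₂.appLE_eq_app]
  exact j₂.app_surjective U.U₂ U.isAffineOpen₂

/-- Surjectivity of `j₂` makes the kernel of `q₂` nil. -/
theorem isHomeomorph_γ₁ [IsClosedImmersion j₂] [Surjective j₂] (U : AffinePair j₁ j₂) : IsHomeomorph U.γ₁ := by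
  have := isIso_toSpecΓ U.isAffineOpen₁
  rw [γ₁, Scheme.Hom.comp_base, TopCat.coe_comp]
  refine (isHomeomorph_specMap_fst U.isPullback U.q₂_surjective ?_).comp
    U.U₁.toSpecΓ.homeomorph.isHomeomorph
  exact ker_le_nilradical_of_surjective _ U.q₂_surjective
    (surjective_specMap_of_resLE j₂ U.isAffineOpen₂ _ (surjective_resLE j₂ U.preimage_eq))

theorem isHomeomorph_γ₂ [IsClosedImmersion j₁] [Surjective j₁] (U : AffinePair j₁ j₂) : IsHomeomorph U.γ₂ := by
  have := isIso_toSpecΓ U.isAffineOpen₂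
  rw [γ₂, Scheme.Hom.comp_base, TopCat.coe_comp]
  refine (isHomeomorph_specMap_fst U.isPullback.flip U.q₁_surjective ?_).comp
    U.U₂.toSpecΓ.homeomorph.isHomeomorph
  exact ker_le_nilradical_of_surjective _ U.q₁_surjective
    (surjective_specMap_of_resLE j₁ U.isAffineOpen₁ _ (surjective_resLE j₁ rfl))

end ClosedImmersion

section Basis

theorem isAway_map {X : Scheme.{u}} {U : X.Opens} (hU : IsAffineOpen U) (f : Γ(X, U)) {V : X.Opens}
    (h : V ≤ U) (e : V = X.basicOpen f) : IsAway (X.presheaf.map (homOfLE h).op).hom f := by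
  algebraize [(X.presheaf.map (homOfLE h).op).hom]
  have := hU.isLocalization_of_eq_basicOpen f (homOfLE h) e
  exact IsAway.of_isLocalization f

theorem preimage_basicOpen_appLE {X Y : Scheme.{u}} (f : X ⟶ Y) {U : Y.Opens} {V : X.Opens}
    (h : V = f ⁻¹ᵁ U) (a : Γ(Y, U)) :
    f ⁻¹ᵁ Y.basicOpen a = X.basicOpen (f.appLE U V h.le a) := by
  subst h
  rw [f.appLE_eq_app, Scheme.preimage_basicOpen]

/-- The basic open pair defined by an element of the ring of pairs. -/
def basicOpen (V : AffinePair j₁ j₂) (f : V.ring) : AffinePair j₁ j₂ where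
  U₁ := D₁.basicOpen (V.p₁ f)
  U₂ := D₂.basicOpen (V.p₂ f)
  preimage_eq := by
    rw [preimage_basicOpen_appLE j₁ rfl, preimage_basicOpen_appLE j₂ V.preimage_eq]
    congr 1
    exact congr($V.isPullback.w f)
  isAffineOpen₁ := V.isAffineOpen₁.basicOpen _
  isAffineOpen₂ := V.isAffineOpen₂.basicOpen _

theorem basicOpen_le [IsAffineHom j₁] (V : AffinePair j₁ j₂) (f : V.ring) : V.basicOpen f ≤ V := by
  have h₁ : (V.basicOpen f).U₁ ≤ V.U₁ := D₁.basicOpen_le _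
  have h₂ : (V.basicOpen f).U₂ ≤ V.U₂ := D₂.basicOpen_le _
  refine ⟨h₁, h₂, IsAway.isOpenImmersion (f := f) ?_⟩
  refine IsAway.fibreProduct V.isPullback (V.basicOpen f).isPullback (res_p₁ h₁ h₂) (res_p₂ h₁ h₂)
    (ρ₀ := X.presheaf.map (homOfLE (j₁.preimage_mono h₁)).op) ?_ ?_ ?_ ?_ ?_
  · simp [q₁]
  · simp [q₂]
  · exact isAway_map V.isAffineOpen₁ _ h₁ rfl
  · exact isAway_map V.isAffineOpen₂ _ h₂ rfl
  · exact isAway_map (V.isAffineOpen₁.preimage j₁) _ _ (preimage_basicOpen_appLE j₁ rfl _)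

theorem ext_of_eq {U V : AffinePair j₁ j₂} (h₁ : U.U₁ = V.U₁) (h₂ : U.U₂ = V.U₂) : U = V := by
  cases U; cases V; simp_all

theorem opens_eq_of_preimage_eq {X Y : Scheme.{u}} (f : X ⟶ Y) [Surjective f] {U V : Y.Opens}
    (h : f ⁻¹ᵁ U = f ⁻¹ᵁ V) : U = V := by
  ext y
  obtain ⟨x, rfl⟩ := f.surjective y
  exact (SetLike.ext_iff.mp h x)

variable [IsClosedImmersion j₁] [IsClosedImmersion j₂]

theorem exists_basicOpen_preimage (V : AffinePair j₁ j₂) (f : Γ(X, j₁ ⁻¹ᵁ V.U₁)) :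
    ∃ a : V.ring, j₁ ⁻¹ᵁ (V.basicOpen a).U₁ = X.basicOpen f := by
  obtain ⟨a₁, ha₁⟩ := V.q₁_surjective f
  obtain ⟨a₂, ha₂⟩ := V.q₂_surjective f
  obtain ⟨a, h₁, h₂⟩ := exists_of_isPullback_commRingCat V.isPullback (ha₁.trans ha₂.symm)
  exact ⟨a, by rw [basicOpen, preimage_basicOpen_appLE j₁ rfl, h₁]; exact congrArg _ ha₁⟩

/-- Two affine opens of `X` share a basic open around `x`. Its equations lift to both rings of
pairs, and the two basic pairs coincide because opens are determined by their preimages under the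
surjections `j₁` and `j₂`. -/
theorem exists_le_le [Surjective j₁] [Surjective j₂] (U V : AffinePair j₁ j₂) (x : X)
    (hU : j₁ x ∈ U.U₁) (hV : j₁ x ∈ V.U₁) : ∃ W ≤ U, W ≤ V ∧ j₁ x ∈ W.U₁ := by
  obtain ⟨f, g, hfg, hx⟩ := exists_basicOpen_le_affine_inter (U.isAffineOpen₁.preimage j₁)
    (V.isAffineOpen₁.preimage j₁) x ⟨hU, hV⟩
  obtain ⟨a, ha⟩ := U.exists_basicOpen_preimage f
  obtain ⟨b, hb⟩ := V.exists_basicOpen_preimage g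
  have hab : U.basicOpen a = V.basicOpen b :=
    ext_of_eq (opens_eq_of_preimage_eq j₁ (by rw [ha, hb, hfg]))
      (opens_eq_of_preimage_eq j₂ (by
        rw [← (U.basicOpen a).preimage_eq, ← (V.basicOpen b).preimage_eq, ha, hb, hfg]))
  refine ⟨U.basicOpen a, U.basicOpen_le a, hab ▸ V.basicOpen_le b, ?_⟩
  rw [← ha] at hx
  exact hx

variable (j₁ j₂) in
-- Affine neighbourhoods chosen separately may have different preimages; a common basic open of
-- these preimages lifts to basic opens on both sides.
theorem exists_mem_le (x : X) {N₁ : D₁.Opens} {N₂ : D₂.Opens} (h₁ : j₁ x ∈ N₁) (h₂ : j₂ x ∈ N₂) :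
    ∃ U : AffinePair j₁ j₂, j₁ x ∈ U.U₁ ∧ U.U₁ ≤ N₁ ∧ U.U₂ ≤ N₂ := by
  obtain ⟨A₁, hA₁, hxA₁, hN₁⟩ := exists_isAffineOpen_mem_and_subset h₁
  obtain ⟨A₂, hA₂, hxA₂, hN₂⟩ := exists_isAffineOpen_mem_and_subset h₂
  obtain ⟨f, g, hfg, hx⟩ := exists_basicOpen_le_affine_inter (hA₁.preimage j₁)
    (hA₂.preimage j₂) x ⟨hxA₁, hxA₂⟩
  obtain ⟨a, rfl⟩ := j₁.app_surjective A₁ hA₁ f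
  obtain ⟨b, rfl⟩ := j₂.app_surjective A₂ hA₂ g
  rw [← Scheme.preimage_basicOpen, ← Scheme.preimage_basicOpen] at hfg
  rw [← Scheme.preimage_basicOpen] at hx
  exact ⟨⟨_, _, hfg, hA₁.basicOpen a, hA₂.basicOpen b⟩, hx, (D₁.basicOpen_le _).trans hN₁,
    (D₂.basicOpen_le _).trans hN₂⟩

end Basis

end AffinePair

end

/-! ### Construction of the pushout. -/

section

variable {X D₁ D₂ : Scheme.{u}} {j₁ : X ⟶ D₁} {j₂ : X ⟶ D₂}

theorem appLE_opensRange_eq {D Z : Scheme.{u}} {R : CommRingCat.{u}} {U : D.Opens} {i : D ⟶ Z}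
    {κ : Spec R ⟶ Z} [IsOpenImmersion κ] {p : R ⟶ Γ(D, U)}
    (h : U.ι ≫ i = (U.toSpecΓ ≫ Spec.map p) ≫ κ) (hU : U ≤ i ⁻¹ᵁ κ.opensRange) :
    i.appLE κ.opensRange U hU =
      (κ.appLE κ.opensRange ⊤ (κ.preimage_opensRange.ge) ≫ (Scheme.ΓSpecIso R).hom) ≫ p := by
  have hU' : (⊤ : U.toScheme.Opens) ≤ (U.ι ≫ i) ⁻¹ᵁ κ.opensRange := fun x _ ↦ hU x.2
  have hU'' : (⊤ : U.toScheme.Opens) ≤ ((U.toSpecΓ ≫ Spec.map p) ≫ κ) ⁻¹ᵁ κ.opensRange :=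
    h ▸ hU'
  have e := appLE_congr_hom h hU' hU''
  rw [← Scheme.Hom.appLE_comp_appLE (e₁ := hU) (e₂ := U.ι_preimage_self.ge),
    ← Scheme.Hom.appLE_comp_appLE (V := ⊤) (W := ⊤)
      (e₁ := κ.preimage_opensRange.ge) (e₂ := le_rfl)] at e
  have e₂ : (U.toSpecΓ ≫ Spec.map p).appLE ⊤ ⊤ le_rfl = (Scheme.ΓSpecIso R).hom ≫ p ≫ U.topIso.inv := by
    refine (Scheme.Hom.appLE_eq_app _).trans ?_
    rw [← Scheme.Hom.appTop, Scheme.Hom.comp_appTop, Scheme.Opens.toSpecΓ_appTop, Scheme.ΓSpecIso_naturality_assoc]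
  have e₁ : U.ι.appLE U ⊤ U.ι_preimage_self.ge = U.topIso.inv := by
    rw [Scheme.Opens.ι_appLE]; rfl
  rw [e₁, e₂] at e
  rw [← cancel_mono U.topIso.inv, e]
  simp only [Category.assoc]

/-- On a chart, the sections of `Z` are the ring of pairs and pulling back along `i₁`, `i₂` is
projecting; `e` is this identification. -/
theorem AffinePair.isMilnorOn {Z : Scheme.{u}} (U : AffinePair j₁ j₂) {i₁ : D₁ ⟶ Z} {i₂ : D₂ ⟶ Z}
    (κ : Spec U.ring ⟶ Z) [IsOpenImmersion κ] (h₁ : U.U₁.ι ≫ i₁ = U.γ₁ ≫ κ)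
    (h₂ : U.U₂.ι ≫ i₂ = U.γ₂ ≫ κ) (e₁ : i₁ ⁻¹ᵁ κ.opensRange = U.U₁)
    (e₂ : i₂ ⁻¹ᵁ κ.opensRange = U.U₂) : IsMilnorOn j₁ j₂ i₁ i₂ κ.opensRange := by
  let e := κ.appLE κ.opensRange ⊤ κ.preimage_opensRange.ge ≫ (Scheme.ΓSpecIso U.ring).hom
  have : IsIso (κ.appLE κ.opensRange ⊤ κ.preimage_opensRange.ge) := by
    have := κ.isIso_app κ.opensRange le_rfl
    have : IsIso ((Spec U.ring).presheaf.map (homOfLE κ.preimage_opensRange.ge).op) :=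
      inferInstanceAs (IsIso ((Spec U.ring).presheaf.map (eqToHom κ.preimage_opensRange.symm).op))
    rw [Scheme.Hom.appLE]
    infer_instance
  have : IsIso e := inferInstance
  have a₁ := appLE_opensRange_eq h₁ e₁.ge
  have a₂ := appLE_opensRange_eq h₂ e₂.ge
  have r₁ : ∀ a, i₁.appLE κ.opensRange U.U₁ e₁.ge a = U.p₁ (e a) := fun a ↦ congr(($a₁).hom a)
  have r₂ : ∀ a, i₂.appLE κ.opensRange U.U₂ e₂.ge a = U.p₂ (e a) := fun a ↦ congr(($a₂).hom a)
  have t₁ : ∀ a, i₁.appLE κ.opensRange U.U₁ e₁.ge a =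
      D₁.presheaf.map (eqToHom e₁.symm).op (i₁.app _ a) := fun a ↦ rfl
  have t₂ : ∀ a, i₂.appLE κ.opensRange U.U₂ e₂.ge a =
      D₂.presheaf.map (eqToHom e₂.symm).op (i₂.app _ a) := fun a ↦ rfl
  refine ⟨fun a ha₁ ha₂ ↦ ?_, fun a₁ a₂ ha ↦ ?_⟩
  · have : e a = 0 := by
      refine eq_of_isPullback_commRingCat U.isPullback ?_ ?_
      · rw [← r₁, t₁, ha₁, map_zero, map_zero]
      · rw [← r₂, t₂, ha₂, map_zero, map_zero]
    exact (ConcreteCategory.bijective_of_isIso e).1 (this.trans (map_zero e.hom).symm)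
  · obtain ⟨b, hb₁, hb₂⟩ := exists_of_isPullback_commRingCat U.isPullback
      (a₁ := D₁.presheaf.map (eqToHom e₁.symm).op a₁)
      (a₂ := D₂.presheaf.map (eqToHom e₂.symm).op a₂) (by
        have := ha (j₁ ⁻¹ᵁ U.U₁) (by rw [e₁]) (by rw [e₂, U.preimage_eq])
        refine .trans ?_ (this.trans ?_)
        · exact congr($(j₁.map_appLE le_rfl (eqToHom e₁.symm).op) a₁)
        · exact congr($(j₂.map_appLE U.preimage_eq.le (eqToHom e₂.symm).op) a₂).symm)
    obtain ⟨a, rfl⟩ := (ConcreteCategory.bijective_of_isIso e).2 b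
    refine ⟨a, ?_, ?_⟩
    · rw [← r₁, t₁] at hb₁
      exact (ConcreteCategory.bijective_of_isIso (D₁.presheaf.map (eqToHom e₁.symm).op)).1 hb₁
    · rw [← r₂, t₂] at hb₂
      exact (ConcreteCategory.bijective_of_isIso (D₂.presheaf.map (eqToHom e₂.symm).op)).1 hb₂

/-- Two surjective closed immersions with the same source have a pushout in the category of schemes
that is a pushout on the level of sections over a basis of affine opens. -/
theorem exists_milnorSquare (j₁ : X ⟶ D₁) (j₂ : X ⟶ D₂) [IsClosedImmersion j₁]
    [IsClosedImmersion j₂] [Surjective j₁] [Surjective j₂] :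
    ∃ (Z : Scheme.{u}) (i₁ : D₁ ⟶ Z) (i₂ : D₂ ⟶ Z), j₁ ≫ i₁ = j₂ ≫ i₂ ∧ IsHomeomorph i₁ ∧
      IsHomeomorph i₂ ∧ ∀ (O : Z.Opens), ∀ z ∈ O, ∃ W ≤ O, z ∈ W ∧ IsAffineOpen W ∧
        IsAffineOpen (i₁ ⁻¹ᵁ W) ∧ IsAffineOpen (i₂ ⁻¹ᵁ W) ∧ IsMilnorOn j₁ j₂ i₁ i₂ W := by
  -- The pushout is the colimit of the spectra of the rings of pairs, glued along open immersions.
  let F := AffinePair.specFunctor j₁ j₂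
  have mem_iff : ∀ (U : AffinePair j₁ j₂) (x : X), j₁ x ∈ U.U₁ ↔ j₂ x ∈ U.U₂ := fun U x ↦
    SetLike.ext_iff.mp U.preimage_eq x
  have dir₁ : ∀ (U V : AffinePair j₁ j₂) (x : D₁), x ∈ U.U₁ → x ∈ V.U₁ →
      ∃ W, W ≤ U ∧ W ≤ V ∧ x ∈ W.U₁ := by
    intro U V x hU hV
    obtain ⟨x, rfl⟩ := j₁.surjective x
    obtain ⟨W, h⟩ := U.exists_le_le V x hU hV
    exact ⟨W, h.1, h.2.1, h.2.2⟩
  have dir₂ : ∀ (U V : AffinePair j₁ j₂) (x : D₂), x ∈ U.U₂ → x ∈ V.U₂ →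
      ∃ W, W ≤ U ∧ W ≤ V ∧ x ∈ W.U₂ := by
    intro U V x hU hV
    obtain ⟨x, rfl⟩ := j₂.surjective x
    rw [← mem_iff] at hU hV
    obtain ⟨W, h⟩ := U.exists_le_le V x hU hV
    exact ⟨W, h.1, h.2.1, (mem_iff _ _).mp h.2.2⟩
  have basis₁ : ∀ (N : D₁.Opens), ∀ x ∈ N, ∃ U : AffinePair j₁ j₂, x ∈ U.U₁ ∧ U.U₁ ≤ N := by
    intro N x hx
    obtain ⟨x, rfl⟩ := j₁.surjective x
    obtain ⟨U, h⟩ := AffinePair.exists_mem_le j₁ j₂ x hx (N₂ := ⊤) trivial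
    exact ⟨U, h.1, h.2.1⟩
  have basis₂ : ∀ (N : D₂.Opens), ∀ x ∈ N, ∃ U : AffinePair j₁ j₂, x ∈ U.U₂ ∧ U.U₂ ≤ N := by
    intro N x hx
    obtain ⟨x, rfl⟩ := j₂.surjective x
    obtain ⟨U, h⟩ := AffinePair.exists_mem_le j₁ j₂ x (N₁ := ⊤) trivial hx
    exact ⟨U, (mem_iff _ _).mp h.1, h.2.2⟩
  have : (F ⋙ Scheme.forget).IsLocallyDirected :=
    isLocallyDirected_of_opens (γ := AffinePair.γ₁) AffinePair.isHomeomorph_γ₁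
      (fun _ _ ↦ AffinePair.le_fst) (fun _ _ ↦ AffinePair.γ₁_naturality) dir₁
  have : ∀ {i j} (f : i ⟶ j), IsOpenImmersion (F.map f) := fun f ↦
    inferInstanceAs (IsOpenImmersion ((AffinePair.specFunctor j₁ j₂).map f))
  obtain ⟨i₁, hi₁, hh₁, hp₁⟩ := exists_hom_colimit (F := F) (γ := AffinePair.γ₁)
    AffinePair.isHomeomorph_γ₁ (fun _ _ ↦ AffinePair.le_fst) (fun _ _ ↦ AffinePair.γ₁_naturality)
    dir₁ basis₁
  obtain ⟨i₂, hi₂, hh₂, hp₂⟩ := exists_hom_colimit (F := F) (γ := AffinePair.γ₂)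
    AffinePair.isHomeomorph_γ₂ (fun _ _ ↦ AffinePair.le_snd) (fun _ _ ↦ AffinePair.γ₂_naturality)
    dir₂ basis₂
  refine ⟨colimit F, i₁, i₂, ?_, hh₁, hh₂, fun O z hz ↦ ?_⟩
  · refine Scheme.hom_ext_of_forall _ _ fun x ↦ ?_
    obtain ⟨U, hU, -⟩ := basis₁ ⊤ (j₁ x) trivial
    refine ⟨j₁ ⁻¹ᵁ U.U₁, hU, ?_⟩
    have h₁ := Scheme.Hom.resLE_comp_ι j₁ (U := U.U₁) (V := j₁ ⁻¹ᵁ U.U₁) le_rfl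
    have h₂ := Scheme.Hom.resLE_comp_ι j₂ (U := U.U₂) (V := j₁ ⁻¹ᵁ U.U₁) U.preimage_eq.le
    rw [← Category.assoc, ← Category.assoc, ← h₁, ← h₂, Category.assoc, Category.assoc, hi₁, hi₂]
    exact (Category.assoc _ _ _).symm.trans
      ((congrArg (· ≫ colimit.ι F U) U.res_eq_γ).trans (Category.assoc _ _ _))
  · obtain ⟨y, rfl⟩ := hh₁.surjective z
    obtain ⟨U, hU, hUO⟩ := basis₁ (i₁ ⁻¹ᵁ O) y hz
    let κ : Spec U.ring ⟶ colimit F := colimit.ι F U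
    have : IsOpenImmersion κ := inferInstanceAs (IsOpenImmersion (colimit.ι F U))
    refine ⟨κ.opensRange, fun z hz ↦ ?_, ?_, isAffineOpen_opensRange κ, ?_, ?_, ?_⟩
    · obtain ⟨x, rfl⟩ := hh₁.surjective z
      exact hUO ((SetLike.ext_iff.mp (hp₁ U) x).mp hz)
    · exact (SetLike.ext_iff.mp (hp₁ U) y).mpr hU
    · have : i₁ ⁻¹ᵁ κ.opensRange = U.U₁ := hp₁ U
      rw [this]; exact U.isAffineOpen₁
    · have : i₂ ⁻¹ᵁ κ.opensRange = U.U₂ := hp₂ U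
      rw [this]; exact U.isAffineOpen₂
    · exact U.isMilnorOn κ (hi₁ U) (hi₂ U) (hp₁ U) (hp₂ U)

end

section

/-! ### Schemes over `Spec A` and the ideals of their closed base changes. -/

section BaseHom

variable {A B : Type u} [CommRing A] [CommRing B] {Z E : Scheme.{u}}

theorem le_preimage_top (f : E ⟶ Z) (V : E.Opens) : V ≤ f ⁻¹ᵁ ⊤ := le_top

/-- The ring homomorphism `A → Γ(Z, W)`, for a scheme `Z` over `Spec A`. -/
def baseHom (σ : Z ⟶ Spec (.of A)) (W : Z.Opens) : A →+* Γ(Z, W) :=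
  ((Scheme.ΓSpecIso (.of A)).inv ≫ σ.appLE ⊤ W (le_preimage_top _ _)).hom

theorem appLE_baseHom {σ : Z ⟶ Spec (.of A)} {f : E ⟶ Z} {g : E ⟶ Spec (.of B)} {φ : A →+* B}
    (w : f ≫ σ = g ≫ Spec.map (CommRingCat.ofHom φ)) {W : Z.Opens} {V : E.Opens} (h : V ≤ f ⁻¹ᵁ W)
    (a : A) : f.appLE W V h (baseHom σ W a) = baseHom g V (φ a) := by
  have e : (Scheme.ΓSpecIso (.of A)).inv ≫ σ.appLE ⊤ W (le_preimage_top _ _) ≫ f.appLE W V h =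
      CommRingCat.ofHom φ ≫ (Scheme.ΓSpecIso (.of B)).inv ≫ g.appLE ⊤ V (le_preimage_top _ _) := by
    rw [Scheme.Hom.appLE_comp_appLE, appLE_congr_hom w _ (le_preimage_top _ _), Scheme.ΓSpecIso_inv_naturality_assoc,
      ← Scheme.Hom.appLE_comp_appLE (V := ⊤) (e₁ := le_preimage_top _ _)
      (e₂ := le_preimage_top _ _)]
    congr 2
  exact congr($e a)

theorem appLE_baseHom_of_comp_eq {σ : Z ⟶ Spec (.of A)} {f : E ⟶ Z} {g : E ⟶ Spec (.of A)}
    (w : f ≫ σ = g) {W : Z.Opens} {V : E.Opens} (h : V ≤ f ⁻¹ᵁ W) (a : A) :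
    f.appLE W V h (baseHom σ W a) = baseHom g V a := by
  refine appLE_baseHom (φ := RingHom.id A) ?_ h a
  rw [w]
  exact ((congrArg _ (Spec.map_id _)).trans (Category.comp_id _)).symm

theorem app_baseHom {σ : Z ⟶ Spec (.of A)} {f : E ⟶ Z} {g : E ⟶ Spec (.of B)} {φ : A →+* B}
    (w : f ≫ σ = g ≫ Spec.map (CommRingCat.ofHom φ)) (W : Z.Opens) (a : A) :
    f.app W (baseHom σ W a) = baseHom g (f ⁻¹ᵁ W) (φ a) := by
  rw [← f.appLE_eq_app]
  exact appLE_baseHom w _ a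

theorem baseHom_flat (σ : Z ⟶ Spec (.of A)) [Flat σ] {W : Z.Opens} (hW : IsAffineOpen W) :
    (baseHom σ W).Flat := by
  have h : (σ.appLE ⊤ W (le_preimage_top _ _)).hom.Flat :=
    HasRingHomProperty.appLE @Flat σ inferInstance ⟨⊤, isAffineOpen_top _⟩ ⟨W, hW⟩ le_top
  rw [baseHom, CommRingCat.hom_comp]
  exact RingHom.Flat.comp (.of_bijective
    (ConcreteCategory.bijective_of_isIso (Scheme.ΓSpecIso (.of A)).inv)) h

theorem isClosedImmersion_of_isPullback {σ : Z ⟶ Spec (.of A)} {f : E ⟶ Z} {g : E ⟶ Spec (.of B)}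
    {φ : A →+* B} (h : IsPullback f g σ (Spec.map (CommRingCat.ofHom φ)))
    (hφ : Function.Surjective φ) : IsClosedImmersion f := by
  have : IsClosedImmersion (Spec.map (CommRingCat.ofHom φ)) :=
    IsClosedImmersion.spec_of_surjective _ hφ
  exact MorphismProperty.of_isPullback h.flip inferInstance

/-- Over an affine `W` the sections of `E` are the pushout of `Γ(Z, W)` and `B` over `A`. The
quotient of `Γ(Z, W)` by the extension of `ker φ` receives a map from this pushout, so nothing else
can die. -/
theorem ker_app_of_isPullback {σ : Z ⟶ Spec (.of A)} {f : E ⟶ Z} {g : E ⟶ Spec (.of B)}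
    {φ : A →+* B} (h : IsPullback f g σ (Spec.map (CommRingCat.ofHom φ)))
    (hφ : Function.Surjective φ) {W : Z.Opens} (hW : IsAffineOpen W) :
    RingHom.ker (f.app W).hom = (RingHom.ker φ).map (baseHom σ W) := by
  apply le_antisymm
  · intro a ha
    have hp : IsPushout (σ.appLE ⊤ W (le_preimage_top _ _))
        ((Spec.map (CommRingCat.ofHom φ)).appLE ⊤ ⊤ (le_preimage_top _ _)) (f.appLE W (f ⁻¹ᵁ W) le_rfl)
          (g.appLE ⊤ (f ⁻¹ᵁ W) (le_preimage_top _ _)) := by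
      refine (isIso_pushoutSection_iff (US := ⊤) (UT := ⊤) (UX := W) (UY := f ⁻¹ᵁ W) h le_top le_top
        (by simp)).mp ?_
      exact isIso_pushoutSection_of_isAffineOpen (US := ⊤) (UT := ⊤) (UX := W) (UY := f ⁻¹ᵁ W)
        h le_top le_top (by simp) (isAffineOpen_top _) (isAffineOpen_top _) hW
    let J := (RingHom.ker φ).map (baseHom σ W)
    let m : Γ(Z, W) ⟶ CommRingCat.of (Γ(Z, W) ⧸ J) := CommRingCat.ofHom (Ideal.Quotient.mk J)
    let l : B →+* Γ(Z, W) ⧸ J := (RingHom.liftOfSurjective φ hφ)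
      ⟨(Ideal.Quotient.mk J).comp (baseHom σ W), fun x hx ↦ by
        rw [RingHom.mem_ker, RingHom.comp_apply, Ideal.Quotient.eq_zero_iff_mem]
        exact Ideal.mem_map_of_mem _ hx⟩
    have hl : ∀ x, l (φ x) = Ideal.Quotient.mk J (baseHom σ W x) := fun x ↦
      RingHom.liftOfRightInverse_comp_apply ..
    have w : σ.appLE ⊤ W (le_preimage_top _ _) ≫ m = (Spec.map (CommRingCat.ofHom φ)).appLE ⊤ ⊤ (le_preimage_top _ _) ≫
        (Scheme.ΓSpecIso (.of B)).hom ≫ CommRingCat.ofHom l := by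
      have e : (Spec.map (CommRingCat.ofHom φ)).appLE ⊤ ⊤ (le_preimage_top _ _) ≫ (Scheme.ΓSpecIso (.of B)).hom =
          (Scheme.ΓSpecIso (.of A)).hom ≫ CommRingCat.ofHom φ := by
        rw [← Scheme.ΓSpecIso_naturality]
        exact congrArg (· ≫ _) (Scheme.Hom.appLE_eq_app _)
      rw [← Category.assoc, e, Category.assoc, ← Iso.inv_comp_eq]
      ext x
      exact (hl x).symm
    have e := hp.inl_desc _ _ w
    have e' : hp.desc _ _ w (f.appLE W (f ⁻¹ᵁ W) le_rfl a) = m a := congr($e a)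
    have ha : f.appLE W (f ⁻¹ᵁ W) le_rfl a = 0 := by
      rw [f.appLE_eq_app]
      exact ha
    rw [ha, map_zero] at e'
    exact Ideal.Quotient.eq_zero_iff_mem.mp e'.symm
  · rw [Ideal.map_le_iff_le_comap]
    intro x hx
    rw [Ideal.mem_comap, RingHom.mem_ker]
    refine (app_baseHom h.w W x).trans ?_
    rw [(hx : φ x = 0), map_zero]

/-- Since `f` factors through the fibre product, one inclusion of ideal sheaves is automatic and the
hypothesis is the other. Closed immersions with the same ideal sheaf agree. -/
theorem isPullback_of_ker_app_le {σ : Z ⟶ Spec (.of A)} {f : E ⟶ Z} {g : E ⟶ Spec (.of B)}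
    {φ : A →+* B} (w : f ≫ σ = g ≫ Spec.map (CommRingCat.ofHom φ)) (hφ : Function.Surjective φ)
    [IsClosedImmersion f] (h : ∀ z : Z, ∃ W : Z.Opens, z ∈ W ∧ IsAffineOpen W ∧
      RingHom.ker (f.app W).hom ≤ (RingHom.ker φ).map (baseHom σ W)) :
    IsPullback f g σ (Spec.map (CommRingCat.ofHom φ)) := by
  let P := pullback σ (Spec.map (CommRingCat.ofHom φ))
  have hP := IsPullback.of_hasPullback σ (Spec.map (CommRingCat.ofHom φ))
  have : IsClosedImmersion (pullback.fst σ (Spec.map (CommRingCat.ofHom φ))) :=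
    isClosedImmersion_of_isPullback hP hφ
  choose W hzW hW hk using h
  have hker : f.ker = (pullback.fst σ (Spec.map (CommRingCat.ofHom φ))).ker := by
    refine le_antisymm ?_ ?_
    · refine Scheme.IdealSheafData.le_of_iSup_eq_top (fun z ↦ ⟨W z, hW z⟩)
        (top_unique fun z _ ↦ Opens.mem_iSup.mpr ⟨z, hzW z⟩) fun z ↦ ?_
      rw [Scheme.Hom.ker_apply, Scheme.Hom.ker_apply, ker_app_of_isPullback hP hφ (hW z)]
      exact hk z
    · have := Scheme.Hom.le_ker_comp (hP.lift f g w) (pullback.fst σ (Spec.map (CommRingCat.ofHom φ)))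
      rwa [hP.lift_fst] at this
  have := IsClosedImmersion.isIso_of_ker_eq f (pullback.fst σ (Spec.map (CommRingCat.ofHom φ)))
    (hP.lift f g w) (hP.lift_fst _ _ _) hker
  exact hP.of_iso (asIso (hP.lift f g w)).symm (Iso.refl _) (Iso.refl _) (Iso.refl _)
    (by simp) (by simp) (by simp) (by simp)

end BaseHom

end

section

/-! ### Deformations as flat families over `Spec A`. -/

section Squares

theorem hom_comp_app {X Y Z : Scheme.{u}} {f : X ⟶ Y} {g : Y ⟶ Z} {h : X ⟶ Z} (w : f ≫ g = h)
    {W : Z.Opens} {Q : X.Opens} (e : Q ≤ f ⁻¹ᵁ g ⁻¹ᵁ W) (e' : Q ≤ h ⁻¹ᵁ W) :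
    (f.appLE (g ⁻¹ᵁ W) Q e).hom.comp (g.app W).hom = (h.appLE W Q e').hom := by
  subst w
  rw [Scheme.Hom.comp_appLE, CommRingCat.hom_comp]

variable {k : Type u} [Field k] {S : Scheme.{u}} {s : S ⟶ Spec (.of k)} {X : Over S}
  {A B : Type u} [CommRing A] [Algebra k A] [CommRing B] [Algebra k B]

theorem isPullback_prodSpecMap (φ : A →ₐ[k] B) :
    IsPullback (prodSpecMap s φ) (pullback.snd _ _) (pullback.snd _ _)
      (Spec.map (CommRingCat.ofHom φ.toRingHom)) := by
  refine (IsPullback.of_bot (v₁₁ := prodSpecMap s φ) (v₂₁ := pullback.fst _ _)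
    (h₃₁ := s) (h₁₁ := pullback.snd _ _) (h₂₁ := pullback.snd _ _)
    (v₁₂ := Spec.map (CommRingCat.ofHom φ.toRingHom))
    (v₂₂ := Spec.map (CommRingCat.ofHom (algebraMap k A))) ?_ ?_
    (IsPullback.of_hasPullback _ _).flip).flip
  · rw [prodSpecMap_fst, ← Spec.map_comp, ← CommRingCat.ofHom_comp]
    have : φ.toRingHom.comp (algebraMap k A) = algebraMap k B := φ.comp_algebraMap
    rw [this]
    exact (IsPullback.of_hasPullback _ _).flip
  · exact (pullback.lift_snd _ _ _).symm

/-- `Spec A` is a single point, so `Spec B ⟶ Spec A` is surjective, and surjectivity survives base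
change. -/
theorem surjective_of_isPullback [IsArtAlg k A] [Nontrivial B] {Z E : Scheme.{u}} {σ : Z ⟶ Spec (.of A)} {f : E ⟶ Z}
    {g : E ⟶ Spec (.of B)} {φ : A →ₐ[k] B}
    (h : IsPullback f g σ (Spec.map (CommRingCat.ofHom φ.toRingHom))) : Surjective f := by
  have := IsArtAlg.toIsLocalRing (k := k) (A := A)
  have : IsArtinianRing A := ‹IsArtAlg k A›.2
  have : Subsingleton (Spec (.of A)) := inferInstanceAs (Subsingleton (PrimeSpectrum A))
  have : Nonempty (Spec (.of B)) := inferInstanceAs (Nonempty (PrimeSpectrum B))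
  have : Surjective (Spec.map (CommRingCat.ofHom φ.toRingHom)) := inferInstance
  exact MorphismProperty.of_isPullback h.flip this

variable [IsArtAlg k A] [IsArtAlg k B]

theorem isPullback_closedPt :
    IsPullback (closedPt s A) s (pullback.snd _ _)
      (Spec.map (CommRingCat.ofHom (aug k A).toRingHom)) := by
  refine (IsPullback.of_bot (v₁₁ := closedPt s A) (v₂₁ := pullback.fst _ _)
    (h₃₁ := s) (h₁₁ := s) (h₂₁ := pullback.snd _ _)
    (v₁₂ := Spec.map (CommRingCat.ofHom (aug k A).toRingHom))
    (v₂₂ := Spec.map (CommRingCat.ofHom (algebraMap k A))) ?_ ?_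
    (IsPullback.of_hasPullback _ _).flip).flip
  · rw [closedPt_fst, ← Spec.map_comp, ← CommRingCat.ofHom_comp]
    have : (aug k A).toRingHom.comp (algebraMap k A) = RingHom.id k := (aug k A).comp_algebraMap
    rw [this]
    have : Spec.map (CommRingCat.ofHom (RingHom.id k)) = 𝟙 (Spec (.of k)) := Spec.map_id _
    rw [this]
    exact IsPullback.of_vert_isIso ⟨by simp⟩
  · exact (pullback.lift_snd _ _ _).symm

instance : Flat s := by
  have : IsIntegral (Spec (.of k)) := inferInstance
  have : Subsingleton (Spec (.of k)) := inferInstanceAs (Subsingleton (PrimeSpectrum k))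
  infer_instance

theorem surjective_aug : Function.Surjective (aug k A).toRingHom := fun c ↦
  ⟨algebraMap k A c, (aug k A).commutes c⟩

namespace Deformation

/-- The structure morphism to `Spec A` of a deformation over `A`. -/
def specHom (D : Deformation s X A) : D.total ⟶ Spec (.of A) := D.hom ≫ pullback.snd _ _

instance (D : Deformation s X A) : Flat D.specHom := by
  have := D.isDeformation.flat
  rw [specHom]
  infer_instance

instance (D : Deformation s X A) : IsClosedImmersion D.incl := D.isDeformation.isClosedImmersion

/-- Projecting to the Artinian factor lets kernels on sections be computed from ideals of `A`. -/
theorem isPullback_specHom {D : Deformation s X A} {E : Deformation s X B} {φ : A →ₐ[k] B}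
    {f : E.total ⟶ D.total} (h : IsPullback f E.hom D.hom (prodSpecMap s φ)) :
    IsPullback f E.specHom D.specHom (Spec.map (CommRingCat.ofHom φ.toRingHom)) :=
  h.paste_vert (isPullback_prodSpecMap φ)

theorem isPullback_incl (D : Deformation s X A) :
    IsPullback D.incl (X.hom ≫ s) D.specHom (Spec.map (CommRingCat.ofHom (aug k A).toRingHom)) :=
  D.isDeformation.isPullback.paste_vert isPullback_closedPt

instance (D : Deformation s X A) : Surjective D.incl := surjective_of_isPullback D.isPullback_incl

theorem appLE_surjective (D : Deformation s X A) {W : D.total.Opens} (hW : IsAffineOpen W)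
    {Q : X.left.Opens} (h : Q = D.incl ⁻¹ᵁ W) : Function.Surjective (D.incl.appLE W Q h.le) := by
  subst h
  rw [D.incl.appLE_eq_app]
  exact D.incl.app_surjective W hW

end Deformation

end Squares

/-! ### Deformations over trivial square zero extensions. -/

section SquareZero

open TrivSqZeroExt

variable {k : Type u} [Field k] {S : Scheme.{u}} {s : S ⟶ Spec (.of k)} {X : Over S}
  {V W : Type u} [AddCommGroup V] [Module k V] [Module kᵐᵒᵖ V] [IsCentralScalar k V]
  [AddCommGroup W] [Module k W] [Module kᵐᵒᵖ W] [IsCentralScalar k W]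

theorem baseHom_basis_prod {ι ι' : Type*} (b : Module.Basis ι k V) (c : Module.Basis ι' k W) {Z : Scheme.{u}}
    (σ : Z ⟶ Spec (.of (TrivSqZeroExt k (V × W)))) (O : Z.Opens) :
    Sum.elim (fun i ↦ baseHom σ O (inr (b i, 0))) (fun j ↦ baseHom σ O (inr (0, c j))) =
      fun x ↦ baseHom σ O (inr ((b.prod c) x)) := by
  ext x
  cases x <;> simp [Module.Basis.prod_apply]

variable {ι ι' : Type*} [Fintype ι] [Fintype ι']

theorem baseHom_inr_mul_baseHom_inr {Z : Scheme.{u}} (σ : Z ⟶ Spec (.of (TrivSqZeroExt k V)))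
    (O : Z.Opens) (v v' : V) : baseHom σ O (inr v) * baseHom σ O (inr v') = 0 := by
  rw [← map_mul, inr_mul_inr, map_zero]

theorem surjective_map_fst : Function.Surjective (TrivSqZeroExt.map (LinearMap.fst k V W)) :=
  fun x ↦ ⟨inl x.fst + inr (x.snd, 0), by ext <;> simp⟩

theorem surjective_map_snd : Function.Surjective (TrivSqZeroExt.map (LinearMap.snd k V W)) :=
  fun x ↦ ⟨inl x.fst + inr (0, x.snd), by ext <;> simp⟩

theorem ker_map_fst_eq_span (c : Module.Basis ι' k W) :
    RingHom.ker (TrivSqZeroExt.map (LinearMap.fst k V W)).toRingHom =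
      Ideal.span (Set.range fun j ↦ (inr (0, c j) : TrivSqZeroExt k (V × W))) := by
  refine ker_map_eq_span (g := LinearMap.fst k V W) (v := fun j ↦ (0, c j)) ?_
  rw [LinearMap.ker_fst, ← Submodule.map_top, ← c.span_eq, Submodule.map_span, ← Set.range_comp]
  rfl

theorem ker_map_snd_eq_span (b : Module.Basis ι k V) :
    RingHom.ker (TrivSqZeroExt.map (LinearMap.snd k V W)).toRingHom =
      Ideal.span (Set.range fun i ↦ (inr (b i, 0) : TrivSqZeroExt k (V × W))) := by
  refine ker_map_eq_span (g := LinearMap.snd k V W) (v := fun i ↦ (b i, 0)) ?_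
  rw [LinearMap.ker_snd, ← Submodule.map_top, ← b.span_eq, Submodule.map_span, ← Set.range_comp]
  rfl

variable [Module.Finite k V] [Module.Finite k W]

theorem ker_aug_eq_span (b : Module.Basis ι k V) :
    RingHom.ker (aug k (TrivSqZeroExt k V)).toRingHom =
      Ideal.span (Set.range fun i ↦ (inr (b i) : TrivSqZeroExt k V)) := by
  rw [← ker_fst_eq_span b.span_eq, ← algHom_eq_aug (fstHom k k V)]
  rfl

theorem ker_appLE_eq_span (b : Module.Basis ι k V) {Z E : Scheme.{u}}
    {σ : Z ⟶ Spec (.of (TrivSqZeroExt k V))} {f : E ⟶ Z} {g : E ⟶ Spec (.of k)}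
    (hf : IsPullback f g σ (Spec.map (CommRingCat.ofHom (aug k (TrivSqZeroExt k V)).toRingHom)))
    {O : Z.Opens} (hO : IsAffineOpen O) {Q : E.Opens} (h : Q = f ⁻¹ᵁ O) :
    RingHom.ker (f.appLE O Q h.le).hom =
      Ideal.span (Set.range fun i ↦ baseHom σ O (inr (b i))) := by
  subst h
  rw [f.appLE_eq_app, ker_app_of_isPullback hf surjective_aug hO, ker_aug_eq_span b, Ideal.map_span,
    ← Set.range_comp]
  rfl

theorem Deformation.appLE_eq_zero_of_sum_eq_zero (b : Module.Basis ι k V)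
    (D : Deformation s X (TrivSqZeroExt k V)) {O : D.total.Opens} (hO : IsAffineOpen O)
    {Q : X.left.Opens} (h : Q = D.incl ⁻¹ᵁ O) (r : ι → Γ(D.total, O))
    (hr : ∑ i, baseHom D.specHom O (inr (b i)) * r i = 0) (i : ι) :
    D.incl.appLE O Q h.le (r i) = 0 := by
  change r i ∈ RingHom.ker (D.incl.appLE O Q h.le).hom
  rw [ker_appLE_eq_span b D.isPullback_incl hO h]
  exact mem_span_of_flat_of_sum_eq_zero b (baseHom_flat D.specHom hO) hr i

/-- The two restriction maps have kernels generated by the basis vectors of `W` and of `V`. Flatness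
over `k[V × W]` allows no relations between these beyond the trivial ones, so the kernels meet in
zero. -/
theorem isMilnorOn_of_isPullback {Z : Deformation s X (TrivSqZeroExt k (V × W))}
    {D₁ : Deformation s X (TrivSqZeroExt k V)} {D₂ : Deformation s X (TrivSqZeroExt k W)}
    {i₁ : D₁.total ⟶ Z.total} {i₂ : D₂.total ⟶ Z.total}
    (h₁ : IsPullback i₁ D₁.hom Z.hom (prodSpecMap s (TrivSqZeroExt.map (LinearMap.fst k V W))))
    (h₂ : IsPullback i₂ D₂.hom Z.hom (prodSpecMap s (TrivSqZeroExt.map (LinearMap.snd k V W))))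
    (w₁ : D₁.incl ≫ i₁ = Z.incl) (w₂ : D₂.incl ≫ i₂ = Z.incl) {O : Z.total.Opens}
    (hO : IsAffineOpen O) : IsMilnorOn D₁.incl D₂.incl i₁ i₂ O := by
  let b := Module.finBasis k V
  let c := Module.finBasis k W
  let Q := D₁.incl ⁻¹ᵁ i₁ ⁻¹ᵁ O
  have hQ₂ : Q = D₂.incl ⁻¹ᵁ i₂ ⁻¹ᵁ O := preimage_preimage_eq (w₁.trans w₂.symm) O
  have hQ : Q = Z.incl ⁻¹ᵁ O := by rw [← w₁]; rfl
  have g₁ := Deformation.isPullback_specHom h₁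
  have g₂ := Deformation.isPullback_specHom h₂
  have := isClosedImmersion_of_isPullback g₁ surjective_map_fst
  have := isClosedImmersion_of_isPullback g₂ surjective_map_snd
  let p₁ := (i₁.app O).hom
  let p₂ := (i₂.app O).hom
  let q₁ := (D₁.incl.appLE (i₁ ⁻¹ᵁ O) Q le_rfl).hom
  let q₂ := (D₂.incl.appLE (i₂ ⁻¹ᵁ O) Q hQ₂.le).hom
  let t₁ := fun i ↦ baseHom Z.specHom O (inr (b i, 0))
  let t₂ := fun j ↦ baseHom Z.specHom O (inr (0, c j))
  have hq₁ : q₁.comp p₁ = (Z.incl.appLE O Q hQ.le).hom :=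
    hom_comp_app w₁ _ _
  have hq₂ : q₂.comp p₂ = (Z.incl.appLE O Q hQ.le).hom :=
    hom_comp_app w₂ _ _
  have hw := hq₁.trans hq₂.symm
  have hk₁ : RingHom.ker p₁ = Ideal.span (Set.range t₂) := by
    rw [ker_app_of_isPullback g₁ surjective_map_fst hO, ker_map_fst_eq_span c, Ideal.map_span,
      ← Set.range_comp]
    rfl
  have hk₂ : RingHom.ker p₂ = Ideal.span (Set.range t₁) := by
    rw [ker_app_of_isPullback g₂ surjective_map_snd hO, ker_map_snd_eq_span b, Ideal.map_span,
      ← Set.range_comp]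
    rfl
  have ht₁ : ∀ i, p₂ (t₁ i) = 0 := fun i ↦ by
    rw [← RingHom.mem_ker, hk₂]; exact Ideal.subset_span ⟨i, rfl⟩
  have ht₂ : ∀ j, p₁ (t₂ j) = 0 := fun j ↦ by
    rw [← RingHom.mem_ker, hk₁]; exact Ideal.subset_span ⟨j, rfl⟩
  have ht := baseHom_basis_prod b c Z.specHom O
  have hk : RingHom.ker (q₁.comp p₁) ≤ Ideal.span (Set.range (Sum.elim t₁ t₂)) := by
    rw [hq₁, ker_appLE_eq_span (b.prod c) Z.isPullback_incl hO hQ, ht]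
  refine ⟨fun a ha₁ ha₂ ↦ ?_, fun a₁ a₂ ha ↦ ?_⟩
  · refine eq_zero_of_relation (t₁ := t₁) (t₂ := t₂) (p₁ := p₁) (p₂ := p₂) (p₀ := q₁.comp p₁)
      (fun i j ↦ ?_) hk₁.le hk₂.le hk (fun r hr i ↦ ?_) ha₁ ha₂
    · rw [ht]
      exact baseHom_inr_mul_baseHom_inr _ _ _ _
    · rw [hq₁]
      rw [ht] at hr
      exact Z.appLE_eq_zero_of_sum_eq_zero (b.prod c) hO hQ r hr i
  · exact exists_of_ker_le (t₁ := t₁) (t₂ := t₂) hw (i₁.app_surjective O hO)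
      (i₂.app_surjective O hO) ht₁ ht₂ hk a₁ a₂ (ha Q _ _)

end SquareZero

end

/-! ### Pushouts of deformations are deformations, and conversely. -/

section

theorem isHomeomorph_of_isClosedImmersion {X Y : Scheme.{u}} (f : X ⟶ Y) [IsClosedImmersion f]
    [Surjective f] : IsHomeomorph f :=
  isHomeomorph_iff_isEmbedding_surjective.mpr ⟨f.isClosedEmbedding.isEmbedding, f.surjective⟩

theorem isClosedImmersion_of_forall_exists {X Y : Scheme.{u}} (f : X ⟶ Y)
    (h : ∀ y : Y, ∃ W : Y.Opens, y ∈ W ∧ IsAffineOpen W ∧ IsAffineOpen (f ⁻¹ᵁ W) ∧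
      Function.Surjective (f.app W)) : IsClosedImmersion f := by
  choose W hy hW hW' hs using h
  refine IsZariskiLocalAtTarget.of_iSup_eq_top W
    (top_unique fun y _ ↦ Opens.mem_iSup.mpr ⟨y, hy y⟩) fun y ↦ ?_
  have : IsAffine (W y) := hW y
  have : IsAffine (f ⁻¹ᵁ W y) := hW' y
  refine IsClosedImmersion.of_surjective_of_isAffine _ ?_
  rw [morphismRestrict_appTop]
  have e' : Function.Surjective (f.app ((W y).ι ''ᵁ ⊤)) := by
    have e : (W y).ι ''ᵁ ⊤ = W y := (W y).ι_image_top
    rw [e]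
    exact hs y
  exact (ConcreteCategory.bijective_of_isIso
    (X.presheaf.map (eqToHom (image_morphismRestrict_preimage f (W y) ⊤)).op)).2.comp e'

instance isAffineHom_prodSpec_fst {k : Type u} [Field k] {S : Scheme.{u}} (s : S ⟶ Spec (.of k))
    (A : Type u) [CommRing A] [Algebra k A] :
    IsAffineHom (pullback.fst s (Spec.map (CommRingCat.ofHom (algebraMap k A)))) := by
  have h : IsAffineHom (Spec.map (CommRingCat.ofHom (algebraMap k A))) := inferInstance
  exact MorphismProperty.of_isPullback
    (IsPullback.of_hasPullback s (Spec.map (CommRingCat.ofHom (algebraMap k A)))).flip h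

open TrivSqZeroExt

variable {k : Type u} [Field k] {S : Scheme.{u}} {s : S ⟶ Spec (.of k)} {X : Over S}
  {V W : Type u} [AddCommGroup V] [Module k V] [Module kᵐᵒᵖ V] [IsCentralScalar k V]
  [AddCommGroup W] [Module k W] [Module kᵐᵒᵖ W] [IsCentralScalar k W]
  [Module.Finite k V] [Module.Finite k W]

theorem isPushout_of_isPullback {Z : Deformation s X (TrivSqZeroExt k (V × W))}
    {D₁ : Deformation s X (TrivSqZeroExt k V)} {D₂ : Deformation s X (TrivSqZeroExt k W)}
    {i₁ : D₁.total ⟶ Z.total} {i₂ : D₂.total ⟶ Z.total}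
    (h₁ : IsPullback i₁ D₁.hom Z.hom (prodSpecMap s (TrivSqZeroExt.map (LinearMap.fst k V W))))
    (h₂ : IsPullback i₂ D₂.hom Z.hom (prodSpecMap s (TrivSqZeroExt.map (LinearMap.snd k V W))))
    (w₁ : D₁.incl ≫ i₁ = Z.incl) (w₂ : D₂.incl ≫ i₂ = Z.incl) :
    IsPushout D₁.incl D₂.incl i₁ i₂ := by
  have g₁ := Deformation.isPullback_specHom h₁
  have := isClosedImmersion_of_isPullback g₁ surjective_map_fst
  have : Nontrivial (TrivSqZeroExt k V) :=
    (IsArtAlg.toIsLocalRing (k := k) (A := TrivSqZeroExt k V)).toNontrivial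
  have := surjective_of_isPullback g₁
  refine isPushout_of_isMilnorOn (w₁.trans w₂.symm) (isHomeomorph_of_isClosedImmersion i₁)
    D₂.incl.surjective (IsMilnorOn.of_basis fun O z hz ↦ ?_)
  obtain ⟨O', haff, hz', hle⟩ := exists_isAffineOpen_mem_and_subset hz
  exact ⟨O', hle, hz', isMilnorOn_of_isPullback h₁ h₂ w₁ w₂ haff⟩

/-- Flatness of the family over `S ×ₖ Spec A` on a chart. -/
theorem appLE_flat {ι : Type*} [Fintype ι] (b : Module.Basis ι k V) {Z : Scheme.{u}}
    {σ : Z ⟶ prodSpec s (TrivSqZeroExt k V)} {incl : X.left ⟶ Z} [Flat X.hom]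
    (w : incl ≫ σ = X.hom ≫ closedPt s (TrivSqZeroExt k V)) {N : S.Opens} (hN : IsAffineOpen N)
    {O : Z.Opens} {Q : X.left.Opens} (hQ : IsAffineOpen Q) (hQO : Q = incl ⁻¹ᵁ O)
    (hON : O ≤ σ ⁻¹ᵁ (pullback.fst s (Spec.map (CommRingCat.ofHom (algebraMap k _)))) ⁻¹ᵁ N)
    (hs : Function.Surjective (incl.appLE O Q hQO.le))
    (hk : RingHom.ker (incl.appLE O Q hQO.le).hom ≤ Ideal.span (Set.range fun i ↦
      baseHom (σ ≫ pullback.snd _ _) O (inr (b i))))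
    (hrel : ∀ r : ι → Γ(Z, O), ∑ i, baseHom (σ ≫ pullback.snd _ _) O (inr (b i)) * r i = 0 →
      ∀ i, incl.appLE O Q hQO.le (r i) = 0) :
    (σ.appLE _ O hON).hom.Flat := by
  let π := pullback.fst s (Spec.map (CommRingCat.ofHom (algebraMap k (TrivSqZeroExt k V))))
  have hπ : N = closedPt s (TrivSqZeroExt k V) ⁻¹ᵁ π ⁻¹ᵁ N := by
    rw [← Scheme.Hom.comp_preimage, closedPt_fst, Scheme.Hom.id_preimage]
  have hNQ : Q ≤ X.hom ⁻¹ᵁ N := by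
    rw [hπ, ← Scheme.Hom.comp_preimage, ← w, hQO]
    exact incl.preimage_mono hON
  have hπN : IsAffineOpen (π ⁻¹ᵁ N) := hN.preimage (pullback.fst s (Spec.map (CommRingCat.ofHom (algebraMap k _))))
  have hε : ∀ i, σ.appLE (π ⁻¹ᵁ N) O hON (baseHom (pullback.snd _ _) (π ⁻¹ᵁ N) (inr (b i))) =
      baseHom (σ ≫ pullback.snd _ _) O (inr (b i)) := fun i ↦
    appLE_baseHom_of_comp_eq rfl hON _
  -- Modulo the elements of `V` the family reduces to `X ⟶ S`, which is flat.
  refine flat_of_forall_relation (q := ((closedPt s (TrivSqZeroExt k V)).appLE (π ⁻¹ᵁ N) N hπ.le).hom)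
    (p := (incl.appLE O Q hQO.le).hom) (φ₀ := (X.hom.appLE N Q hNQ).hom)
    (ε := fun i ↦ baseHom (pullback.snd _ _) (π ⁻¹ᵁ N) (inr (b i))) ?_ ?_ ?_ hs ?_ ?_ ?_ ?_
  · rw [← CommRingCat.hom_comp, ← CommRingCat.hom_comp, Scheme.Hom.appLE_comp_appLE,
      Scheme.Hom.appLE_comp_appLE, appLE_congr_hom w]
  · exact HasRingHomProperty.appLE @Flat X.hom inferInstance ⟨N, hN⟩ ⟨Q, hQ⟩ hNQ
  · have := (closedPt s (TrivSqZeroExt k V)).app_surjective (π ⁻¹ᵁ N) hπN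
    rw [Scheme.Hom.appLE, CommRingCat.hom_comp, RingHom.coe_comp]
    exact (ConcreteCategory.bijective_of_isIso
      (S.presheaf.map (eqToHom hπ).op)).2.comp this
  · intro i j
    exact baseHom_inr_mul_baseHom_inr _ _ _ _
  · exact ker_appLE_eq_span b isPullback_closedPt hπN hπ
  · refine hk.trans (le_of_eq ?_)
    congr 2
    ext i
    exact (hε i).symm
  · intro r hr
    refine hrel r (Eq.trans ?_ hr)
    exact Finset.sum_congr rfl fun i _ ↦ congrArg (· * _) (hε i).symm

end

section

open TrivSqZeroExt

variable {k : Type u} [Field k] {S : Scheme.{u}} {s : S ⟶ Spec (.of k)} {X : Over S}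
  {V W : Type u} [AddCommGroup V] [Module k V] [Module kᵐᵒᵖ V] [IsCentralScalar k V]
  [AddCommGroup W] [Module k W] [Module kᵐᵒᵖ W] [IsCentralScalar k W]
  [Module.Finite k V] [Module.Finite k W]

/-- The pushout of schemes carries a morphism to `S ×ₖ Spec k[V × W]` by its universal property.
Flatness and the cartesian squares are local and reduce to ring computations on the charts. -/
theorem Deformation.exists_isPushout (D₁ : Deformation s X (TrivSqZeroExt k V))
    (D₂ : Deformation s X (TrivSqZeroExt k W)) :
    ∃ (Z : Deformation s X (TrivSqZeroExt k (V × W))) (i₁ : D₁.total ⟶ Z.total)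
      (i₂ : D₂.total ⟶ Z.total),
      IsPushout D₁.incl D₂.incl i₁ i₂ ∧ D₁.incl ≫ i₁ = Z.incl ∧
      IsPullback i₁ D₁.hom Z.hom (prodSpecMap s (TrivSqZeroExt.map (LinearMap.fst k V W))) ∧
      IsPullback i₂ D₂.hom Z.hom (prodSpecMap s (TrivSqZeroExt.map (LinearMap.snd k V W))) := by
  obtain ⟨Z, i₁, i₂, w, hh₁, hh₂, hb⟩ := exists_milnorSquare D₁.incl D₂.incl
  have hpo : IsPushout D₁.incl D₂.incl i₁ i₂ :=
    isPushout_of_isMilnorOn w hh₁ D₂.incl.surjective (IsMilnorOn.of_basis fun O z hz ↦ by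
      obtain ⟨O', h⟩ := hb O z hz
      exact ⟨O', h.1, h.2.1, h.2.2.2.2.2⟩)
  have hflat : Flat X.hom := flat_of_deformation D₁
  let φ₁ := TrivSqZeroExt.map (LinearMap.fst k V W)
  let φ₂ := TrivSqZeroExt.map (LinearMap.snd k V W)
  have hc₁ : D₁.incl ≫ D₁.hom ≫ prodSpecMap s φ₁ = X.hom ≫ closedPt s _ := by
    rw [← Category.assoc, D₁.isDeformation.isPullback.w, Category.assoc, closedPt_map]
  have hc₂ : D₂.incl ≫ D₂.hom ≫ prodSpecMap s φ₂ = X.hom ≫ closedPt s _ := by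
    rw [← Category.assoc, D₂.isDeformation.isPullback.w, Category.assoc, closedPt_map]
  let σ : Z ⟶ prodSpec s (TrivSqZeroExt k (V × W)) := hpo.desc _ _ (hc₁.trans hc₂.symm)
  have hσ₁ : i₁ ≫ σ = D₁.hom ≫ prodSpecMap s φ₁ := hpo.inl_desc _ _ _
  have hσ₂ : i₂ ≫ σ = D₂.hom ≫ prodSpecMap s φ₂ := hpo.inr_desc _ _ _
  let τ := σ ≫ pullback.snd s (Spec.map (CommRingCat.ofHom (algebraMap k _)))
  have hτ₁ : i₁ ≫ τ = D₁.specHom ≫ Spec.map (CommRingCat.ofHom φ₁.toRingHom) := by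
    rw [← Category.assoc, hσ₁, Category.assoc, (isPullback_prodSpecMap φ₁).w, Deformation.specHom,
      Category.assoc]
  have hτ₂ : i₂ ≫ τ = D₂.specHom ≫ Spec.map (CommRingCat.ofHom φ₂.toRingHom) := by
    rw [← Category.assoc, hσ₂, Category.assoc, (isPullback_prodSpecMap φ₂).w, Deformation.specHom,
      Category.assoc]
  let incl := D₁.incl ≫ i₁
  have hincl : incl ≫ σ = X.hom ≫ closedPt s _ := by rw [Category.assoc, hσ₁, hc₁]
  let b := Module.finBasis k V
  let c := Module.finBasis k W
  -- All the commutative algebra on a chart: surjectivity and kernels of the restrictions to `D₁`,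
  -- `D₂` and `X`, and the relation condition of the flatness criterion, inherited from `D₁` and
  -- `D₂`.
  have chart : ∀ O : Z.Opens, IsAffineOpen (i₁ ⁻¹ᵁ O) → IsAffineOpen (i₂ ⁻¹ᵁ O) →
      IsMilnorOn D₁.incl D₂.incl i₁ i₂ O → Function.Surjective (i₁.app O) ∧
      Function.Surjective (i₂.app O) ∧
      RingHom.ker (i₁.app O).hom ≤ Ideal.span (Set.range fun j ↦ baseHom τ O (inr (0, c j))) ∧
      RingHom.ker (i₂.app O).hom ≤ Ideal.span (Set.range fun i ↦ baseHom τ O (inr (b i, 0))) ∧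
      Function.Surjective (incl.appLE O (incl ⁻¹ᵁ O) le_rfl) ∧
      RingHom.ker (incl.appLE O (incl ⁻¹ᵁ O) le_rfl).hom ≤
        Ideal.span (Set.range fun x ↦ baseHom τ O (inr (b.prod c x))) ∧
      ∀ r : _ → Γ(Z, O), ∑ x, baseHom τ O (inr (b.prod c x)) * r x = 0 →
        ∀ x, incl.appLE O (incl ⁻¹ᵁ O) le_rfl (r x) = 0 := by
    intro O hO₁ hO₂ hM
    let Q := D₁.incl ⁻¹ᵁ i₁ ⁻¹ᵁ O
    have hQ₂ : Q = D₂.incl ⁻¹ᵁ i₂ ⁻¹ᵁ O := preimage_preimage_eq w O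
    let p₁ := (i₁.app O).hom
    let p₂ := (i₂.app O).hom
    let q₁ := (D₁.incl.appLE (i₁ ⁻¹ᵁ O) Q le_rfl).hom
    let q₂ := (D₂.incl.appLE (i₂ ⁻¹ᵁ O) Q hQ₂.le).hom
    let t₁ := fun i ↦ baseHom τ O (inr (b i, 0))
    let t₂ := fun j ↦ baseHom τ O (inr (0, c j))
    have hq₁ : q₁.comp p₁ = (incl.appLE O (incl ⁻¹ᵁ O) le_rfl).hom := hom_comp_app rfl _ _
    have hq₂ : q₂.comp p₂ = (incl.appLE O (incl ⁻¹ᵁ O) le_rfl).hom := hom_comp_app w.symm _ _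
    have hw := hq₁.trans hq₂.symm
    have hs₁ : Function.Surjective q₁ := D₁.appLE_surjective hO₁ rfl
    have hs₂ : Function.Surjective q₂ := D₂.appLE_surjective hO₂ hQ₂
    have hpb := hM.isPullback w
    have hex : ∀ a₁ a₂, q₁ a₁ = q₂ a₂ → ∃ a, p₁ a = a₁ ∧ p₂ a = a₂ := fun a₁ a₂ h ↦
      exists_of_isPullback_commRingCat hpb h
    have e₁₁ : ∀ i, p₁ (t₁ i) = baseHom D₁.specHom (i₁ ⁻¹ᵁ O) (inr (b i)) := fun i ↦
      (app_baseHom hτ₁ O _).trans (congrArg _ (map_inr _ _))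
    have e₁₂ : ∀ j, p₁ (t₂ j) = 0 := fun j ↦
      (app_baseHom hτ₁ O _).trans ((congrArg _ ((map_inr _ _).trans (inr_zero _))).trans
        (map_zero _))
    have e₂₁ : ∀ i, p₂ (t₁ i) = 0 := fun j ↦
      (app_baseHom hτ₂ O _).trans ((congrArg _ ((map_inr _ _).trans (inr_zero _))).trans
        (map_zero _))
    have e₂₂ : ∀ j, p₂ (t₂ j) = baseHom D₂.specHom (i₂ ⁻¹ᵁ O) (inr (c j)) := fun j ↦
      (app_baseHom hτ₂ O _).trans (congrArg _ (map_inr _ _))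
    have hk₁ : RingHom.ker q₁ ≤ Ideal.span (Set.range fun i ↦ p₁ (t₁ i)) := by
      simp_rw [e₁₁]
      exact (ker_appLE_eq_span b D₁.isPullback_incl hO₁ rfl).le
    have hk₂ : RingHom.ker q₂ ≤ Ideal.span (Set.range fun j ↦ p₂ (t₂ j)) := by
      simp_rw [e₂₂]
      exact (ker_appLE_eq_span c D₂.isPullback_incl hO₂ hQ₂).le
    have hp₁ : Function.Surjective p₁ := surjective_fst_of_fibreProduct hex hs₂
    have hp₂ : Function.Surjective p₂ := surjective_fst_of_fibreProduct
      (fun a₂ a₁ h ↦ (hex a₁ a₂ h.symm).imp fun _ h ↦ h.symm) hs₁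
    have K₁ : RingHom.ker p₁ ≤ Ideal.span (Set.range t₂) :=
      ker_fst_le_of_fibreProduct hw hM.eq_zero hp₂ e₁₂ hk₂
    have K₂ : RingHom.ker p₂ ≤ Ideal.span (Set.range t₁) :=
      ker_fst_le_of_fibreProduct hw.symm (fun a h₂ h₁ ↦ hM.eq_zero a h₁ h₂) hp₁ e₂₁ hk₁
    have K := ker_comp_le_of_fibreProduct hk₁ hp₁ K₁
    have ht : Sum.elim t₁ t₂ = fun x ↦ baseHom τ O (inr (b.prod c x)) := baseHom_basis_prod b c τ O
    refine ⟨hp₁, hp₂, K₁, K₂, ?_, ?_, fun r hr x ↦ ?_⟩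
    · have := hs₁.comp hp₁
      rw [← RingHom.coe_comp, hq₁] at this
      exact this
    · rwa [hq₁, ht] at K
    · have := relation_of_fibreProduct (t₁ := t₁) (t₂ := t₂) hw e₂₁ e₁₂ (fun r hr i ↦ ?_)
        (fun r hr i ↦ ?_) r (by rw [ht]; exact hr) x
      · rw [hq₁] at this
        exact this
      · simp_rw [e₁₁] at hr
        exact D₁.appLE_eq_zero_of_sum_eq_zero b hO₁ rfl r hr i
      · simp_rw [e₂₂] at hr
        exact D₂.appLE_eq_zero_of_sum_eq_zero c hO₂ hQ₂ r hr i
  have : IsClosedImmersion i₁ := isClosedImmersion_of_forall_exists i₁ fun z ↦ by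
    obtain ⟨O, -, hz, hO, hO₁, hO₂, hM⟩ := hb ⊤ z (Opens.mem_top z)
    exact ⟨O, hz, hO, hO₁, (chart O hO₁ hO₂ hM).1⟩
  have : IsClosedImmersion i₂ := isClosedImmersion_of_forall_exists i₂ fun z ↦ by
    obtain ⟨O, -, hz, hO, hO₁, hO₂, hM⟩ := hb ⊤ z (Opens.mem_top z)
    exact ⟨O, hz, hO, hO₂, (chart O hO₁ hO₂ hM).2.1⟩
  have P₁ : IsPullback i₁ D₁.hom σ (prodSpecMap s φ₁) := by
    -- The square over `S ×ₖ Spec` is cartesian once the one over `Spec` is, where the ideal can be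
    -- compared chart by chart.
    refine IsPullback.of_bot ?_ hσ₁ (isPullback_prodSpecMap φ₁)
    refine isPullback_of_ker_app_le hτ₁ surjective_map_fst fun z ↦ ?_
    obtain ⟨O, -, hz, hO, hO₁, hO₂, hM⟩ := hb ⊤ z (Opens.mem_top z)
    refine ⟨O, hz, hO, (chart O hO₁ hO₂ hM).2.2.1.trans (le_of_eq ?_)⟩
    rw [ker_map_fst_eq_span c, Ideal.map_span, ← Set.range_comp]
    rfl
  have P₂ : IsPullback i₂ D₂.hom σ (prodSpecMap s φ₂) := by
    refine IsPullback.of_bot ?_ hσ₂ (isPullback_prodSpecMap φ₂)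
    refine isPullback_of_ker_app_le hτ₂ surjective_map_snd fun z ↦ ?_
    obtain ⟨O, -, hz, hO, hO₁, hO₂, hM⟩ := hb ⊤ z (Opens.mem_top z)
    refine ⟨O, hz, hO, (chart O hO₁ hO₂ hM).2.2.2.1.trans (le_of_eq ?_)⟩
    rw [ker_map_snd_eq_span b, Ideal.map_span, ← Set.range_comp]
    rfl
  have P₀ : IsPullback incl X.hom σ (closedPt s _) := by
    rw [← closedPt_map s φ₁]
    exact D₁.isDeformation.isPullback.paste_horiz P₁
  have F : Flat σ := by
    refine (HasRingHomProperty.iff_exists_appLE (P := @Flat)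
      (RingHom.Flat.stableUnderComposition.stableUnderCompositionWithLocalizationAway
        RingHom.Flat.holdsForLocalizationAway).left).mpr fun z ↦ ?_
    let π := pullback.fst s (Spec.map (CommRingCat.ofHom (algebraMap k (TrivSqZeroExt k (V × W)))))
    obtain ⟨N, hN, hzN, -⟩ := exists_isAffineOpen_mem_and_subset (U := ⊤) (x := π (σ z))
      (Opens.mem_top _)
    have : IsAffineHom π := isAffineHom_prodSpec_fst s _
    obtain ⟨O, hON, hz, hO, hO₁, hO₂, hM⟩ := hb (σ ⁻¹ᵁ π ⁻¹ᵁ N) z hzN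
    have ch := chart O hO₁ hO₂ hM
    exact ⟨⟨π ⁻¹ᵁ N, hN.preimage π⟩, ⟨O, hO⟩, hz, hON,
      appLE_flat (b.prod c) hincl hN (hO.preimage incl) rfl hON ch.2.2.2.2.1 ch.2.2.2.2.2.1
        ch.2.2.2.2.2.2⟩
  exact ⟨⟨Z, incl, σ, inferInstance, F, P₀⟩, i₁, i₂, hpo, rfl, P₁, P₂⟩

end

section

/-! ### Deformation classes over `k[V × W]` are pairs of classes. -/

section Pairs

variable {k : Type u} [Field k] {S : Scheme.{u}} {s : S ⟶ Spec (.of k)} {X : Over S}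
  {V W U : Type u} [AddCommGroup V] [Module k V] [Module kᵐᵒᵖ V] [IsCentralScalar k V]
  [AddCommGroup W] [Module k W] [Module kᵐᵒᵖ W] [IsCentralScalar k W]
  [AddCommGroup U] [Module k U] [Module kᵐᵒᵖ U] [IsCentralScalar k U]
  [Module.Finite k V] [Module.Finite k W] [Module.Finite k U]

/-- The map on classes of deformations over trivial square zero extensions induced by a linear
map. -/
def DefClass.lin (a : DefClass s X (TrivSqZeroExt k V)) (g : V →ₗ[k] W) :
    DefClass s X (TrivSqZeroExt k W) :=
  a.map (TrivSqZeroExt.map g)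

theorem DefClass.lin_id (a : DefClass s X (TrivSqZeroExt k V)) : a.lin LinearMap.id = a := by
  rw [lin, TrivSqZeroExt.map_id, map_id]

theorem DefClass.lin_lin (a : DefClass s X (TrivSqZeroExt k V)) (g : V →ₗ[k] W) (h : W →ₗ[k] U) :
    (a.lin g).lin h = a.lin (h ∘ₗ g) := by
  rw [lin, lin, lin, map_map, TrivSqZeroExt.map_comp_map]

theorem DefClass.lin_zero (hX : Flat X.hom) (a : DefClass s X (TrivSqZeroExt k V)) :
    a.lin (0 : V →ₗ[k] W) = (Deformation.trivial s X (TrivSqZeroExt k W) hX).cls := by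
  rw [← map_ofId_comp_aug hX a, lin]
  congr 1
  rw [← algHom_eq_aug (TrivSqZeroExt.fstHom k k V)]
  ext x <;> simp

theorem DefClass.exists_pair (a : DefClass s X (TrivSqZeroExt k V))
    (b : DefClass s X (TrivSqZeroExt k W)) : ∃ z : DefClass s X (TrivSqZeroExt k (V × W)),
      z.lin (LinearMap.fst k V W) = a ∧ z.lin (LinearMap.snd k V W) = b := by
  induction a using DefClass.ind with | _ D₁
  induction b using DefClass.ind with | _ D₂
  obtain ⟨Z, i₁, i₂, hp, w₁, h₁, h₂⟩ := D₁.exists_isPushout D₂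
  exact ⟨Z.cls, (Deformation.cls_eq_of_isPullback h₁ w₁).symm,
    (Deformation.cls_eq_of_isPullback h₂ (hp.w.symm.trans w₁)).symm⟩

theorem Deformation.cls_eq_of_isPushout {A : Type u} [CommRing A] [Algebra k A] [IsArtAlg k A]
    {Z Z' : Deformation s X A} {D₁ D₂ : Scheme.{u}} {j₁ : X.left ⟶ D₁} {j₂ : X.left ⟶ D₂}
    {i₁ : D₁ ⟶ Z.total} {i₂ : D₂ ⟶ Z.total} {i₁' : D₁ ⟶ Z'.total} {i₂' : D₂ ⟶ Z'.total}
    (h : IsPushout j₁ j₂ i₁ i₂) (h' : IsPushout j₁ j₂ i₁' i₂') (w : j₁ ≫ i₁ = Z.incl)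
    (w' : j₁ ≫ i₁' = Z'.incl) (e₁ : i₁ ≫ Z.hom = i₁' ≫ Z'.hom) (e₂ : i₂ ≫ Z.hom = i₂' ≫ Z'.hom) :
    Z.cls = Z'.cls := by
  refine Quotient.sound ⟨h.isoIsPushout _ _ h', ?_, ?_⟩
  · apply h.hom_ext
    · rw [IsPushout.inl_isoIsPushout_hom_assoc, e₁]
    · rw [IsPushout.inr_isoIsPushout_hom_assoc, e₂]
  · rw [← w, Category.assoc, IsPushout.inl_isoIsPushout_hom, w']

/-- Equal base changes present both deformations as pushouts of the same diagram under `X`. -/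
theorem DefClass.pair_ext {z z' : DefClass s X (TrivSqZeroExt k (V × W))}
    (h₁ : z.lin (LinearMap.fst k V W) = z'.lin (LinearMap.fst k V W))
    (h₂ : z.lin (LinearMap.snd k V W) = z'.lin (LinearMap.snd k V W)) : z = z' := by
  induction z using DefClass.ind with | _ Z
  induction z' using DefClass.ind with | _ Z'
  obtain ⟨i₁, hi₁, w₁⟩ :=
    Z.exists_isPullback_baseChange (TrivSqZeroExt.map (LinearMap.fst k V W))
  obtain ⟨i₂, hi₂, w₂⟩ :=
    Z.exists_isPullback_baseChange (TrivSqZeroExt.map (LinearMap.snd k V W))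
  obtain ⟨i₁', hi₁', w₁'⟩ := Deformation.exists_isPullback_of_cls_eq
    (E := Z.baseChange (TrivSqZeroExt.map (LinearMap.fst k V W))) h₁
  obtain ⟨i₂', hi₂', w₂'⟩ := Deformation.exists_isPullback_of_cls_eq
    (E := Z.baseChange (TrivSqZeroExt.map (LinearMap.snd k V W))) h₂
  exact Deformation.cls_eq_of_isPushout (isPushout_of_isPullback hi₁ hi₂ w₁ w₂)
    (isPushout_of_isPullback hi₁' hi₂' w₁' w₂') w₁ w₁' (hi₁.w.trans hi₁'.w.symm)
    (hi₂.w.trans hi₂'.w.symm)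

end Pairs

/-! ### The vector space structure. -/

section Tangent

open scoped DualNumber

variable {k : Type u} [Field k] {S : Scheme.{u}} {s : S ⟶ Spec (.of k)} {X : Over S}
  {V : Type u} [AddCommGroup V] [Module k V] [Module kᵐᵒᵖ V] [IsCentralScalar k V]
  [Module.Finite k V]

/-- `IsGluing` asks only for commutative squares; by uniqueness of pushouts `Z` is isomorphic to the
constructed gluing, whose squares are cartesian. -/
theorem IsGluing.lin_eq {D₁ D₂ : Deformation s X k[ε]} {Z : Deformation s X (DualSq k)}
    (h : IsGluing D₁ D₂ Z) : Z.cls.lin (LinearMap.fst k k k) = D₁.cls ∧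
      Z.cls.lin (LinearMap.snd k k k) = D₂.cls := by
  obtain ⟨i₁, i₂, hp, w, h₁, h₂⟩ := h
  obtain ⟨Z', i₁', i₂', hp', w', h₁', h₂'⟩ := D₁.exists_isPushout D₂
  have e : Z.cls = Z'.cls := Deformation.cls_eq_of_isPushout hp hp' w w' (h₁.trans h₁'.w.symm)
    (h₂.trans h₂'.w.symm)
  rw [e]
  exact ⟨(Deformation.cls_eq_of_isPullback h₁' w').symm,
    (Deformation.cls_eq_of_isPullback h₂' (hp'.w.symm.trans w')).symm⟩

theorem exists_isGluing (D₁ D₂ : Deformation s X k[ε]) : ∃ Z, IsGluing D₁ D₂ Z := by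
  obtain ⟨Z', i₁', i₂', hp', w', h₁', h₂'⟩ := D₁.exists_isPushout D₂
  exact ⟨Z', i₁', i₂', hp', w', h₁'.w, h₂'.w⟩

/-- The sum of two first order deformation classes. -/
def DefClass.add (a b : DefClass s X k[ε]) : DefClass s X k[ε] :=
  (exists_pair a b).choose.lin (LinearMap.fst k k k + LinearMap.snd k k k)

theorem DefClass.add_eq {a b : DefClass s X k[ε]} {z : DefClass s X (DualSq k)}
    (h₁ : z.lin (LinearMap.fst k k k) = a) (h₂ : z.lin (LinearMap.snd k k k) = b) :
    a.add b = z.lin (LinearMap.fst k k k + LinearMap.snd k k k) := by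
  have h := (exists_pair a b).choose_spec
  rw [add, pair_ext (h.1.trans h₁.symm) (h.2.trans h₂.symm)]

/-- The pair of classes comes from `z` via `g.prod h`. All vector space axioms below reduce to this
identity. -/
theorem DefClass.lin_add (z : DefClass s X (TrivSqZeroExt k V)) (g h : V →ₗ[k] k) :
    DefClass.add (z.lin g) (z.lin h) = z.lin (g + h) := by
  have h₁ : (z.lin (g.prod h)).lin (LinearMap.fst k k k) = z.lin g := by
    rw [lin_lin, LinearMap.fst_prod]
  have h₂ : (z.lin (g.prod h)).lin (LinearMap.snd k k k) = z.lin h := by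
    rw [lin_lin, LinearMap.snd_prod]
  rw [add_eq h₁ h₂, lin_lin, LinearMap.add_comp, LinearMap.fst_prod, LinearMap.snd_prod]

theorem DefClass.add_eq_iff_isSum (a b c : DefClass s X k[ε]) : a.add b = c ↔ IsSum a b c := by
  constructor
  · rintro rfl
    induction a using DefClass.ind with | _ D₁
    induction b using DefClass.ind with | _ D₂
    obtain ⟨Z, hZ⟩ := exists_isGluing D₁ D₂
    exact ⟨D₁, D₂, Z, rfl, rfl, hZ, (add_eq hZ.lin_eq.1 hZ.lin_eq.2).symm⟩
  · rintro ⟨D₁, D₂, Z, rfl, rfl, hZ, rfl⟩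
    exact add_eq hZ.lin_eq.1 hZ.lin_eq.2

variable (s X) in
/-- The group structure on first order deformation classes of a flat scheme. -/
abbrev tangentAddCommGroup (hX : Flat X.hom) : AddCommGroup (DefClass s X k[ε]) where
  add := DefClass.add
  zero := (Deformation.trivial s X k[ε] hX).cls
  neg a := a.lin (-LinearMap.id)
  nsmul :=
    letI : Zero (DefClass s X k[ε]) := ⟨(Deformation.trivial s X k[ε] hX).cls⟩
    letI : Add (DefClass s X k[ε]) := ⟨DefClass.add⟩
    nsmulRec
  zsmul :=
    letI : Zero (DefClass s X k[ε]) := ⟨(Deformation.trivial s X k[ε] hX).cls⟩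
    letI : Add (DefClass s X k[ε]) := ⟨DefClass.add⟩
    letI : Neg (DefClass s X k[ε]) := ⟨fun a ↦ a.lin (-LinearMap.id)⟩
    zsmulRec
  add_assoc a b c := by
    change (a.add b).add c = a.add (b.add c)
    -- Three classes come from one class over `k[(k × k) × k]`, where associativity is that of
    -- adding linear forms.
    obtain ⟨x, rfl, rfl⟩ := a.exists_pair b
    obtain ⟨z, rfl, rfl⟩ := x.exists_pair c
    simp only [DefClass.lin_lin, DefClass.lin_add, add_assoc]
  zero_add a := by
    change (Deformation.trivial s X k[ε] hX).cls.add a = a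
    -- Both summands are images of `a`, under the zero map and the identity.
    conv_lhs => rw [← DefClass.lin_zero hX a, ← a.lin_id]
    simp only [DefClass.lin_lin, DefClass.lin_add]
    simp [DefClass.lin_id]
  add_zero a := by
    change a.add (Deformation.trivial s X k[ε] hX).cls = a
    conv_lhs => rw [← DefClass.lin_zero hX a, ← a.lin_id]
    simp only [DefClass.lin_lin, DefClass.lin_add]
    simp [DefClass.lin_id]
  add_comm a b := by
    change a.add b = b.add a
    obtain ⟨x, rfl, rfl⟩ := a.exists_pair b
    simp only [DefClass.lin_add, add_comm]
  neg_add_cancel a := by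
    change (a.lin (-LinearMap.id)).add a = (Deformation.trivial s X k[ε] hX).cls
    rw [← DefClass.lin_zero hX a]
    conv_lhs => rw [← a.lin_id]
    simp only [DefClass.lin_lin, DefClass.lin_add]
    congr 1
    simp

variable (s X) in
/-- The vector space structure on first order deformation classes of a flat scheme. -/
abbrev tangentModule (hX : Flat X.hom) :
    letI := tangentAddCommGroup s X hX
    Module k (DefClass s X k[ε]) :=
  letI := tangentAddCommGroup s X hX
  { smul := fun c a ↦ a.lin (c • LinearMap.id)
    one_smul := fun a ↦ by
      change a.lin ((1 : k) • LinearMap.id) = a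
      rw [one_smul, DefClass.lin_id]
    mul_smul := fun c d a ↦ by
      change a.lin ((c * d) • LinearMap.id) = (a.lin (d • LinearMap.id)).lin (c • LinearMap.id)
      rw [DefClass.lin_lin]
      congr 1
      ext
      simp
    smul_zero := fun c ↦ by
      change ((Deformation.trivial s X k[ε] hX).cls).lin (c • LinearMap.id) =
        (Deformation.trivial s X k[ε] hX).cls
      conv_lhs => rw [← DefClass.lin_zero hX (Deformation.trivial s X k[ε] hX).cls]
      rw [DefClass.lin_lin, LinearMap.comp_zero, DefClass.lin_zero hX]
    smul_add := fun c a b ↦ by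
      change (a.add b).lin (c • LinearMap.id) =
        (a.lin (c • LinearMap.id)).add (b.lin (c • LinearMap.id))
      obtain ⟨x, rfl, rfl⟩ := a.exists_pair b
      simp only [DefClass.lin_lin, DefClass.lin_add, LinearMap.comp_add]
    add_smul := fun c d a ↦ by
      change a.lin ((c + d) • LinearMap.id) =
        (a.lin (c • LinearMap.id)).add (a.lin (d • LinearMap.id))
      rw [DefClass.lin_add, add_smul]
    zero_smul := fun a ↦ by
      change a.lin ((0 : k) • LinearMap.id) = (Deformation.trivial s X k[ε] hX).cls
      rw [zero_smul, DefClass.lin_zero hX] }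

theorem isTangentSpace (hX : Flat X.hom) :
    letI := tangentAddCommGroup s X hX
    letI := tangentModule s X hX
    IsTangentSpace s X :=
  letI := tangentAddCommGroup s X hX
  letI := tangentModule s X hX
  ⟨DefClass.add_eq_iff_isSum, fun _ _ ↦ rfl⟩

end Tangent

end

section

/-! ### Functors compatible with base change act linearly on tangent spaces. -/

section Image

open scoped DualNumber

variable {k : Type u} [Field k] {S T : Scheme.{u}} {s : S ⟶ Spec (.of k)} {t : T ⟶ Spec (.of k)}
  {F : Over S ⥤ Over T} {p : NatProj s t F}

/-- A morphism of deformations over a morphism of Artinian algebras, as a morphism of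
`S`-schemes. -/
def Deformation.overHom {X : Over S} {A B : Type u} [CommRing A] [Algebra k A] [IsArtAlg k A]
    [CommRing B] [Algebra k B] [IsArtAlg k B] {D : Deformation s X A} {E : Deformation s X B}
    {φ : A →ₐ[k] B} (f : E.total ⟶ D.total) (w : f ≫ D.hom = E.hom ≫ prodSpecMap s φ) :
    E.toOver ⟶ D.toOver :=
  Over.homMk f (by
    change f ≫ D.hom ≫ _ = E.hom ≫ _
    rw [reassoc_of% w, prodSpecMap_fst])

theorem map_inclOver_imageHom {X : Over S} {A : Type u} [CommRing A] [Algebra k A] [IsArtAlg k A]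
    (D : Deformation s X A) :
    (F.map D.inclOver).left ≫ imageHom p D = (F.obj X).hom ≫ closedPt t A := by
  apply pullback.hom_ext
  · rw [Category.assoc, Category.assoc, closedPt_fst, imageHom, pullback.lift_fst,
      Category.comp_id, Over.w]
  · have h : D.inclOver.left ≫ D.hom = X.hom ≫ closedPt s A := D.isDeformation.isPullback.w
    rw [Category.assoc, Category.assoc, imageHom, pullback.lift_snd, ← Category.assoc,
      p.naturality, Category.assoc, reassoc_of% h, closedPt, closedPt, pullback.lift_snd,
      pullback.lift_snd]
    simpa only [Category.assoc] using p.comm X =≫ _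

theorem map_overHom_imageHom {X : Over S} {A B : Type u} [CommRing A] [Algebra k A] [IsArtAlg k A]
    [CommRing B] [Algebra k B] [IsArtAlg k B] {D : Deformation s X A} {E : Deformation s X B}
    {φ : A →ₐ[k] B} (f : E.total ⟶ D.total) (w : f ≫ D.hom = E.hom ≫ prodSpecMap s φ) :
    (F.map (Deformation.overHom f w)).left ≫ imageHom p D = imageHom p E ≫ prodSpecMap t φ := by
  apply pullback.hom_ext
  · rw [Category.assoc, Category.assoc, prodSpecMap_fst, imageHom, imageHom, pullback.lift_fst,
      pullback.lift_fst, Over.w]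
  · have h : (Deformation.overHom f w).left ≫ D.hom = E.hom ≫ prodSpecMap s φ := w
    rw [Category.assoc, Category.assoc, imageHom, imageHom, pullback.lift_snd, ← Category.assoc,
      p.naturality, Category.assoc, reassoc_of% h, prodSpecMap, prodSpecMap, pullback.lift_snd,
      pullback.lift_snd, pullback.lift_snd_assoc, Category.assoc, Category.assoc]

/-- A functor between categories of relative schemes is compatible with base change of
deformations along morphisms of Artinian algebras. -/
def PreservesBaseChange (p : NatProj s t F) : Prop :=
  ∀ (X : Over S) (A B : Type u) [CommRing A] [Algebra k A] [IsArtAlg k A] [CommRing B]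
    [Algebra k B] [IsArtAlg k B] (D : Deformation s X A) (E : Deformation s X B) (φ : A →ₐ[k] B)
    (f : E.total ⟶ D.total) (hf : IsPullback f E.hom D.hom (prodSpecMap s φ)),
    IsPullback (F.map (Deformation.overHom f hf.w)).left (imageHom p E) (imageHom p D)
      (prodSpecMap t φ)

namespace PreservesDeformations

variable (h : PreservesDeformations p) {X : Over S}
  {A B : Type u} [CommRing A] [Algebra k A] [IsArtAlg k A] [CommRing B]
  [Algebra k B] [IsArtAlg k B]

theorem image_cls_eq (h' : PreservesBaseChange p) {D : Deformation s X A} {E : Deformation s X B} {φ : A →ₐ[k] B}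
    (e : E.cls = D.cls.map φ) : (h.image E).cls = (h.image D).cls.map φ := by
  obtain ⟨f, hf, w⟩ := Deformation.exists_isPullback_of_cls_eq e
  refine Deformation.cls_eq_of_isPullback (h' X A B D E φ f hf) ?_
  change (F.map E.inclOver).left ≫ (F.map _).left = (F.map D.inclOver).left
  rw [← Over.comp_left, ← F.map_comp]
  congr 2
  ext
  exact w

/-- The map on deformation classes induced by `F`. -/
def imageClass (h' : PreservesBaseChange p) (A : Type u) [CommRing A] [Algebra k A] [IsArtAlg k A] (a : DefClass s X A) :
    DefClass t (F.obj X) A :=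
  Quotient.lift (fun D ↦ (h.image D).cls) (fun D E e ↦ by
    have e' : D.cls = E.cls.map (AlgHom.id k A) := by
      rw [DefClass.map_id]
      exact Quotient.sound e
    have := h.image_cls_eq h' e'
    rwa [DefClass.map_id] at this) a

theorem imageClass_cls (h' : PreservesBaseChange p) (D : Deformation s X A) :
    h.imageClass h' A D.cls = (h.image D).cls := rfl

theorem imageClass_map (h' : PreservesBaseChange p) (φ : A →ₐ[k] B) (a : DefClass s X A) :
    h.imageClass h' B (a.map φ) = (h.imageClass h' A a).map φ := by
  induction a using DefClass.ind with | _ D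
  exact h.image_cls_eq h' rfl

/-- Both summands and their sum are base changes of one class over `k[ε] ×ₖ k[ε]`, so compatibility
with base change suffices; pushouts need not be preserved by `F`. -/
theorem imageClass_add (h' : PreservesBaseChange p) (a b : DefClass s X k[ε]) :
    h.imageClass h' k[ε] (a.add b) = (h.imageClass h' k[ε] a).add (h.imageClass h' k[ε] b) := by
  obtain ⟨z, rfl, rfl⟩ := a.exists_pair b
  rw [DefClass.lin_add, DefClass.lin, DefClass.lin, DefClass.lin, imageClass_map, imageClass_map,
    imageClass_map]
  exact (DefClass.lin_add (h.imageClass h' _ z) _ _).symm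

end PreservesDeformations

theorem IsSmoothFunctor.of_preservesBaseChange (h : PreservesDeformations p)
    (h' : PreservesBaseChange p) (hF : ∀ X : Over S, Flat X.hom → Flat (F.obj X).hom) :
    IsSmoothFunctor p := by
  refine ⟨h, fun X hX ↦ ⟨tangentAddCommGroup s X hX, tangentModule s X hX,
    tangentAddCommGroup t _ (hF X hX), tangentModule t _ (hF X hX), isTangentSpace hX,
    isTangentSpace (hF X hX), ?_⟩⟩
  let := tangentAddCommGroup s X hX
  let := tangentModule s X hX
  let := tangentAddCommGroup t _ (hF X hX)
  let := tangentModule t _ (hF X hX)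
  exact ⟨{ toFun := h.imageClass h' k[ε]
           map_add' := h.imageClass_add h'
           map_smul' := fun c a ↦ h.imageClass_map h' _ a }, h.imageClass_cls h'⟩

end Image

/-! ### The functor `X ↦ X ×_S Y`. -/

section FibreProduct

variable {k : Type u} [Field k] {S Y : Scheme.{u}} (s : S ⟶ Spec (.of k)) (g : Y ⟶ S)

/-- The morphism `g × Spec A : Y ×ₖ Spec A ⟶ S ×ₖ Spec A`. -/
def prodSpecBase (A : Type u) [CommRing A] [Algebra k A] : prodSpec (g ≫ s) A ⟶ prodSpec s A :=
  pullback.lift (pullback.fst _ _ ≫ g) (pullback.snd _ _) (by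
    rw [Category.assoc, pullback.condition])

section

variable (A : Type u) [CommRing A] [Algebra k A]

theorem prodSpecBase_fst :
    prodSpecBase s g A ≫ pullback.fst _ _ = pullback.fst _ _ ≫ g :=
  pullback.lift_fst _ _ _

theorem prodSpecBase_snd : prodSpecBase s g A ≫ pullback.snd _ _ = pullback.snd _ _ :=
  pullback.lift_snd _ _ _

theorem isPullback_prodSpecBase :
    IsPullback (prodSpecBase s g A) (pullback.fst _ _) (pullback.fst _ _) g := by
  refine (IsPullback.of_right (h₁₂ := pullback.snd s _) (h₂₂ := s) ?_
    (prodSpecBase_fst s g A) (IsPullback.of_hasPullback _ _).flip)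
  rw [prodSpecBase_snd]
  exact (IsPullback.of_hasPullback _ _).flip

theorem closedPt_prodSpecBase [IsArtAlg k A] :
    closedPt (g ≫ s) A ≫ prodSpecBase s g A = g ≫ closedPt s A := by
  apply pullback.hom_ext
  · rw [Category.assoc, Category.assoc, prodSpecBase_fst, closedPt_fst, ← Category.assoc,
      closedPt_fst, Category.id_comp, Category.comp_id]
  · rw [Category.assoc, Category.assoc, prodSpecBase_snd, closedPt, closedPt, pullback.lift_snd,
      pullback.lift_snd, Category.assoc]

variable {A} in
theorem prodSpecMap_prodSpecBase {B : Type u} [CommRing B] [Algebra k B] (φ : A →ₐ[k] B) :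
    prodSpecMap (g ≫ s) φ ≫ prodSpecBase s g A = prodSpecBase s g B ≫ prodSpecMap s φ := by
  apply pullback.hom_ext
  · rw [Category.assoc, Category.assoc, prodSpecBase_fst, prodSpecMap_fst, ← Category.assoc,
      prodSpecMap_fst, prodSpecBase_fst]
  · rw [Category.assoc, Category.assoc, prodSpecBase_snd, prodSpecMap, prodSpecMap,
      pullback.lift_snd, pullback.lift_snd, ← Category.assoc, prodSpecBase_snd]

theorem isPullback_closedPt_prodSpecBase [IsArtAlg k A] :
    IsPullback (closedPt (g ≫ s) A) g (prodSpecBase s g A) (closedPt s A) := by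
  refine IsPullback.of_right ?_ (closedPt_prodSpecBase s g A) (isPullback_prodSpecBase s g A).flip
  rw [closedPt_fst, closedPt_fst]
  exact IsPullback.of_horiz_isIso ⟨by simp⟩

variable {A} in
theorem isPullback_prodSpecMap_prodSpecBase {B : Type u} [CommRing B] [Algebra k B]
    (φ : A →ₐ[k] B) : IsPullback (prodSpecMap (g ≫ s) φ) (prodSpecBase s g B) (prodSpecBase s g A)
      (prodSpecMap s φ) := by
  refine IsPullback.of_right ?_ (prodSpecMap_prodSpecBase s g φ) (isPullback_prodSpecBase s g A).flip
  rw [prodSpecMap_fst, prodSpecMap_fst]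
  exact (isPullback_prodSpecBase s g B).flip

end

variable {s} {A B : Type u} [CommRing A] [Algebra k A] [IsArtAlg k A] [CommRing B] [Algebra k B]
  [IsArtAlg k B] {X : Over S}

theorem imageHom_fibreProduct_prodSpecBase (D : Deformation s X A) :
    imageHom (fibreProduct s g) D ≫ prodSpecBase s g A = pullback.fst _ _ ≫ D.hom := by
  apply pullback.hom_ext
  · rw [Category.assoc, Category.assoc, prodSpecBase_fst, imageHom, pullback.lift_fst_assoc]
    exact pullback.condition.symm
  · rw [Category.assoc, Category.assoc, prodSpecBase_snd, imageHom, pullback.lift_snd]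
    rfl

theorem imageHom_fibreProductOver (D : Deformation s X A) :
    imageHom (fibreProductOver s g) D = imageHom (fibreProduct s g) D ≫ prodSpecBase s g A := by
  rw [imageHom_fibreProduct_prodSpecBase]
  apply pullback.hom_ext
  · rw [imageHom, pullback.lift_fst, Category.assoc]
    exact pullback.condition.symm
  · rw [imageHom, pullback.lift_snd, Category.assoc]
    rfl

/-- The structure morphism of `𝒳 ×_S Y` is thus a base change of that of `𝒳`; flatness and all other
cartesian squares follow by pasting and cancelling. -/
theorem isPullback_imageHom_fibreProduct (D : Deformation s X A) :
    IsPullback (pullback.fst D.toOver.hom g) (imageHom (fibreProduct s g) D) D.hom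
      (prodSpecBase s g A) := by
  refine IsPullback.of_bot (v₂₁ := pullback.fst _ _) (v₂₂ := pullback.fst _ _) (h₃₁ := g) ?_
    (imageHom_fibreProduct_prodSpecBase g D).symm (isPullback_prodSpecBase s g A)
  rw [imageHom, pullback.lift_fst]
  exact IsPullback.of_hasPullback _ _

variable (s)

theorem preservesDeformations_fibreProduct : PreservesDeformations (fibreProduct s g) := by
  intro X A _ _ _ D
  have hD := D.isDeformation
  have hf := hD.flat
  have hi := isPullback_imageHom_fibreProduct g D
  have hp : IsPullback ((Over.pullback g).map D.inclOver).left ((Over.pullback g).obj X).hom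
      (imageHom (fibreProduct s g) D) (closedPt (g ≫ s) A) := by
    refine IsPullback.of_right (h₁₂ := (fibreProduct s g).app D.toOver) ?_ (map_inclOver_imageHom D) hi
    rw [closedPt_prodSpecBase, (fibreProduct s g).naturality D.inclOver]
    exact (IsPullback.of_hasPullback _ _).paste_horiz hD.isPullback
  exact ⟨MorphismProperty.of_isPullback hp.flip inferInstance,
    MorphismProperty.of_isPullback hi hf, hp⟩

/-- Flatness of `g` enters here: the structure morphism is the one over `Y ×ₖ Spec A` followed by a
base change of `g`. -/
theorem preservesDeformations_fibreProductOver (hg : Flat g) :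
    PreservesDeformations (fibreProductOver s g) := by
  intro X A _ _ _ D
  obtain ⟨hc, hf, hp⟩ := preservesDeformations_fibreProduct s g X A D
  have hb : Flat (prodSpecBase s g A) :=
    MorphismProperty.of_isPullback (isPullback_prodSpecBase s g A).flip hg
  refine ⟨hc, ?_, ?_⟩
  · rw [imageHom_fibreProductOver]
    infer_instance
  · rw [imageHom_fibreProductOver]
    exact hp.paste_vert (isPullback_closedPt_prodSpecBase s g A)

theorem preservesBaseChange_fibreProduct : PreservesBaseChange (fibreProduct s g) := by
  intro X A B _ _ _ _ _ _ D E φ f hf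
  refine IsPullback.of_right (h₁₂ := (fibreProduct s g).app D.toOver) ?_
    (map_overHom_imageHom f hf.w) (isPullback_imageHom_fibreProduct g D)
  rw [prodSpecMap_prodSpecBase, (fibreProduct s g).naturality (Deformation.overHom f hf.w)]
  exact (isPullback_imageHom_fibreProduct g E).paste_horiz hf

theorem preservesBaseChange_fibreProductOver : PreservesBaseChange (fibreProductOver s g) := by
  intro X A B _ _ _ _ _ _ D E φ f hf
  rw [imageHom_fibreProductOver, imageHom_fibreProductOver]
  exact (preservesBaseChange_fibreProduct s g X A B D E φ f hf).paste_vert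
    (isPullback_prodSpecMap_prodSpecBase s g φ)

end FibreProduct

end

end

end SmoothFunctor

theorem mainTheorem3 {k : Type u} [Field k] {S Y : Scheme.{u}} (s : S ⟶ Spec (.of k))
    (g : Y ⟶ S) (hg : Flat g) :
    SmoothFunctor.IsSmoothFunctor (F := Over.pullback g) (SmoothFunctor.fibreProduct s g) ∧
    SmoothFunctor.IsSmoothFunctor (F := Over.pullback g ⋙ Over.map g)
      (SmoothFunctor.fibreProductOver s g) := by
  have hF (X : Over S) (hX : Flat X.hom) : Flat ((Over.pullback g).obj X).hom :=
    MorphismProperty.of_isPullback (IsPullback.of_hasPullback X.hom g) hX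
  refine ⟨.of_preservesBaseChange (SmoothFunctor.preservesDeformations_fibreProduct s g)
      (SmoothFunctor.preservesBaseChange_fibreProduct s g) hF,
    .of_preservesBaseChange (SmoothFunctor.preservesDeformations_fibreProductOver s g hg)
      (SmoothFunctor.preservesBaseChange_fibreProductOver s g) fun X hX ↦ ?_⟩
  -- As an `S`-scheme, `X ×_S Y` is flat through the composite with `g`.
  have := hF X hX
  exact inferInstanceAs (Flat (((Over.pullback g).obj X).hom ≫ g))
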